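/- Let $\Sigma$ be a (possibly many-sorted) first-order signature, let $\mathbb T$ be a regular theory over $\Sigma$ (sequents $\varphi\vdash_{\mathbf x}\psi$ between formulas built from atomic formulas, including equations, with $\top,\wedge,\exists$), and let $\mathbb D$ be an infinite set with $|\mathbb D|\ge|\Sigma|$. Sorts may be interpreted by empty sets. The syntactic category $\mathcal C_{\mathbb T}$ has as objects the regular formulas-in-context $\{\mathbf x.\varphi\}$ up to renaming of variables; its morphisms $\{\mathbf x.\varphi\}\to\{\mathbf y.\psi\}$ are the $\mathbb T$-provable equivalence classes of formulas $\sigma(\mathbf x,\mathbf y)$ that $\mathbb T$ proves to be functional relations from $\varphi$ to $\psi$. Let $\mathbb M_{\mathbb T}^d$ be the category of $\mathbb T$-models whose underlying sets are subsets of $\mathbb D$, with set of objects $M_{\mathbb T}$ and set of homomorphisms $H_{\mathbb T}$. Give $M_{\mathbb T}$ the coarsest topology in which the sets $\{\mathbf M: a\in A^{\mathbf M}\}$, $\{\mathbf M:\mathbf a\in R^{\mathbf M}\}$ and $\{\mathbf M: f^{\mathbf M}(\mathbf a)=b\}$ are open, for all sorts $A$, relation symbols $R$, function symbols $f$ and elements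 of $\mathbb D$. Give $H_{\mathbb T}$ the coarsest topology in which domain and codomain $H_{\mathbb T}\to M_{\mathbb T}$ are continuous and all sets $\{\mathbf f: a\in A^{\mathrm{dom}\,\mathbf f},\ f_A(a)=b\}$ are open. Let $\mathrm{Sh}_{H_{\mathbb T}}(M_{\mathbb T})$ be the category of equivariant sheaves: local homeomorphisms $r:R\to M_{\mathbb T}$ with a continuous, unital and associative action $\rho:H_{\mathbb T}\times_{M_{\mathbb T}}R\to R$ over the codomain map; morphisms are continuous maps over $M_{\mathbb T}$ that commute with the actions. Let $u^*:\mathrm{Sh}_{H_{\mathbb T}}(M_{\mathbb T})\to\mathbf{Set}^{\mathbb M_{\mathbb T}^d}$ be the forgetful functor, which sends $(R,r,\rho)$ to $\mathbf M\mapsto r^{-1}(\mathbf M)$, $\mathbf f\mapsto\rho(\mathbf f,-)$, and let $\mathrm{Ev}:\mathcal C_{\mathbb T}\to\mathbf{Set}^{\mathbb M_{\mathbb T}^d}$ be the evaluation functor, which sends $\{\mathbf x.\varphi\}$ to $\mathbf M\mapsto[\![\mathbf x.\varphi]\!]^{\mathbf M}$. For an object $\{\mathbf x.\varphi\}$ of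 $\mathcal C_{\mathbb T}$ let $[\![\mathbf x.\varphi]\!]_{M_{\mathbb T}}=\{(\mathbf M,\mathbf a):\mathbf M\in M_{\mathbb T},\ \mathbf a\in[\![\mathbf x.\varphi]\!]^{\mathbf M}\}$, with the projection $\pi$ to $M_{\mathbb T}$, the action $\theta(\mathbf f,(\mathbf M,\mathbf a))=(\mathbf N,\mathbf f(\mathbf a))$ for $\mathbf f:\mathbf M\to\mathbf N$, and the coarsest topology such that $\pi$ is continuous and, for each tuple $\mathbf a$ of elements of $\mathbb D$, the set of all its points of the form $(\mathbf M,\mathbf a)$ is open. Then each $\pi$ is a local homeomorphism, each $\theta$ is continuous, and for each morphism $[\sigma]:\{\mathbf x.\varphi\}\to\{\mathbf y.\psi\}$ of $\mathcal C_{\mathbb T}$ the map that sends $(\mathbf M,\mathbf a)$ to $(\mathbf M,\mathbf b)$, with $\mathbf b$ the unique tuple such that $\mathbf M\models\sigma(\mathbf a,\mathbf b)$, is continuous. Hence $\{\mathbf x.\varphi\}\mapsto([\![\mathbf x.\varphi]\!]_{M_{\mathbb T}},\theta)$ is the object part of a functor $\mathcal M:\mathcal C_{\mathbb T}\to\mathrm{Sh}_{H_{\mathbb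 T}}(M_{\mathbb T})$. There is a natural isomorphism $u^*\circ\mathcal M\cong\mathrm{Ev}$, given by $(\mathbf M,\mathbf a)\mapsto\mathbf a$. Moreover $\mathcal M$ is regular (it preserves finite limits and regular epimorphisms), full, faithful, and cover reflecting: if $\mathcal M$ sends a family of morphisms of $\mathcal C_{\mathbb T}$ with common codomain to a jointly epimorphic family, then some member of the family is a regular epimorphism. -/

import Mathlib

open CategoryTheory CategoryTheory.Limits

universe u v w

namespace RegLogic

/-! ### Contexts, terms, regular formulas -/

/-- A many-sorted first-order signature (equality is a logical symbol). -/
structure Signature where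
  Srt : Type u
  Fn : Type u
  Rel : Type u
  dom : Fn → List Srt
  cod : Fn → Srt
  arity : Rel → List Srt

/-- The cardinality of a signature: its number of sorts and of symbols. -/
def Signature.card (L : Signature.{u}) : Cardinal.{u} :=
  Cardinal.mk (L.Srt ⊕ L.Fn ⊕ L.Rel)

/-- A context, up to renaming of its variables, is a list of sorts. `Var Γ A` is the set of
variables of sort `A` in the context `Γ`. -/
inductive Var {S : Type u} : List S → S → Type u
  | zero {Γ : List S} {A : S} : Var (A :: Γ) A
  | succ {Γ : List S} {A B : S} : Var Γ A → Var (B :: Γ) A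

/-- A sorted list of elements of `X`, one for each variable of the context `Γ`. -/
abbrev Fam {S : Type u} (X : S → Type v) (Γ : List S) : Type (max u v) :=
  ∀ A : S, Var Γ A → X A

namespace Fam

variable {S : Type u} {X : S → Type v}

def cons {A : S} {Γ : List S} (a : X A) (g : Fam X Γ) : Fam X (A :: Γ)
  | _, .zero => a
  | _, .succ x => g _ x

/-- Concatenation of lists of elements. -/
def append : ∀ {Δ Γ : List S}, Fam X Δ → Fam X Γ → Fam X (Δ ++ Γ)
  | [], _, _, g => g
  | _ :: _, _, d, g => cons (d _ .zero) (append (fun _ x => d _ (.succ x)) g)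

end Fam

/-- The variables of the left part of a concatenated context. -/
def Var.inl {S : Type u} {Γ : List S} {A : S} : ∀ {Δ : List S}, Var Δ A → Var (Δ ++ Γ) A
  | _ :: _, .zero => .zero
  | _ :: _, .succ x => .succ (Var.inl x)

/-- The variables of the right part of a concatenated context. -/
def Var.inr {S : Type u} {Γ : List S} {A : S} : ∀ {Δ : List S}, Var Γ A → Var (Δ ++ Γ) A
  | [], x => x
  | _ :: _, x => .succ (Var.inr x)

theorem Fam.append_inl {S : Type u} {X : S → Type v} {Γ : List S} {A : S} :
    ∀ {Δ : List S} (d : Fam X Δ) (g : Fam X Γ) (x : Var Δ A),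
      Fam.append d g A (Var.inl x) = d A x
  | _ :: _, _, _, .zero => rfl
  | _ :: _, d, g, .succ x => Fam.append_inl (fun _ x => d _ (.succ x)) g x

theorem Fam.append_inr {S : Type u} {X : S → Type v} {Γ : List S} {A : S} :
    ∀ {Δ : List S} (d : Fam X Δ) (g : Fam X Γ) (x : Var Γ A),
      Fam.append d g A (Var.inr x) = g A x
  | [], _, _, _ => rfl
  | _ :: _, d, g, x => Fam.append_inr (fun _ x => d _ (.succ x)) g x

theorem Fam.append_ext {S : Type u} {X : S → Type v} {Γ : List S} :
    ∀ {Δ : List S} (h k : Fam X (Δ ++ Γ)),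
      (∀ A (x : Var Δ A), h A (Var.inl x) = k A (Var.inl x)) →
      (∀ A (x : Var Γ A), h A (Var.inr x) = k A (Var.inr x)) → h = k
  | [], h, k, _, h2 => by
      funext A x
      exact h2 A x
  | B :: Δ, h, k, h1, h2 => by
      have := Fam.append_ext (Δ := Δ) (fun A x => h A (.succ x)) (fun A x => k A (.succ x))
        (fun A x => h1 A (.succ x)) (fun A x => h2 A x)
      funext A x
      cases x with
      | zero => exact h1 _ .zero
      | succ x => exact congrFun (congrFun this A) x

section Formulas

variable (L : Signature.{u})

/-- Terms in context. -/
inductive Term (Γ : List L.Srt) : L.Srt → Type u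
  | var {A : L.Srt} : Var Γ A → Term Γ A
  | app (f : L.Fn) : (∀ A : L.Srt, Var (L.dom f) A → Term Γ A) → Term Γ (L.cod f)

/-- Regular formulas in context, up to renaming of bound and free variables. In `ex A φ` the
bound variable is the first variable of the context of `φ`. -/
inductive Formula : List L.Srt → Type u
  | top {Γ : List L.Srt} : Formula Γ
  | eq {Γ : List L.Srt} {A : L.Srt} : Term L Γ A → Term L Γ A → Formula Γ
  | rel {Γ : List L.Srt} (R : L.Rel) : Fam (Term L Γ) (L.arity R) → Formula Γ
  | and {Γ : List L.Srt} : Formula Γ → Formula Γ → Formula Γ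
  | ex {Γ : List L.Srt} (A : L.Srt) : Formula (A :: Γ) → Formula Γ

/-- Simultaneous substitutions: a term in context `Δ` for each variable in `Γ`. -/
abbrev Sub (Γ Δ : List L.Srt) : Type u := Fam (Term L Δ) Γ

end Formulas

variable {L : Signature.{u}}

def Term.subst {Γ Δ : List L.Srt} (s : Sub L Γ Δ) : ∀ {A : L.Srt}, Term L Γ A → Term L Δ A
  | _, .var x => s _ x
  | _, .app f ts => .app f (fun A x => (ts A x).subst s)

namespace Sub

def id (Γ : List L.Srt) : Sub L Γ Γ := fun _ x => .var x

def comp {Γ Δ Θ : List L.Srt} (s : Sub L Γ Δ) (t : Sub L Δ Θ) : Sub L Γ Θ :=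
  fun _ x => (s _ x).subst t

def wk (A : L.Srt) (Γ : List L.Srt) : Sub L Γ (A :: Γ) := fun _ x => .var (.succ x)

def lift (A : L.Srt) {Γ Δ : List L.Srt} (s : Sub L Γ Δ) : Sub L (A :: Γ) (A :: Δ) :=
  Fam.cons (.var .zero) (s.comp (wk A Δ))

/-- The variables of `Δ`, as terms in the context `Δ ++ Γ`. -/
def inl (Δ Γ : List L.Srt) : Sub L Δ (Δ ++ Γ) := fun _ x => .var (.inl x)

/-- The variables of `Γ`, as terms in the context `Δ ++ Γ`. -/
def inr (Δ Γ : List L.Srt) : Sub L Γ (Δ ++ Γ) := fun _ x => .var (.inr x)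

/-- The substitution on a concatenated context that is given by `d` on the left part and by `g`
on the right part. -/
def pair {Δ Γ Θ : List L.Srt} (d : Sub L Δ Θ) (g : Sub L Γ Θ) : Sub L (Δ ++ Γ) Θ :=
  Fam.append d g

end Sub

namespace Formula

def subst : ∀ {Γ Δ : List L.Srt}, Sub L Γ Δ → Formula L Γ → Formula L Δ
  | _, _, _, .top => .top
  | _, _, s, .eq t t' => .eq (t.subst s) (t'.subst s)
  | _, _, s, .rel R ts => .rel R (fun A x => (ts A x).subst s)
  | _, _, s, .and φ ψ => .and (φ.subst s) (ψ.subst s)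
  | _, _, s, .ex A φ => .ex A (φ.subst (s.lift A))

/-- Conjunction of the equations between two lists of terms. -/
def eqs : ∀ {Δ Γ : List L.Srt}, Sub L Δ Γ → Sub L Δ Γ → Formula L Γ
  | [], _, _, _ => .top
  | _ :: _, _, s, t =>
      .and (.eq (s _ .zero) (t _ .zero)) (eqs (fun _ x => s _ (.succ x)) (fun _ x => t _ (.succ x)))

/-- Existential quantification over a list of variables. -/
def exs : ∀ (Δ : List L.Srt) {Γ : List L.Srt}, Formula L (Δ ++ Γ) → Formula L Γ
  | [], _, φ => φ
  | A :: Δ, _, φ => exs Δ (.ex A φ)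

end Formula

/-! ### Regular theories and their deductive calculus -/

/-- A sequent `hyp ⊢ concl` of regular formulas in a common context. -/
structure Sequent (L : Signature.{u}) where
  ctx : List L.Srt
  hyp : Formula L ctx
  concl : Formula L ctx

/-- A regular theory, given by a set of regular sequents (its theorems are the sequents that are
provable from them). -/
abbrev RegTheory (L : Signature.{u}) := Set (Sequent L)

/-- Provability of sequents from a regular theory: the sequent calculus of regular logic. -/
inductive Provable (T : RegTheory L) : ∀ {Γ : List L.Srt}, Formula L Γ → Formula L Γ → Prop
  | ax (q : Sequent L) : q ∈ T → Provable T q.hyp q.concl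
  | refl {Γ : List L.Srt} (φ : Formula L Γ) : Provable T φ φ
  | cut {Γ : List L.Srt} {φ ψ χ : Formula L Γ} :
      Provable T φ ψ → Provable T ψ χ → Provable T φ χ
  | subst {Γ Δ : List L.Srt} {φ ψ : Formula L Γ} (s : Sub L Γ Δ) :
      Provable T φ ψ → Provable T (φ.subst s) (ψ.subst s)
  | eq_refl {Γ : List L.Srt} {A : L.Srt} (t : Term L Γ A) : Provable T .top (.eq t t)
  | eq_subst {Γ Δ : List L.Srt} (s t : Sub L Δ Γ) (φ : Formula L Δ) :
      Provable T (.and (Formula.eqs s t) (φ.subst s)) (φ.subst t)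
  | top_intro {Γ : List L.Srt} (φ : Formula L Γ) : Provable T φ .top
  | and_left {Γ : List L.Srt} (φ ψ : Formula L Γ) : Provable T (.and φ ψ) φ
  | and_right {Γ : List L.Srt} (φ ψ : Formula L Γ) : Provable T (.and φ ψ) ψ
  | and_intro {Γ : List L.Srt} {φ ψ χ : Formula L Γ} :
      Provable T φ ψ → Provable T φ χ → Provable T φ (.and ψ χ)
  | ex_elim {Γ : List L.Srt} {A : L.Srt} {φ : Formula L (A :: Γ)} {ψ : Formula L Γ} :
      Provable T φ (ψ.subst (Sub.wk A Γ)) → Provable T (.ex A φ) ψ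
  | ex_intro {Γ : List L.Srt} {A : L.Srt} {φ : Formula L (A :: Γ)} {ψ : Formula L Γ} :
      Provable T (.ex A φ) ψ → Provable T φ (ψ.subst (Sub.wk A Γ))
  | frobenius {Γ : List L.Srt} {A : L.Srt} (φ : Formula L Γ) (ψ : Formula L (A :: Γ)) :
      Provable T (.and φ (.ex A ψ)) (.ex A (.and (φ.subst (Sub.wk A Γ)) ψ))

/-! ### Algebra of substitutions -/

theorem Term.subst_subst {Γ Δ Θ : List L.Srt} (s : Sub L Γ Δ) (t : Sub L Δ Θ) :
    ∀ {A : L.Srt} (a : Term L Γ A), (a.subst s).subst t = a.subst (s.comp t)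
  | _, .var x => rfl
  | _, .app f ts => by
      simp only [Term.subst]
      congr 1
      funext A x
      exact Term.subst_subst s t (ts A x)

theorem Term.subst_id {Γ : List L.Srt} :
    ∀ {A : L.Srt} (a : Term L Γ A), a.subst (Sub.id Γ) = a
  | _, .var x => rfl
  | _, .app f ts => by
      simp only [Term.subst]
      congr 1
      funext A x
      exact Term.subst_id (ts A x)

namespace Sub

variable {Γ Δ Θ Ξ : List L.Srt}

theorem comp_assoc (s : Sub L Γ Δ) (t : Sub L Δ Θ) (r : Sub L Θ Ξ) :
    (s.comp t).comp r = s.comp (t.comp r) := by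
  funext A x
  exact Term.subst_subst t r (s A x)

theorem id_comp (s : Sub L Γ Δ) : (Sub.id Γ).comp s = s := rfl

theorem comp_id (s : Sub L Γ Δ) : s.comp (Sub.id Δ) = s := by
  funext A x
  exact Term.subst_id (s A x)

theorem inl_pair (d : Sub L Δ Θ) (g : Sub L Γ Θ) : (inl Δ Γ).comp (pair d g) = d := by
  funext A x
  exact Fam.append_inl d g x

theorem inr_pair (d : Sub L Δ Θ) (g : Sub L Γ Θ) : (inr Δ Γ).comp (pair d g) = g := by
  funext A x
  exact Fam.append_inr d g x

theorem pair_ext {s t : Sub L (Δ ++ Γ) Θ} (h1 : (inl Δ Γ).comp s = (inl Δ Γ).comp t)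
    (h2 : (inr Δ Γ).comp s = (inr Δ Γ).comp t) : s = t :=
  Fam.append_ext s t (fun A x => congrFun (congrFun h1 A) x)
    (fun A x => congrFun (congrFun h2 A) x)

theorem pair_comp (d : Sub L Δ Θ) (g : Sub L Γ Θ) (r : Sub L Θ Ξ) :
    (pair d g).comp r = pair (d.comp r) (g.comp r) := by
  apply pair_ext
  · rw [← comp_assoc, inl_pair, inl_pair]
  · rw [← comp_assoc, inr_pair, inr_pair]

theorem pair_inl_inr : pair (inl Δ Γ) (inr Δ Γ) = Sub.id (Δ ++ Γ) := by
  apply pair_ext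
  · rw [inl_pair, comp_id]
  · rw [inr_pair, comp_id]

theorem wk_cons {A : L.Srt} (a : Term L Δ A) (s : Sub L Γ Δ) :
    (wk A Γ).comp (Fam.cons a s) = s := rfl

theorem wk_lift {A : L.Srt} (s : Sub L Γ Δ) :
    (wk A Γ).comp (s.lift A) = s.comp (wk A Δ) := rfl

theorem lift_comp {A : L.Srt} (s : Sub L Γ Δ) (t : Sub L Δ Θ) :
    (s.lift A).comp (t.lift A) = (s.comp t).lift A := by
  funext B x
  cases x with
  | zero => rfl
  | succ x =>
    change ((s B x).subst (wk A Δ)).subst (t.lift A) = ((s B x).subst t).subst (wk A Θ)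
    rw [Term.subst_subst, Term.subst_subst, wk_lift]

theorem lift_id {A : L.Srt} : (Sub.id Γ).lift A = Sub.id (A :: Γ) := by
  funext B x
  cases x <;> rfl

end Sub

namespace Formula

theorem subst_subst : ∀ {Γ Δ Θ : List L.Srt} (s : Sub L Γ Δ) (t : Sub L Δ Θ) (φ : Formula L Γ),
    (φ.subst s).subst t = φ.subst (s.comp t)
  | _, _, _, _, _, .top => rfl
  | _, _, _, s, t, .eq a b => by
      simp only [subst, Term.subst_subst]
  | _, _, _, s, t, .rel R ts => by
      simp only [subst, Term.subst_subst]
  | _, _, _, s, t, .and φ ψ => by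
      simp only [subst, subst_subst s t]
  | _, _, _, s, t, .ex A φ => by
      simp only [subst, subst_subst (s.lift A) (t.lift A), Sub.lift_comp]

theorem subst_id : ∀ {Γ : List L.Srt} (φ : Formula L Γ), φ.subst (Sub.id Γ) = φ
  | _, .top => rfl
  | _, .eq a b => by
      simp only [subst, Term.subst_id]
  | _, .rel R ts => by
      simp only [subst, Term.subst_id]
  | _, .and φ ψ => by
      simp only [subst, subst_id]
  | _, .ex A φ => by
      simp only [subst, Sub.lift_id, subst_id]

theorem subst_eqs : ∀ {Δ Γ Θ : List L.Srt} (s t : Sub L Δ Γ) (r : Sub L Γ Θ),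
    (eqs s t).subst r = eqs (s.comp r) (t.comp r)
  | [], _, _, _, _, _ => rfl
  | _ :: _, _, _, s, t, r => by
      simp only [eqs, subst, subst_eqs _ _ r]
      rfl

end Formula

/-! ### Derived rules -/

namespace Provable

variable {T : RegTheory L} {Γ Δ Θ : List L.Srt}

theorem hyp_left {φ ψ χ : Formula L Γ} (h : Provable T φ χ) : Provable T (.and φ ψ) χ :=
  .cut (.and_left _ _) h

theorem hyp_right {φ ψ χ : Formula L Γ} (h : Provable T ψ χ) : Provable T (.and φ ψ) χ :=
  .cut (.and_right _ _) h

theorem exs_elim : ∀ {Δ : List L.Srt} {φ : Formula L (Δ ++ Γ)} {ψ : Formula L Γ},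
    Provable T φ (ψ.subst (Sub.inr Δ Γ)) → Provable T (Formula.exs Δ φ) ψ
  | [], φ, ψ, h => by
      have e : Sub.inr [] Γ = Sub.id Γ := rfl
      rw [e, Formula.subst_id] at h
      exact h
  | A :: Δ, φ, ψ, h => by
      apply exs_elim (Δ := Δ)
      apply Provable.ex_elim
      rw [Formula.subst_subst]
      exact h

theorem exs_intro_var : ∀ {Δ : List L.Srt} (φ : Formula L (Δ ++ Γ)),
    Provable T φ ((Formula.exs Δ φ).subst (Sub.inr Δ Γ))
  | [], φ => by
      have e : Sub.inr [] Γ = Sub.id Γ := rfl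
      rw [e, Formula.subst_id]
      exact .refl _
  | A :: Δ, φ => by
      have h := exs_intro_var (Δ := Δ) (.ex A φ)
      have h2 := Provable.ex_intro h
      rw [Formula.subst_subst] at h2
      exact h2

theorem exs_frobenius (ξ : Formula L Γ) : ∀ {Δ : List L.Srt} (φ : Formula L (Δ ++ Γ)),
    Provable T (.and ξ (Formula.exs Δ φ)) (Formula.exs Δ (.and (ξ.subst (Sub.inr Δ Γ)) φ))
  | [], φ => by
      have e : Sub.inr [] Γ = Sub.id Γ := rfl
      rw [e, Formula.subst_id]
      exact .refl _
  | A :: Δ, φ => by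
      refine .cut (exs_frobenius ξ (Δ := Δ) (.ex A φ)) ?_
      refine exs_elim (Δ := Δ) (.cut (.frobenius _ _) ?_)
      rw [Formula.subst_subst]
      exact exs_intro_var (Δ := Δ) (.ex A (.and (ξ.subst (Sub.inr (A :: Δ) Γ)) φ))

theorem exs_intro {ξ : Formula L Θ} {φ : Formula L (Δ ++ Γ)} (g : Sub L Γ Θ) (d : Sub L Δ Θ)
    (h : Provable T ξ (φ.subst (Sub.pair d g))) :
    Provable T ξ ((Formula.exs Δ φ).subst g) := by
  have h2 := Provable.subst (Sub.pair d g) (exs_intro_var (T := T) φ)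
  rw [Formula.subst_subst, Sub.inr_pair] at h2
  exact h.cut h2

/-- To use an existential statement, extend the context by fresh variables. -/
theorem exs_use {ξ ψ : Formula L Θ} {φ : Formula L (Δ ++ Γ)} {g : Sub L Γ Θ}
    (h : Provable T ξ ((Formula.exs Δ φ).subst g))
    (k : Provable T (.and (ξ.subst (Sub.inr Δ Θ))
      (φ.subst (Sub.pair (Sub.inl Δ Θ) (g.comp (Sub.inr Δ Θ))))) (ψ.subst (Sub.inr Δ Θ))) :
    Provable T ξ ψ := by
  have h1 : Provable T ((Formula.exs Δ φ).subst g)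
      (Formula.exs Δ (φ.subst (Sub.pair (Sub.inl Δ Θ) (g.comp (Sub.inr Δ Θ))))) := by
    have h2 : Provable T (Formula.exs Δ φ) ((Formula.exs Δ (φ.subst
        (Sub.pair (Sub.inl Δ Γ) (Sub.inr Δ Γ))))) := by
      rw [Sub.pair_inl_inr, Formula.subst_id]
      exact .refl _
    have h3 : ∀ {Δ : List L.Srt} (φ : Formula L (Δ ++ Γ)),
        (Formula.exs Δ φ).subst g =
          Formula.exs Δ (φ.subst (Sub.pair (Sub.inl Δ Θ) (g.comp (Sub.inr Δ Θ)))) := by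
      intro Δ
      induction Δ with
      | nil =>
        intro φ
        have e : g = Sub.pair (Sub.inl [] Θ) (g.comp (Sub.inr [] Θ)) :=
          (Sub.comp_id g).symm
        exact congrArg (fun s => φ.subst s) e
      | cons A Δ ih =>
        intro φ
        change (Formula.exs Δ (.ex A φ)).subst g = _
        rw [ih]
        change Formula.exs Δ (.ex A _) = Formula.exs Δ (.ex A _)
        congr 2
        congr 1
        apply Sub.pair_ext (Δ := A :: Δ)
        · rw [Sub.inl_pair]
          funext B x
          cases x with
          | zero => rfl
          | succ x =>
            change ((Sub.pair (Sub.inl Δ Θ) (g.comp (Sub.inr Δ Θ))) B (Var.inl x)).subst _ = _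
            have := congrFun (congrFun (Sub.inl_pair (Sub.inl Δ Θ) (g.comp (Sub.inr Δ Θ))) B) x
            change (Sub.pair (Sub.inl Δ Θ) (g.comp (Sub.inr Δ Θ))) B (Var.inl x) = _ at this
            rw [this]
            rfl
        · rw [Sub.inr_pair]
          funext B x
          change ((Sub.pair (Sub.inl Δ Θ) (g.comp (Sub.inr Δ Θ))) B (Var.inr x)).subst _ = _
          have := congrFun (congrFun (Sub.inr_pair (Sub.inl Δ Θ) (g.comp (Sub.inr Δ Θ))) B) x
          change (Sub.pair (Sub.inl Δ Θ) (g.comp (Sub.inr Δ Θ))) B (Var.inr x) = _ at this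
          rw [this]
          change ((g B x).subst _).subst _ = (g B x).subst _
          rw [Term.subst_subst]
          rfl
    rw [h3]
    exact .refl _
  exact (Provable.and_intro (.refl _) (h.cut h1)).cut ((exs_frobenius ξ _).cut (exs_elim k))

theorem eqs_intro : ∀ {Δ : List L.Srt} {ξ : Formula L Γ} {s t : Sub L Δ Γ},
    (∀ A x, Provable T ξ (.eq (s A x) (t A x))) → Provable T ξ (Formula.eqs s t)
  | [], _, _, _, _ => .top_intro _
  | _ :: _, _, _, _, h =>
      .and_intro (h _ .zero) (eqs_intro (fun A x => h A (.succ x)))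

theorem eqs_refl (ξ : Formula L Γ) (s : Sub L Δ Γ) : Provable T ξ (Formula.eqs s s) :=
  eqs_intro (fun _ _ => .cut (.top_intro _) (.eq_refl _))

theorem eqs_use {ξ : Formula L Γ} {s t : Sub L Δ Γ} (φ : Formula L Δ)
    (h : Provable T ξ (Formula.eqs s t)) (k : Provable T ξ (φ.subst s)) :
    Provable T ξ (φ.subst t) :=
  (Provable.and_intro h k).cut (.eq_subst s t φ)

theorem eqs_pair {ξ : Formula L Γ} {s t : Sub L Δ Γ} {s' t' : Sub L Θ Γ}
    (h : Provable T ξ (Formula.eqs s t)) (h' : Provable T ξ (Formula.eqs s' t')) :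
    Provable T ξ (Formula.eqs (Sub.pair s s') (Sub.pair t t')) := by
  induction Δ with
  | nil => exact h'
  | cons A Δ ih => exact .and_intro (h.cut (.and_left _ _)) (ih (h.cut (.and_right _ _)))

theorem eqs_symm {ξ : Formula L Γ} {s t : Sub L Δ Γ} (h : Provable T ξ (Formula.eqs s t)) :
    Provable T ξ (Formula.eqs t s) := by
  have k := eqs_use (T := T) (ξ := ξ) (s := Sub.pair s s) (t := Sub.pair t s)
    (Formula.eqs (Sub.inl Δ Δ) (Sub.inr Δ Δ))
  rw [Formula.subst_eqs, Formula.subst_eqs, Sub.inl_pair, Sub.inl_pair, Sub.inr_pair,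
    Sub.inr_pair] at k
  exact k (eqs_pair h (eqs_refl _ _)) (eqs_refl _ _)

theorem eqs_trans {ξ : Formula L Γ} {s t r : Sub L Δ Γ} (h : Provable T ξ (Formula.eqs s t))
    (h' : Provable T ξ (Formula.eqs t r)) : Provable T ξ (Formula.eqs s r) := by
  have k := eqs_use (T := T) (ξ := ξ) (s := Sub.pair t r) (t := Sub.pair s r)
    (Formula.eqs (Sub.inl Δ Δ) (Sub.inr Δ Δ))
  rw [Formula.subst_eqs, Formula.subst_eqs, Sub.inl_pair, Sub.inl_pair, Sub.inr_pair,
    Sub.inr_pair] at k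
  exact k (eqs_pair (eqs_symm h) (eqs_refl _ _)) h'

end Provable

/-! ### The syntactic category -/

/-- `σ(y, x)`, in the context `Δ ++ Γ`, is provably a functional relation from `φ(x)` to `ψ(y)`. -/
structure IsFunctional (T : RegTheory L) {Γ Δ : List L.Srt} (φ : Formula L Γ) (ψ : Formula L Δ)
    (σ : Formula L (Δ ++ Γ)) : Prop where
  dom : Provable T σ (φ.subst (Sub.inr Δ Γ))
  cod : Provable T σ (ψ.subst (Sub.inl Δ Γ))
  total : Provable T φ (Formula.exs Δ σ)
  /-- In the context `y, y', x`: from `σ(y, x)` and `σ(y', x)` follows `y = y'`. -/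
  unique : Provable T
    (.and (σ.subst (Sub.pair (Sub.inl Δ (Δ ++ Γ)) ((Sub.inr Δ Γ).comp (Sub.inr Δ (Δ ++ Γ)))))
      (σ.subst (Sub.pair ((Sub.inl Δ Γ).comp (Sub.inr Δ (Δ ++ Γ)))
        ((Sub.inr Δ Γ).comp (Sub.inr Δ (Δ ++ Γ))))))
    (Formula.eqs (Sub.inl Δ (Δ ++ Γ)) ((Sub.inl Δ Γ).comp (Sub.inr Δ (Δ ++ Γ))))

namespace Formula

/-- The formula `φ(x) ∧ y = x` in the context `y, x`. -/
def idRel {Γ : List L.Srt} (φ : Formula L Γ) : Formula L (Γ ++ Γ) :=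
  .and (φ.subst (Sub.inr Γ Γ)) (eqs (Sub.inl Γ Γ) (Sub.inr Γ Γ))

/-- The formula `∃ y, σ(y, x) ∧ τ(z, y)` in the context `z, x`. -/
def compRel {Γ Δ Θ : List L.Srt} (σ : Formula L (Δ ++ Γ)) (τ : Formula L (Θ ++ Δ)) :
    Formula L (Θ ++ Γ) :=
  exs Δ (.and
    (σ.subst (Sub.pair (Sub.inl Δ (Θ ++ Γ)) ((Sub.inr Θ Γ).comp (Sub.inr Δ (Θ ++ Γ)))))
    (τ.subst (Sub.pair ((Sub.inl Θ Γ).comp (Sub.inr Δ (Θ ++ Γ))) (Sub.inl Δ (Θ ++ Γ)))))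

theorem subst_pair_inl_inr {Γ Δ : List L.Srt} (σ : Formula L (Δ ++ Γ)) :
    σ.subst (Sub.pair (Sub.inl Δ Γ) (Sub.inr Δ Γ)) = σ := by
  rw [Sub.pair_inl_inr, subst_id]

theorem subst_eq_pair {Γ Δ Θ : List L.Srt} (σ : Formula L (Δ ++ Γ)) (s : Sub L (Δ ++ Γ) Θ) :
    σ.subst s = σ.subst (Sub.pair ((Sub.inl Δ Γ).comp s) ((Sub.inr Δ Γ).comp s)) := by
  congr 1
  apply Sub.pair_ext
  · rw [Sub.inl_pair]
  · rw [Sub.inr_pair]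

end Formula

namespace IsFunctional

variable {T : RegTheory L} {Γ Δ Θ Ξ : List L.Srt} {φ : Formula L Γ} {ψ : Formula L Δ}
  {χ : Formula L Θ} {σ σ' : Formula L (Δ ++ Γ)} {τ τ' : Formula L (Θ ++ Δ)} {ξ : Formula L Ξ}

theorem dom_at (h : IsFunctional T φ ψ σ) {d : Sub L Δ Ξ} {g : Sub L Γ Ξ}
    (k : Provable T ξ (σ.subst (Sub.pair d g))) : Provable T ξ (φ.subst g) := by
  have := h.dom.subst (Sub.pair d g)
  rw [Formula.subst_subst, Sub.inr_pair] at this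
  exact k.cut this

theorem cod_at (h : IsFunctional T φ ψ σ) {d : Sub L Δ Ξ} {g : Sub L Γ Ξ}
    (k : Provable T ξ (σ.subst (Sub.pair d g))) : Provable T ξ (ψ.subst d) := by
  have := h.cod.subst (Sub.pair d g)
  rw [Formula.subst_subst, Sub.inl_pair] at this
  exact k.cut this

theorem total_at (h : IsFunctional T φ ψ σ) {g : Sub L Γ Ξ}
    (k : Provable T ξ (φ.subst g)) : Provable T ξ ((Formula.exs Δ σ).subst g) :=
  k.cut (h.total.subst g)

theorem unique_at (h : IsFunctional T φ ψ σ) {d d' : Sub L Δ Ξ} {g : Sub L Γ Ξ}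
    (k : Provable T ξ (σ.subst (Sub.pair d g))) (k' : Provable T ξ (σ.subst (Sub.pair d' g))) :
    Provable T ξ (Formula.eqs d d') := by
  have := h.unique.subst (Sub.pair d (Sub.pair d' g))
  simp only [Formula.subst, Formula.subst_subst, Formula.subst_eqs, Sub.pair_comp, Sub.inl_pair,
    Sub.inr_pair, Sub.comp_assoc] at this
  exact (Provable.and_intro k k').cut this

theorem compRel_intro {d : Sub L Δ Ξ} {g : Sub L Γ Ξ} {e : Sub L Θ Ξ}
    (k : Provable T ξ (σ.subst (Sub.pair d g))) (k' : Provable T ξ (τ.subst (Sub.pair e d))) :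
    Provable T ξ ((Formula.compRel σ τ).subst (Sub.pair e g)) := by
  apply Provable.exs_intro _ d
  simp only [Formula.subst, Formula.subst_subst, Sub.pair_comp, Sub.inl_pair,
    Sub.inr_pair, Sub.comp_assoc]
  exact .and_intro k k'

theorem compRel_use {g : Sub L Γ Ξ} {e : Sub L Θ Ξ} {ζ : Formula L Ξ}
    (k : Provable T ξ ((Formula.compRel σ τ).subst (Sub.pair e g)))
    (k' : ∀ ω : Formula L (Δ ++ Ξ), Provable T ω (ξ.subst (Sub.inr Δ Ξ)) →
      Provable T ω (σ.subst (Sub.pair (Sub.inl Δ Ξ) (g.comp (Sub.inr Δ Ξ)))) →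
      Provable T ω (τ.subst (Sub.pair (e.comp (Sub.inr Δ Ξ)) (Sub.inl Δ Ξ))) →
      Provable T ω (ζ.subst (Sub.inr Δ Ξ))) :
    Provable T ξ ζ := by
  apply Provable.exs_use k
  simp only [Formula.subst, Formula.subst_subst, Sub.pair_comp, Sub.inl_pair,
    Sub.inr_pair, Sub.comp_assoc]
  exact k' _ (.and_left _ _) (.hyp_right (.and_left _ _)) (.hyp_right (.and_right _ _))

theorem exs_use' {g : Sub L Γ Ξ} {ζ : Formula L Ξ} (k : Provable T ξ ((Formula.exs Δ σ).subst g))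
    (k' : ∀ ω : Formula L (Δ ++ Ξ), Provable T ω (ξ.subst (Sub.inr Δ Ξ)) →
      Provable T ω (σ.subst (Sub.pair (Sub.inl Δ Ξ) (g.comp (Sub.inr Δ Ξ)))) →
      Provable T ω (ζ.subst (Sub.inr Δ Ξ))) :
    Provable T ξ ζ :=
  Provable.exs_use k (k' _ (.and_left _ _) (.and_right _ _))

/-- Entailment between functional relations is symmetric. -/
theorem symm_of_le (h : IsFunctional T φ ψ σ) (h' : IsFunctional T φ ψ σ')
    (k : Provable T σ σ') : Provable T σ' σ := by
  refine exs_use' (h.total_at h'.dom) ?_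
  intro ω h1 h2
  have h3 := h2.cut (k.subst _)
  rw [Formula.subst_eq_pair] at h1 ⊢
  exact Provable.eqs_use σ (Provable.eqs_pair (h'.unique_at h3 h1) (Provable.eqs_refl _ _)) h2

theorem mk_at (h1 : Provable T σ (φ.subst (Sub.inr Δ Γ))) (h2 : Provable T σ (ψ.subst (Sub.inl Δ Γ)))
    (h3 : Provable T φ ((Formula.exs Δ σ).subst (Sub.id Γ)))
    (h4 : ∀ {Ξ : List L.Srt} (ξ : Formula L Ξ) (d d' : Sub L Δ Ξ) (g : Sub L Γ Ξ),
      Provable T ξ (σ.subst (Sub.pair d g)) → Provable T ξ (σ.subst (Sub.pair d' g)) →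
      Provable T ξ (Formula.eqs d d')) : IsFunctional T φ ψ σ where
  dom := h1
  cod := h2
  total := by
    rw [Formula.subst_id] at h3
    exact h3
  unique := h4 _ _ _ _ (.and_left _ _) (.and_right _ _)

theorem idRel (φ : Formula L Γ) : IsFunctional T φ φ φ.idRel := by
  apply mk_at
  · exact .and_left _ _
  · exact Provable.eqs_use φ (Provable.eqs_symm (.and_right _ _)) (.and_left _ _)
  · apply Provable.exs_intro _ (Sub.id Γ)
    simp only [Formula.idRel, Formula.subst, Formula.subst_subst, Formula.subst_eqs,
      Sub.inl_pair, Sub.inr_pair, Formula.subst_id]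
    exact .and_intro (.refl _) (Provable.eqs_refl _ _)
  · intro Ξ ξ d d' g h h'
    simp only [Formula.idRel, Formula.subst, Formula.subst_subst, Formula.subst_eqs,
      Sub.inl_pair, Sub.inr_pair] at h h'
    exact Provable.eqs_trans (h.cut (.and_right _ _))
      (Provable.eqs_symm (h'.cut (.and_right _ _)))

theorem compRel (h : IsFunctional T φ ψ σ) (h' : IsFunctional T ψ χ τ) :
    IsFunctional T φ χ (Formula.compRel σ τ) := by
  have e : Provable T (Formula.compRel σ τ)
      ((Formula.compRel σ τ).subst (Sub.pair (Sub.inl Θ Γ) (Sub.inr Θ Γ))) := by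
    rw [Formula.subst_pair_inl_inr]
    exact .refl _
  apply mk_at
  · refine compRel_use e ?_
    intro ω _ h2 _
    rw [Formula.subst_subst]
    exact h.dom_at h2
  · refine compRel_use e ?_
    intro ω _ _ h3
    rw [Formula.subst_subst]
    exact h'.cod_at h3
  · refine exs_use' (g := Sub.id Γ) (h.total_at (by rw [Formula.subst_id]; exact .refl _)) ?_
    intro ω _ h2
    refine exs_use' (h'.total_at (h.cod_at h2)) ?_
    intro ω' h3 h4
    rw [Formula.subst_subst, Formula.subst_subst]
    apply Provable.exs_intro _ (Sub.inl Θ (Δ ++ Γ))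
    refine compRel_intro ?_ h4
    simpa only [Sub.pair_comp, Sub.comp_assoc, Sub.id_comp, Formula.subst_subst] using
      h3.cut (h2.subst _)
  · intro Ξ ξ d d' g k k'
    refine compRel_use k ?_
    intro ω h1 h2 h3
    have k2 := h1.cut (k'.subst _)
    rw [Formula.subst_subst, Sub.pair_comp] at k2
    refine compRel_use k2 ?_
    intro ω' h4 h5 h6
    have h7 := h4.cut (h2.subst _)
    have h8 := h4.cut (h3.subst _)
    rw [Formula.subst_subst, Sub.pair_comp] at h7 h8
    rw [Formula.subst_eqs, Formula.subst_eqs]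
    exact h'.unique_at (Provable.eqs_use τ
      (Provable.eqs_pair (Provable.eqs_refl _ _) (h.unique_at h7 h5)) h8) h6

end IsFunctional

/-- The objects of the syntactic category: formulas in context. -/
structure SynCat (T : RegTheory L) where
  ctx : List L.Srt
  form : Formula L ctx

namespace SynCat

variable {T : RegTheory L}

/-- Formulas that are provably functional from `X` to `Y`. -/
def FunRel (X Y : SynCat T) : Type u :=
  {σ : Formula L (Y.ctx ++ X.ctx) // IsFunctional T X.form Y.form σ}

/-- Provable equivalence. -/
def funSetoid (X Y : SynCat T) : Setoid (FunRel X Y) where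
  r σ τ := Provable T σ.1 τ.1 ∧ Provable T τ.1 σ.1
  iseqv :=
    { refl := fun _ => ⟨.refl _, .refl _⟩
      symm := fun h => ⟨h.2, h.1⟩
      trans := fun h k => ⟨h.1.cut k.1, k.2.cut h.2⟩ }

theorem FunRel.sound {X Y : SynCat T} {σ τ : FunRel X Y} (h : Provable T σ.1 τ.1) :
    Quotient.mk (funSetoid X Y) σ = Quotient.mk (funSetoid X Y) τ :=
  Quotient.sound ⟨h, σ.2.symm_of_le τ.2 h⟩

/-- The syntactic category: a morphism is a class of functional formulas up to provable
equivalence. -/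
instance : Category.{u} (SynCat T) where
  Hom X Y := _root_.Quotient (funSetoid X Y)
  id X := Quotient.mk (funSetoid X X) ⟨X.form.idRel, IsFunctional.idRel _⟩
  comp := Quotient.map₂ (fun σ τ => ⟨Formula.compRel σ.1 τ.1, σ.2.compRel τ.2⟩) (by
    have key : ∀ {Γ Δ Θ : List L.Srt} {σ σ' : Formula L (Δ ++ Γ)} {τ τ' : Formula L (Θ ++ Δ)},
        Provable T σ σ' → Provable T τ τ' →
          Provable T (Formula.compRel σ τ) (Formula.compRel σ' τ') := by
      intro Γ Δ Θ σ σ' τ τ' h k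
      have e : Provable T (Formula.compRel σ τ)
          ((Formula.compRel σ τ).subst (Sub.pair (Sub.inl Θ Γ) (Sub.inr Θ Γ))) := by
        rw [Formula.subst_pair_inl_inr]
        exact .refl _
      refine IsFunctional.compRel_use e ?_
      intro ω _ h2 h3
      rw [Formula.subst_eq_pair]
      exact IsFunctional.compRel_intro (h2.cut (h.subst _)) (h3.cut (k.subst _))
    intro σ σ' h τ τ' k
    exact ⟨key h.1 k.1, key h.2 k.2⟩)
  id_comp := by
    rintro X Y ⟨σ⟩
    refine FunRel.sound ?_
    refine IsFunctional.compRel_use (e := Sub.inl _ _) (g := Sub.inr _ _)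
      (by rw [Formula.subst_pair_inl_inr]; exact .refl _) ?_
    intro ω _ h2 h3
    rw [Formula.subst_eq_pair]
    simp only [Formula.idRel, Formula.subst, Formula.subst_subst, Formula.subst_eqs,
      Sub.inl_pair, Sub.inr_pair] at h2
    exact Provable.eqs_use σ.1
      (Provable.eqs_pair (Provable.eqs_refl _ _) (h2.cut (.and_right _ _))) h3
  comp_id := by
    rintro X Y ⟨σ⟩
    refine FunRel.sound ?_
    refine IsFunctional.compRel_use (e := Sub.inl _ _) (g := Sub.inr _ _)
      (by rw [Formula.subst_pair_inl_inr]; exact .refl _) ?_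
    intro ω _ h2 h3
    rw [Formula.subst_eq_pair]
    simp only [Formula.idRel, Formula.subst, Formula.subst_subst, Formula.subst_eqs,
      Sub.inl_pair, Sub.inr_pair] at h3
    exact Provable.eqs_use σ.1
      (Provable.eqs_pair (Provable.eqs_symm (h3.cut (.and_right _ _))) (Provable.eqs_refl _ _)) h2
  assoc := by
    rintro X Y Z W ⟨σ⟩ ⟨τ⟩ ⟨ρ⟩
    refine FunRel.sound ?_
    refine IsFunctional.compRel_use (e := Sub.inl _ _) (g := Sub.inr _ _)
      (by rw [Formula.subst_pair_inl_inr]; exact .refl _) ?_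
    intro ω _ h2 h3
    refine IsFunctional.compRel_use h2 ?_
    intro ω' h4 h5 h6
    have h7 := h4.cut (h3.subst _)
    rw [Formula.subst_subst, Sub.pair_comp] at h7
    rw [Formula.subst_subst, Formula.subst_eq_pair]
    exact IsFunctional.compRel_intro h5 (IsFunctional.compRel_intro h6 h7)

end SynCat

/-! ### Structures with elements from a fixed set, models, homomorphisms -/

/-- A structure whose underlying sets are subsets of `D`. -/
structure StrIn (L : Signature.{u}) (D : Type u) where
  carrier : L.Srt → Set D
  fn : ∀ f : L.Fn, Fam (fun A => carrier A) (L.dom f) → carrier (L.cod f)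
  rel : ∀ R : L.Rel, Set (Fam (fun A => carrier A) (L.arity R))

namespace StrIn

variable {D : Type u} (M : StrIn L D)

/-- Interpretations of the variables of a context, i.e. typed tuples of elements of `M`. -/
abbrev Env (Γ : List L.Srt) : Type u := Fam (fun A => M.carrier A) Γ

/-- Extension of a tuple by an interpretation of a new first variable. -/
def consEnv {A : L.Srt} {Γ : List L.Srt} (a : M.carrier A) (e : M.Env Γ) : M.Env (A :: Γ) :=
  Fam.cons (X := fun A => M.carrier A) a e

def eval (M : StrIn L D) {Γ : List L.Srt} (e : M.Env Γ) : ∀ {A : L.Srt}, Term L Γ A → M.carrier A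
  | _, .var x => e _ x
  | _, .app f ts => M.fn f (fun _ x => M.eval e (ts _ x))

/-- `M.sat φ a` says that the tuple `a` lies in the interpretation of `φ` in `M`. -/
def sat (M : StrIn L D) : ∀ {Γ : List L.Srt}, Formula L Γ → M.Env Γ → Prop
  | _, .top, _ => True
  | _, .eq s t, e => M.eval e s = M.eval e t
  | _, .rel R ts, e => (fun A x => M.eval e (ts A x)) ∈ M.rel R
  | _, .and φ ψ, e => M.sat φ e ∧ M.sat ψ e
  | _, .ex A φ, e => ∃ a : M.carrier A, M.sat φ (M.consEnv a e)

def evalSub {Γ Δ : List L.Srt} (s : Sub L Γ Δ) (e : M.Env Δ) : M.Env Γ :=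
  fun A x => M.eval e (s A x)

def Holds (q : Sequent L) : Prop := ∀ e : M.Env q.ctx, M.sat q.hyp e → M.sat q.concl e

variable {M}

theorem eval_subst {Γ Δ : List L.Srt} (s : Sub L Γ Δ) (e : M.Env Δ) :
    ∀ {A : L.Srt} (t : Term L Γ A), M.eval e (t.subst s) = M.eval (M.evalSub s e) t
  | _, .var x => rfl
  | _, .app f ts => by
      simp only [Term.subst, eval]
      congr 1
      funext A x
      exact eval_subst s e (ts A x)

theorem evalSub_lift {Γ Δ : List L.Srt} {A : L.Srt} (s : Sub L Γ Δ) (e : M.Env Δ)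
    (a : M.carrier A) :
    M.evalSub (s.lift A) (M.consEnv a e) = M.consEnv a (M.evalSub s e) := by
  funext B x
  cases x with
  | zero => rfl
  | succ x => exact eval_subst _ _ _

theorem sat_subst : ∀ {Γ Δ : List L.Srt} (s : Sub L Γ Δ) (e : M.Env Δ) (φ : Formula L Γ),
    M.sat (φ.subst s) e ↔ M.sat φ (M.evalSub s e)
  | _, _, _, _, .top => Iff.rfl
  | _, _, s, e, .eq a b => by
      simp only [Formula.subst, sat, eval_subst]
  | _, _, s, e, .rel R ts => by
      simp only [Formula.subst, sat, eval_subst]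
  | _, _, s, e, .and φ ψ => by
      simp only [Formula.subst, sat, sat_subst s e]
  | _, _, s, e, .ex A φ => by
      simp only [Formula.subst, sat, sat_subst (s.lift A), evalSub_lift]

theorem sat_eqs : ∀ {Δ Γ : List L.Srt} (s t : Sub L Δ Γ) (e : M.Env Γ),
    M.sat (Formula.eqs s t) e ↔ M.evalSub s e = M.evalSub t e
  | [], _, s, t, e => by
      refine ⟨fun _ => ?_, fun _ => trivial⟩
      funext A x
      nomatch x
  | B :: Δ, _, s, t, e => by
      simp only [Formula.eqs, sat, sat_eqs (Δ := Δ)]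
      constructor
      · rintro ⟨h1, h2⟩
        funext A x
        cases x with
        | zero => exact h1
        | succ x => exact congrFun (congrFun h2 A) x
      · intro h
        refine ⟨congrFun (congrFun h B) .zero, ?_⟩
        funext A x
        exact congrFun (congrFun h A) (.succ x)

theorem sat_exs : ∀ {Δ Γ : List L.Srt} (φ : Formula L (Δ ++ Γ)) (e : M.Env Γ),
    M.sat (Formula.exs Δ φ) e ↔ ∃ d : M.Env Δ, M.sat φ (Fam.append d e)
  | [], _, φ, e => ⟨fun h => ⟨fun _ x => (nomatch x), h⟩, fun ⟨_, h⟩ => h⟩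
  | B :: Δ, _, φ, e => by
      simp only [Formula.exs, sat_exs (Δ := Δ), sat]
      constructor
      · rintro ⟨d, a, h⟩
        exact ⟨M.consEnv a d, h⟩
      · rintro ⟨d, h⟩
        exact ⟨fun A x => d A (.succ x), d B .zero, h⟩

theorem evalSub_inl {Δ Γ : List L.Srt} (d : M.Env Δ) (e : M.Env Γ) :
    M.evalSub (Sub.inl Δ Γ) (Fam.append d e) = d := by
  funext A x
  exact Fam.append_inl d e x

theorem evalSub_inr {Δ Γ : List L.Srt} (d : M.Env Δ) (e : M.Env Γ) :
    M.evalSub (Sub.inr Δ Γ) (Fam.append d e) = e := by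
  funext A x
  exact Fam.append_inr d e x

theorem evalSub_comp {Γ Δ Θ : List L.Srt} (s : Sub L Γ Δ) (t : Sub L Δ Θ) (e : M.Env Θ) :
    M.evalSub (s.comp t) e = M.evalSub s (M.evalSub t e) := by
  funext A x
  exact eval_subst t e (s A x)

theorem evalSub_pair {Δ Γ Θ : List L.Srt} (d : Sub L Δ Θ) (g : Sub L Γ Θ) (e : M.Env Θ) :
    M.evalSub (Sub.pair d g) e = Fam.append (M.evalSub d e) (M.evalSub g e) := by
  apply Fam.append_ext
  · intro A x
    rw [Fam.append_inl]
    exact congrArg (M.eval e) (Fam.append_inl d g x)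
  · intro A x
    rw [Fam.append_inr]
    exact congrArg (M.eval e) (Fam.append_inr d g x)

/-- Soundness of the calculus. -/
theorem sound {T : RegTheory L} (hM : ∀ q ∈ T, M.Holds q) {Γ : List L.Srt} {φ ψ : Formula L Γ}
    (h : Provable T φ ψ) : ∀ e : M.Env Γ, M.sat φ e → M.sat ψ e := by
  induction h with
  | ax q hq => exact hM q hq
  | refl φ => exact fun _ h => h
  | cut _ _ h k => exact fun e he => k e (h e he)
  | subst s _ h =>
    intro e he
    rw [sat_subst] at he ⊢
    exact h _ he
  | eq_refl t => exact fun _ _ => rfl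
  | eq_subst s t φ =>
    rintro e ⟨h1, h2⟩
    rw [sat_eqs] at h1
    rw [sat_subst] at h2 ⊢
    rwa [← h1]
  | top_intro φ => exact fun _ _ => trivial
  | and_left φ ψ => exact fun _ h => h.1
  | and_right φ ψ => exact fun _ h => h.2
  | and_intro _ _ h k => exact fun e he => ⟨h e he, k e he⟩
  | ex_elim _ h =>
    rintro e ⟨a, ha⟩
    have := h _ ha
    rwa [sat_subst] at this
  | ex_intro _ h =>
    intro e he
    rw [sat_subst]
    exact h _ ⟨e _ .zero, by convert he; funext A x; cases x <;> rfl⟩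
  | frobenius φ ψ =>
    rintro e ⟨h1, a, h2⟩
    refine ⟨a, ?_, h2⟩
    rw [sat_subst]
    exact h1

/-- Homomorphisms of structures. -/
@[ext]
structure Hom (M N : StrIn L D) where
  toFun : ∀ A : L.Srt, M.carrier A → N.carrier A
  map_fn : ∀ (f : L.Fn) (a : M.Env (L.dom f)),
    toFun _ (M.fn f a) = N.fn f (fun A x => toFun A (a A x))
  map_rel : ∀ (R : L.Rel) (a : M.Env (L.arity R)),
    a ∈ M.rel R → (fun A x => toFun A (a A x)) ∈ N.rel R

namespace Hom

variable {M N : StrIn L D}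

/-- The image of a tuple under a homomorphism. -/
def mapEnv (h : Hom M N) {Γ : List L.Srt} (e : M.Env Γ) : N.Env Γ := fun A x => h.toFun A (e A x)

theorem map_eval (h : Hom M N) {Γ : List L.Srt} (e : M.Env Γ) :
    ∀ {A : L.Srt} (t : Term L Γ A), h.toFun A (M.eval e t) = N.eval (h.mapEnv e) t
  | _, .var x => rfl
  | _, .app f ts => by
      simp only [eval, h.map_fn]
      congr 1
      funext A x
      exact h.map_eval e (ts A x)

theorem mapEnv_append (h : Hom M N) {Δ Γ : List L.Srt} (d : M.Env Δ) (e : M.Env Γ) :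
    h.mapEnv (Fam.append d e) = Fam.append (h.mapEnv d) (h.mapEnv e) := by
  apply Fam.append_ext
  · intro A x
    rw [Fam.append_inl]
    exact congrArg (h.toFun A) (Fam.append_inl d e x)
  · intro A x
    rw [Fam.append_inr]
    exact congrArg (h.toFun A) (Fam.append_inr d e x)

theorem map_sat (h : Hom M N) : ∀ {Γ : List L.Srt} (φ : Formula L Γ) (e : M.Env Γ),
    M.sat φ e → N.sat φ (h.mapEnv e)
  | _, .top, _, _ => trivial
  | _, .eq s t, e, k => by
      simp only [sat, ← h.map_eval] at k ⊢
      rw [k]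
  | _, .rel R ts, e, k => by
      simp only [sat, ← h.map_eval] at k ⊢
      exact h.map_rel R _ k
  | _, .and φ ψ, e, k => ⟨h.map_sat φ e k.1, h.map_sat ψ e k.2⟩
  | _, .ex A φ, e, h' => by
      obtain ⟨a, k⟩ := h'
      refine ⟨h.toFun A a, ?_⟩
      have := h.map_sat φ _ k
      convert this
      funext B x
      cases x <;> rfl

end Hom

end StrIn

/-- The set of models of `T` with elements from `D`. -/
structure ModIn (T : RegTheory L) (D : Type u) extends StrIn L D where
  holds : ∀ q ∈ T, toStrIn.Holds q

/-- The category of models with elements from `D` and homomorphisms. -/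
instance (T : RegTheory L) (D : Type u) : Category.{u} (ModIn T D) where
  Hom M N := StrIn.Hom M.toStrIn N.toStrIn
  id M := ⟨fun _ a => a, fun _ _ => rfl, fun _ _ h => h⟩
  comp f g := ⟨fun A a => g.toFun A (f.toFun A a),
    fun k a => by rw [f.map_fn, g.map_fn], fun R a h => g.map_rel R _ (f.map_rel R a h)⟩

namespace ModIn

variable {T : RegTheory L} {D : Type u}

/-- The definable set of a formula in context in a model. -/
def Def (M : ModIn T D) (X : SynCat T) : Type u := {a : M.Env X.ctx // M.sat X.form a}

/-- The action of a homomorphism on definable sets. -/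
def Def.push {M N : ModIn T D} (f : M ⟶ N) {X : SynCat T} (a : M.Def X) : N.Def X :=
  ⟨StrIn.Hom.mapEnv f a.1, StrIn.Hom.map_sat f X.form a.1 a.2⟩

/-- The relation between definable sets that a morphism of the syntactic category defines. -/
def graph (M : ModIn T D) {X Y : SynCat T} (f : X ⟶ Y) (a : M.Def X) (b : M.Def Y) : Prop :=
  _root_.Quotient.lift (s := SynCat.funSetoid X Y)
    (fun σ => M.sat σ.1 (Fam.append b.1 a.1))
    (fun _ _ h => propext ⟨StrIn.sound M.holds h.1 _, StrIn.sound M.holds h.2 _⟩) f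

theorem existsUnique_graph (M : ModIn T D) {X Y : SynCat T} (f : X ⟶ Y) (a : M.Def X) :
    ∃! b : M.Def Y, M.graph f a b := by
  obtain ⟨σ, h⟩ := f
  obtain ⟨b, hb⟩ := (StrIn.sat_exs σ a.1).1 (StrIn.sound M.holds h.total _ a.2)
  have hb2 := StrIn.sound M.holds h.cod _ hb
  rw [StrIn.sat_subst, StrIn.evalSub_inl] at hb2
  refine ⟨⟨b, hb2⟩, hb, ?_⟩
  rintro ⟨c, hc2⟩ hc
  replace hc : M.sat σ (Fam.append c a.1) := hc
  have := StrIn.sound M.holds h.unique (Fam.append c (Fam.append b a.1))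
    ⟨by simpa only [StrIn.sat_subst, StrIn.evalSub_pair, StrIn.evalSub_comp, StrIn.evalSub_inl,
        StrIn.evalSub_inr] using hc,
      by simpa only [StrIn.sat_subst, StrIn.evalSub_pair, StrIn.evalSub_comp, StrIn.evalSub_inl,
        StrIn.evalSub_inr] using hb⟩
  rw [StrIn.sat_eqs, StrIn.evalSub_comp, StrIn.evalSub_inl, StrIn.evalSub_inr,
    StrIn.evalSub_inl] at this
  exact Subtype.ext this

/-- The function between definable sets that a morphism of the syntactic category defines. -/
noncomputable def defMap (M : ModIn T D) {X Y : SynCat T} (f : X ⟶ Y) (a : M.Def X) : M.Def Y :=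
  (M.existsUnique_graph f a).choose

theorem graph_defMap (M : ModIn T D) {X Y : SynCat T} (f : X ⟶ Y) (a : M.Def X) :
    M.graph f a (M.defMap f a) :=
  (M.existsUnique_graph f a).choose_spec.1

theorem defMap_eq (M : ModIn T D) {X Y : SynCat T} {f : X ⟶ Y} {a : M.Def X} {b : M.Def Y}
    (h : M.graph f a b) : M.defMap f a = b :=
  ((M.existsUnique_graph f a).choose_spec.2 b h).symm

theorem defMap_id (M : ModIn T D) (X : SynCat T) (a : M.Def X) : M.defMap (𝟙 X) a = a := by
  apply M.defMap_eq
  change M.sat X.form.idRel (Fam.append a.1 a.1)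
  refine ⟨?_, ?_⟩
  · rw [StrIn.sat_subst, StrIn.evalSub_inr]
    exact a.2
  · rw [StrIn.sat_eqs, StrIn.evalSub_inl, StrIn.evalSub_inr]

theorem defMap_comp (M : ModIn T D) {X Y Z : SynCat T} (f : X ⟶ Y) (g : Y ⟶ Z) (a : M.Def X) :
    M.defMap (f ≫ g) a = M.defMap g (M.defMap f a) := by
  apply M.defMap_eq
  have h1 := M.graph_defMap f a
  have h2 := M.graph_defMap g (M.defMap f a)
  revert h1 h2
  generalize M.defMap g (M.defMap f a) = c
  generalize M.defMap f a = b
  obtain ⟨σ⟩ := f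
  obtain ⟨τ⟩ := g
  intro h1 h2
  replace h1 : M.sat σ.1 (Fam.append b.1 a.1) := h1
  replace h2 : M.sat τ.1 (Fam.append c.1 b.1) := h2
  change M.sat (Formula.compRel σ.1 τ.1) (Fam.append c.1 a.1)
  rw [Formula.compRel, StrIn.sat_exs]
  refine ⟨b.1, ?_, ?_⟩
  · simpa only [StrIn.sat_subst, StrIn.evalSub_pair, StrIn.evalSub_comp, StrIn.evalSub_inl,
      StrIn.evalSub_inr] using h1
  · simpa only [StrIn.sat_subst, StrIn.evalSub_pair, StrIn.evalSub_comp, StrIn.evalSub_inl,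
      StrIn.evalSub_inr] using h2

theorem defMap_push {M N : ModIn T D} (h : M ⟶ N) {X Y : SynCat T} (f : X ⟶ Y) (a : M.Def X) :
    N.defMap f (a.push h) = (M.defMap f a).push h := by
  apply N.defMap_eq
  have h1 := M.graph_defMap f a
  revert h1
  generalize M.defMap f a = b
  obtain ⟨σ⟩ := f
  intro h1
  have := StrIn.Hom.map_sat h σ.1 _ h1
  rw [StrIn.Hom.mapEnv_append] at this
  exact this

end ModIn

/-- The evaluation functor: it sends a formula in context to its definable set functor. -/
noncomputable def evaluation (T : RegTheory L) (D : Type u) :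
    SynCat T ⥤ (ModIn T D ⥤ Type u) where
  obj X :=
    { obj := fun M => M.Def X
      map := fun h => ↾(fun a => a.push h)
      map_id := fun _ => rfl
      map_comp := fun _ _ => rfl }
  map f :=
    { app := fun M => ↾(M.defMap f)
      naturality := fun M N h => by
        ext a
        exact ModIn.defMap_push h f a }
  map_id X := by
    ext M a
    exact M.defMap_id X a
  map_comp f g := by
    ext M a
    exact M.defMap_comp f g a

/-! ### Equivariant sheaves -/

/-- The set of arrows of a category. -/
structure Mor (C : Type u) [Category.{v} C] where
  dom : C
  cod : C
  hom : dom ⟶ cod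

/-- Equivariant sheaves on a category with a topology on its set of objects and a topology on its
set of arrows: local homeomorphisms over the space of objects with a continuous action of the
space of arrows. -/
structure EqSheaf (C : Type u) [Category.{v} C] [TopologicalSpace C]
    [TopologicalSpace (Mor C)] where
  space : Type u
  [top : TopologicalSpace space]
  proj : space → C
  act : {p : Mor C × space // p.1.dom = proj p.2} → space
  isLocalHomeomorph_proj : IsLocalHomeomorph proj
  continuous_act : Continuous act
  proj_act : ∀ p, proj (act p) = p.1.1.cod
  act_id : ∀ x, act ⟨(⟨proj x, proj x, 𝟙 (proj x)⟩, x), rfl⟩ = x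
  act_comp : ∀ {X Y Z : C} (f : X ⟶ Y) (g : Y ⟶ Z) (x : space) (h : X = proj x),
    act ⟨(⟨X, Z, f ≫ g⟩, x), h⟩ =
      act ⟨(⟨Y, Z, g⟩, act ⟨(⟨X, Y, f⟩, x), h⟩),
        (proj_act ⟨(⟨X, Y, f⟩, x), h⟩).symm⟩

namespace EqSheaf

attribute [instance] EqSheaf.top

variable {C : Type u} [Category.{v} C] [TopologicalSpace C] [TopologicalSpace (Mor C)]

/-- Morphisms of equivariant sheaves: continuous maps over the space of objects that commute with
the actions. -/
@[ext]
structure Hom (R S : EqSheaf C) where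
  toFun : R.space → S.space
  continuous_toFun : Continuous toFun
  proj_toFun : ∀ x, S.proj (toFun x) = R.proj x
  toFun_act : ∀ (f : Mor C) (x : R.space) (h : f.dom = R.proj x),
    toFun (R.act ⟨(f, x), h⟩) = S.act ⟨(f, toFun x), h.trans (proj_toFun x).symm⟩

instance : Category.{u} (EqSheaf C) where
  Hom R S := Hom R S
  id R := ⟨fun x => x, continuous_id, fun _ => rfl, fun _ _ _ => rfl⟩
  comp f g := ⟨fun x => g.toFun (f.toFun x), g.continuous_toFun.comp f.continuous_toFun,
    fun x => (g.proj_toFun _).trans (f.proj_toFun x),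
    fun k x h => by rw [f.toFun_act, g.toFun_act]⟩

/-- The functor that forgets the topologies: it sends an equivariant sheaf to the set-valued
functor of its fibres. -/
def forget (C : Type u) [Category.{v} C] [TopologicalSpace C] [TopologicalSpace (Mor C)] :
    EqSheaf C ⥤ (C ⥤ Type u) where
  obj R :=
    { obj := fun X => {x : R.space // R.proj x = X}
      map := fun {X Y} f => ↾(fun x => ⟨R.act ⟨(⟨X, Y, f⟩, x.1), x.2.symm⟩, R.proj_act _⟩)
      map_id := fun X => by
        ext ⟨x, rfl⟩
        exact R.act_id x
      map_comp := fun f g => by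
        ext ⟨x, h⟩
        exact R.act_comp f g x h.symm }
  map {R S} f :=
    { app := fun X => ↾(fun x => ⟨f.toFun x.1, (f.proj_toFun x.1).trans x.2⟩)
      naturality := fun X Y k => by
        ext ⟨x, h⟩
        exact f.toFun_act ⟨X, Y, k⟩ x h.symm }
  map_id _ := rfl
  map_comp _ _ := rfl

end EqSheaf

/-! ### The logical topologies -/

section LogicalTopology

variable (T : RegTheory L) (D : Type u)

/-- The logical topology on the set of models. -/
instance : TopologicalSpace (ModIn T D) :=
  TopologicalSpace.generateFrom
    ({U | ∃ (A : L.Srt) (a : D), U = {M : ModIn T D | a ∈ M.carrier A}} ∪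
     {U | ∃ (R : L.Rel) (a : Fam (fun _ => D) (L.arity R)),
        U = {M : ModIn T D | ∃ h : ∀ A x, a A x ∈ M.carrier A,
          (fun A x => ⟨a A x, h A x⟩) ∈ M.rel R}} ∪
     {U | ∃ (f : L.Fn) (a : Fam (fun _ => D) (L.dom f)) (b : D),
        U = {M : ModIn T D | ∃ h : ∀ A x, a A x ∈ M.carrier A,
          (M.fn f (fun A x => ⟨a A x, h A x⟩) : D) = b}})

/-- The logical topology on the set of homomorphisms. -/
instance : TopologicalSpace (Mor (ModIn T D)) :=
  TopologicalSpace.induced Mor.dom inferInstance ⊓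
  TopologicalSpace.induced Mor.cod inferInstance ⊓
  TopologicalSpace.generateFrom
    {U | ∃ (A : L.Srt) (a b : D),
      U = {f : Mor (ModIn T D) | ∃ h : a ∈ f.dom.carrier A,
        (StrIn.Hom.toFun f.hom A ⟨a, h⟩ : D) = b}}

variable {T}

/-- The set of pairs of a model `M` and an element of the definable set of `X` in `M`. -/
def DefTotal (X : SynCat T) : Type u := Σ M : ModIn T D, M.Def X

namespace DefTotal

variable {D} {X Y : SynCat T}

def proj (p : DefTotal D X) : ModIn T D := p.1

/-- The tuple of elements of `D` that underlies a point. -/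
def tuple (p : DefTotal D X) : Fam (fun _ => D) X.ctx := fun A x => (p.2.1 A x : D)

/-- The logical topology: the coarsest one such that the projection is continuous and, for every
tuple `a` of elements of `D`, the set of all points of the form `(M, a)` is open. -/
instance : TopologicalSpace (DefTotal D X) :=
  TopologicalSpace.induced proj inferInstance ⊓
  TopologicalSpace.generateFrom
    {U | ∃ a : Fam (fun _ => D) X.ctx, U = {p : DefTotal D X | p.tuple = a}}

/-- The action of homomorphisms: `f : M ⟶ N` sends `(M, a)` to `(N, f a)`. -/
def act (p : {p : Mor (ModIn T D) × DefTotal D X // p.1.dom = p.2.proj}) : DefTotal D X :=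
  ⟨p.1.1.cod, p.1.2.2.push (eqToHom p.2.symm ≫ p.1.1.hom)⟩

/-- The map that is defined by a morphism `σ` of the syntactic category: it sends `(M, a)` to
`(M, b)` where `b` is the unique tuple such that `M` satisfies `σ(a, b)`. -/
noncomputable def map (f : X ⟶ Y) (p : DefTotal D X) : DefTotal D Y := ⟨p.1, p.1.defMap f p.2⟩

end DefTotal

end LogicalTopology

/-- The equivariant sheaf of a formula in context, given that its projection is a local
homeomorphism and its action is continuous. -/
def definableSheaf {T : RegTheory L} {D : Type u} (X : SynCat T)
    (hproj : IsLocalHomeomorph (DefTotal.proj : DefTotal D X → ModIn T D))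
    (hact : Continuous (DefTotal.act (D := D) (X := X))) : EqSheaf (ModIn T D) where
  space := DefTotal D X
  proj := DefTotal.proj
  act := DefTotal.act
  isLocalHomeomorph_proj := hproj
  continuous_act := hact
  proj_act _ := rfl
  act_id _ := rfl
  act_comp := by
    rintro _ Y Z f g x rfl
    rfl

/-- The functor that sends a formula in context to its equivariant sheaf, given that the latter is
one and that the maps defined by the morphisms of the syntactic category are continuous. -/
noncomputable def definableFunctor {T : RegTheory L} {D : Type u}
    (hproj : ∀ X : SynCat T, IsLocalHomeomorph (DefTotal.proj : DefTotal D X → ModIn T D))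
    (hact : ∀ X : SynCat T, Continuous (DefTotal.act (D := D) (X := X)))
    (hmap : ∀ (X Y : SynCat T) (f : X ⟶ Y), Continuous (DefTotal.map (D := D) f)) :
    SynCat T ⥤ EqSheaf (ModIn T D) where
  obj X := definableSheaf X (hproj X) (hact X)
  map f :=
    { toFun := DefTotal.map f
      continuous_toFun := hmap _ _ f
      proj_toFun := fun _ => rfl
      toFun_act := by
        rintro k ⟨M, a⟩ h
        exact congrArg (Sigma.mk k.cod) (ModIn.defMap_push _ f a) }
  map_id X := by
    apply EqSheaf.Hom.ext
    funext p
    exact congrArg (Sigma.mk p.1) (p.1.defMap_id X p.2)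
  map_comp f g := by
    apply EqSheaf.Hom.ext
    funext p
    exact congrArg (Sigma.mk p.1) (p.1.defMap_comp f g p.2)

/-! ### Properties of functors -/

section Functors

variable {C : Type u} [Category.{v} C] {E : Type w} [Category.{v} E]

/-- Regular functors: they preserve finite limits and regular epimorphisms (covers). -/
structure IsRegularFunctor (F : C ⥤ E) : Prop where
  preservesFiniteLimits : PreservesFiniteLimits F
  map_regularEpi : ∀ {X Y : C} (f : X ⟶ Y), IsRegularEpi f → IsRegularEpi (F.map f)

/-- A family of morphisms with common codomain is jointly covering if it is jointly epimorphic (in a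
Grothendieck topos, such as the category of equivariant sheaves, these are the covering families). -/
def JointlyCovering {X : C} (P : Presieve X) : Prop :=
  ∀ ⦃Z : C⦄ (g h : X ⟶ Z), (∀ ⦃Y : C⦄ (f : Y ⟶ X), P f → f ≫ g = f ≫ h) → g = h

/-- A functor reflects covers if, whenever the image of a family of morphisms with common codomain
is jointly covering, some morphism of the family is a cover. -/
def ReflectsCovers (F : C ⥤ E) : Prop :=
  ∀ ⦃X : C⦄ (P : Presieve X), JointlyCovering (P.map F) →
    ∃ (Y : C) (f : Y ⟶ X), P f ∧ IsRegularEpi f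

end Functors

end RegLogic

namespace RegLogic

/-! ### Henkin witnesses and stages -/

section Generic

variable {L : Signature.{u}}

/-! The theorem rests on generic models (`exists_generic`). For a formula `φ₀` in context there are
a model `M` with elements in `D` and a tuple `a` of `M` that satisfies exactly the provable
consequences of `φ₀`. Moreover each tuple `b` of `M` has a regular formula `σ(y, x)` that holds of
`(b, a)`, is solvable in `y` over every tuple that satisfies `φ₀` in a model, and is such that any
solution `(d, c)` in a model `N` is the image of `(b, a)` under a homomorphism `M ⟶ N`.

`M` is a Henkin model. Its names are the variables and one witness for each existential formula at
each tuple of names; there are at most `|D|` of them. A stage is one formula, together with terms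
for some names. A statement is true in `M` if every stage above the initial one has an extension
that forces it. Since only equations, relations, `⊤`, `∧` and `∃` occur, this density notion
satisfies the truth lemma (`sat_genericStr`) without a generic filter. Conservativity of extensions
keeps the generic tuple from satisfying too much. A realization of a stage in `N` propagates to all
extensions, and this yields the homomorphisms; projecting the formula of a stage yields `σ`.

Completeness, hence faithfulness, is immediate. For fullness, a morphism of sheaves is a natural
family `h` of functions between definable sets. Take `b = h a` at the generic tuple: by naturality
every solution of `σ` is a pair `(h c, c)`, so `σ` defines `h` (`exists_defMap_eq`).

On the topological side, regular formulas define open sets of models, because `∃` is a union over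
`D`. This gives local homeomorphisms, and open maps between the sheaves. Pullbacks and coequalizers
of kernel pairs are checked on sheaves and reflected along the fully faithful functor; regular
epimorphisms turn out to be the fibrewise surjections.

For cover reflection, the images of a jointly epimorphic family fill the whole sheaf, since
otherwise two copies glued along the union of the images would separate two morphisms. In particular
the generic point lies in one image, so `φ₀` proves the corresponding image formula and that single
morphism is surjective in every model. -/

/-- Names for the elements of a generic model: the variables of `Γ₀`, and a witness for each
existential formula at each tuple of names. -/
inductive Witness (Γ₀ : List L.Srt) : L.Srt → Type u
  | base {A : L.Srt} : Var Γ₀ A → Witness Γ₀ A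
  | wit {A : L.Srt} {Δ : List L.Srt} (φ : Formula L (A :: Δ))
      (g : ∀ B : L.Srt, Var Δ B → Witness Γ₀ B) : Witness Γ₀ A

/-- A finite approximation of a generic model: a formula in context together with terms that
interpret some of the names. -/
structure Stage (T : RegTheory L) (Γ₀ : List L.Srt) where
  ctx : List L.Srt
  form : Formula L ctx
  val : ∀ A : L.Srt, Witness Γ₀ A → Term L ctx A → Prop
  val_unique : ∀ {A : L.Srt} {w : Witness Γ₀ A} {t t' : Term L ctx A},
    val A w t → val A w t' → t = t'
  val_wit : ∀ {A : L.Srt} {Δ : List L.Srt} {φ : Formula L (A :: Δ)} {g : Fam (Witness Γ₀) Δ}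
    {t : Term L ctx A}, val A (.wit φ g) t →
      ∃ s : Sub L Δ ctx, (∀ B x, val B (g B x) (s B x)) ∧
        Provable T form (φ.subst (Fam.cons t s))

/-- A partial interpretation of the names in a structure that is closed under witnesses. -/
structure HenkinMap {D : Type u} (N : StrIn L D) (Γ₀ : List L.Srt) where
  rel : ∀ A : L.Srt, Witness Γ₀ A → N.carrier A → Prop
  unique : ∀ {A : L.Srt} {w : Witness Γ₀ A} {a a' : N.carrier A}, rel A w a → rel A w a' → a = a'
  wit : ∀ {A : L.Srt} {Δ : List L.Srt} (φ : Formula L (A :: Δ)) (g : Fam (Witness Γ₀) Δ)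
    (d : N.Env Δ), (∀ B x, rel B (g B x) (d B x)) → N.sat (.ex A φ) d →
      ∃ a : N.carrier A, rel A (.wit φ g) a ∧ N.sat φ (N.consEnv a d)

variable {T : RegTheory L} {Γ₀ : List L.Srt}

theorem StrIn.evalSub_cons {D : Type u} {N : StrIn L D} {A : L.Srt} {Γ Δ : List L.Srt}
    (t : Term L Γ A) (s : Sub L Δ Γ) (e : N.Env Γ) :
    N.evalSub (Fam.cons t s : Sub L (A :: Δ) Γ) e = N.consEnv (N.eval e t) (N.evalSub s e) := by
  funext B x
  cases x <;> rfl

theorem Sub.cons_comp {A : L.Srt} {Γ Δ Θ : List L.Srt} (t : Term L Γ A) (s : Sub L Δ Γ)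
    (r : Sub L Γ Θ) :
    Sub.comp (Fam.cons t s : Sub L (A :: Δ) Γ) r = Fam.cons (t.subst r) (s.comp r) := by
  funext B x
  cases x <;> rfl

namespace Stage

/-- The names `g` are interpreted by the terms `s`. -/
def Vals (S : Stage T Γ₀) {Δ : List L.Srt} (g : Fam (Witness Γ₀) Δ) (s : Sub L Δ S.ctx) : Prop :=
  ∀ B x, S.val B (g B x) (s B x)

theorem Vals.unique {S : Stage T Γ₀} {Δ : List L.Srt} {g : Fam (Witness Γ₀) Δ}
    {s s' : Sub L Δ S.ctx} (h : S.Vals g s) (h' : S.Vals g s') : s = s' := by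
  funext B x
  exact S.val_unique (h B x) (h' B x)

theorem Vals.cons {S : Stage T Γ₀} {A : L.Srt} {Δ : List L.Srt} {g : Fam (Witness Γ₀) Δ}
    {s : Sub L Δ S.ctx} {w : Witness Γ₀ A} {t : Term L S.ctx A} (h : S.val A w t)
    (h' : S.Vals g s) : S.Vals (Fam.cons w g) (Fam.cons t s) := by
  intro B x
  cases x with
  | zero => exact h
  | succ x => exact h' B x

/-- The stage at which `φ` holds of the names `g`. -/
def Forces (S : Stage T Γ₀) {Δ : List L.Srt} (φ : Formula L Δ) (g : Fam (Witness Γ₀) Δ) : Prop :=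
  ∃ s : Sub L Δ S.ctx, S.Vals g s ∧ Provable T S.form (φ.subst s)

/-- The environment `e` realizes the stage `S` compatibly with `ν`. -/
def Realizes {D : Type u} (S : Stage T Γ₀) {N : StrIn L D} (ν : HenkinMap N Γ₀)
    (e : N.Env S.ctx) : Prop :=
  N.sat S.form e ∧ ∀ A w t, S.val A w t → ν.rel A w (N.eval e t)

theorem Realizes.vals {D : Type u} {S : Stage T Γ₀} {N : StrIn L D} {ν : HenkinMap N Γ₀}
    {e : N.Env S.ctx} (h : S.Realizes ν e) {Δ : List L.Srt} {g : Fam (Witness Γ₀) Δ}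
    {s : Sub L Δ S.ctx} (hs : S.Vals g s) (B : L.Srt) (x : Var Δ B) :
    ν.rel B (g B x) (N.evalSub s e B x) :=
  h.2 _ _ _ (hs B x)

/-- Conservative extensions of stages. -/
def Le (D : Type u) (S S' : Stage T Γ₀) : Prop :=
  ∃ r : Sub L S.ctx S'.ctx,
    Provable T S'.form (S.form.subst r) ∧
    (∀ A w t, S.val A w t → S'.val A w (t.subst r)) ∧
    (∀ ψ : Formula L S.ctx, Provable T S'.form (ψ.subst r) → Provable T S.form ψ) ∧
    ∀ (N : ModIn T D) (ν : HenkinMap N.toStrIn Γ₀) (e : N.Env S.ctx), S.Realizes ν e →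
      ∃ e' : N.Env S'.ctx, S'.Realizes ν e'

variable {D : Type u}

theorem Le.refl (S : Stage T Γ₀) : S.Le D S := by
  refine ⟨Sub.id _, ?_, ?_, ?_, fun N ν e h => ⟨e, h⟩⟩
  · rw [Formula.subst_id]
    exact .refl _
  · intro A w t h
    rwa [Term.subst_id]
  · intro ψ h
    rwa [Formula.subst_id] at h

theorem Le.trans {S S' S'' : Stage T Γ₀} (h : S.Le D S') (h' : S'.Le D S'') : S.Le D S'' := by
  obtain ⟨r, h1, h2, h3, h4⟩ := h
  obtain ⟨r', k1, k2, k3, k4⟩ := h'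
  refine ⟨r.comp r', ?_, ?_, ?_, ?_⟩
  · rw [← Formula.subst_subst]
    exact k1.cut (h1.subst _)
  · intro A w t h
    rw [← Term.subst_subst]
    exact k2 _ _ _ (h2 _ _ _ h)
  · intro ψ h
    rw [← Formula.subst_subst] at h
    exact h3 _ (k3 _ h)
  · intro N ν e h
    obtain ⟨e', h'⟩ := h4 N ν e h
    exact k4 N ν e' h'

/-- The new realization need not restrict to `e`. Both are tied to the same `ν`, and this already
fixes the values of all names. -/
theorem Le.realizes {S S' : Stage T Γ₀} (h : S.Le D S') {N : ModIn T D}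
    {ν : HenkinMap N.toStrIn Γ₀} {e : N.Env S.ctx} (he : S.Realizes ν e) :
    ∃ e' : N.Env S'.ctx, S'.Realizes ν e' := by
  obtain ⟨r, _, _, _, h4⟩ := h
  exact h4 N ν e he

/-- A property of stages that is stable under extension. -/
def Stable (D : Type u) (P : Stage T Γ₀ → Prop) : Prop := ∀ ⦃S S'⦄, S.Le D S' → P S → P S'

theorem stable_vals {Δ : List L.Srt} (g : Fam (Witness Γ₀) Δ) :
    Stable D (fun S : Stage T Γ₀ => ∃ s, S.Vals g s) := by
  rintro S S' ⟨r, -, h, -⟩ ⟨s, hs⟩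
  exact ⟨s.comp r, fun B x => h _ _ _ (hs B x)⟩

theorem stable_forces {Δ : List L.Srt} (φ : Formula L Δ) (g : Fam (Witness Γ₀) Δ) :
    Stable D (fun S : Stage T Γ₀ => S.Forces φ g) := by
  rintro S S' ⟨r, h1, h, -⟩ ⟨s, hs, k⟩
  refine ⟨s.comp r, fun B x => h _ _ _ (hs B x), ?_⟩
  rw [← Formula.subst_subst]
  exact h1.cut (k.subst _)

/-- Adjunction of a witness of an existential formula. -/
def extend (S : Stage T Γ₀) {A : L.Srt} {Δ : List L.Srt} (φ : Formula L (A :: Δ))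
    (g : Fam (Witness Γ₀) Δ) (s : Sub L Δ S.ctx) (hs : S.Vals g s)
    (hnew : ∀ t, ¬ S.val A (.wit φ g) t) : Stage T Γ₀ where
  ctx := A :: S.ctx
  form := .and (S.form.subst (Sub.wk A S.ctx)) (φ.subst (s.lift A))
  -- An equation of triples identifies sort, name and term together, without transport along an
  -- equality of sorts.
  val B w t := (∃ t₀, S.val B w t₀ ∧ t = t₀.subst (Sub.wk A S.ctx)) ∨
    (⟨B, w, t⟩ : Σ B : L.Srt, Witness Γ₀ B × Term L (A :: S.ctx) B) =
      ⟨A, .wit φ g, .var .zero⟩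
  val_unique := by
    rintro B w t t' (⟨t₀, h, rfl⟩ | h) (⟨t₀', h', rfl⟩ | h')
    · rw [S.val_unique h h']
    · cases h'
      exact absurd h (hnew _)
    · cases h
      exact absurd h' (hnew _)
    · cases h
      cases h'
      rfl
  val_wit := by
    rintro B Δ' φ' g' t (⟨t₀, h, rfl⟩ | h)
    · obtain ⟨s', h1, h2⟩ := S.val_wit h
      refine ⟨s'.comp (Sub.wk A S.ctx), fun C x => .inl ⟨_, h1 C x, rfl⟩, ?_⟩
      have := h2.subst (Sub.wk A S.ctx)
      rw [Formula.subst_subst, Sub.cons_comp] at this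
      exact .hyp_left this
    · cases h
      exact ⟨s.comp (Sub.wk A S.ctx), fun C x => .inl ⟨_, hs C x, rfl⟩, .and_right _ _⟩

/-- Conservativity is Frobenius followed by elimination of the existential formula. Realizations
extend because `ν` has a value at the new witness. -/
theorem le_extend (S : Stage T Γ₀) {A : L.Srt} {Δ : List L.Srt} (φ : Formula L (A :: Δ))
    (g : Fam (Witness Γ₀) Δ) (s : Sub L Δ S.ctx) (hs : S.Vals g s)
    (hnew : ∀ t, ¬ S.val A (.wit φ g) t) (h : Provable T S.form ((Formula.ex A φ).subst s)) :
    S.Le D (S.extend φ g s hs hnew) := by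
  refine ⟨Sub.wk A S.ctx, .and_left _ _, fun B w t ht => .inl ⟨t, ht, rfl⟩, ?_, ?_⟩
  · intro ψ hψ
    exact (Provable.and_intro (.refl _) h).cut ((Provable.frobenius _ _).cut (.ex_elim hψ))
  · rintro N ν e ⟨h1, h2⟩
    have h3 := StrIn.sound N.holds h e h1
    rw [StrIn.sat_subst] at h3
    obtain ⟨a, ha, ha'⟩ := ν.wit φ g _ (fun B x => h2 _ _ _ (hs B x)) h3
    refine ⟨N.consEnv a e, ⟨(StrIn.sat_subst _ (N.consEnv a e) _).2 h1,
      (StrIn.sat_subst _ (N.consEnv a e) _).2 ?_⟩, ?_⟩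
    · rw [StrIn.evalSub_lift]
      exact ha'
    · rintro B w t (⟨t₀, ht, rfl⟩ | ht)
      · have h4 : N.eval (N.consEnv a e) (t₀.subst (Sub.wk A S.ctx)) = N.eval e t₀ :=
          StrIn.eval_subst _ _ _
        exact h4.symm ▸ h2 _ _ _ ht
      · cases ht
        exact ha

/-- A witness that already has a term satisfies its formula by `val_wit`; otherwise it is adjoined
with a fresh variable as its term. -/
theorem exists_forces_wit {S : Stage T Γ₀} {A : L.Srt} {Δ : List L.Srt} {φ : Formula L (A :: Δ)}
    {g : Fam (Witness Γ₀) Δ} (h : S.Forces (.ex A φ) g) :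
    ∃ S', S.Le D S' ∧ S'.Forces φ (Fam.cons (.wit φ g) g) := by
  obtain ⟨s, hs, h⟩ := h
  by_cases hnew : ∃ t, S.val A (.wit φ g) t
  · obtain ⟨t, ht⟩ := hnew
    obtain ⟨s', hs', h'⟩ := S.val_wit ht
    exact ⟨S, .refl S, _, Vals.cons ht hs', h'⟩
  · rw [not_exists] at hnew
    refine ⟨_, S.le_extend φ g s hs hnew h, s.lift A, Vals.cons ?_ ?_, .and_right _ _⟩
    · exact .inr rfl
    · exact fun B x => .inl ⟨_, hs B x, rfl⟩

/-- The interpretation of names in `N` that extends a given realization of a stage. -/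
inductive Interp (S : Stage T Γ₀) (N : StrIn L D) (e : N.Env S.ctx) :
    ∀ A : L.Srt, Witness Γ₀ A → N.carrier A → Prop
  | val {A : L.Srt} {w : Witness Γ₀ A} {t : Term L S.ctx A} :
      S.val A w t → Interp S N e A w (N.eval e t)
  -- Choice is used only for witnesses without a term at `S`, so the two clauses never compete and
  -- the interpretation is single-valued.
  | wit {A : L.Srt} {Δ : List L.Srt} (φ : Formula L (A :: Δ)) (g : Fam (Witness Γ₀) Δ)
      (d : N.Env Δ) (hnew : ∀ t, ¬ S.val A (.wit φ g) t)
      (hd : ∀ B x, Interp S N e B (g B x) (d B x)) (h : ∃ a, N.sat φ (N.consEnv a d)) :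
      Interp S N e A (.wit φ g) h.choose

theorem Interp.unique {S : Stage T Γ₀} {N : StrIn L D} {e : N.Env S.ctx} {A : L.Srt}
    {w : Witness Γ₀ A} {a a' : N.carrier A} (h : S.Interp N e A w a) (h' : S.Interp N e A w a') :
    a = a' := by
  induction h with
  | val k =>
    cases h' with
    | val k' => rw [S.val_unique k k']
    | wit φ g d hnew hd h => exact absurd k (hnew _)
  | wit φ g d hnew hd h ih =>
    cases h' with
    | val k' => exact absurd k' (hnew _)
    | wit _ _ d' _ hd' h' =>
      obtain rfl : d = d' := by
        funext B x
        exact ih B x (hd' B x)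
      rfl

/-- Closure under witnesses has two cases: for a witness with a term at `S` it is `val_wit` and
soundness at `e`, for any other it is the choice made in `Interp`. -/
def henkinMap (S : Stage T Γ₀) (N : StrIn L D) (hN : ∀ q ∈ T, N.Holds q) (e : N.Env S.ctx)
    (he : N.sat S.form e) : HenkinMap N Γ₀ where
  rel := S.Interp N e
  unique := Interp.unique
  wit := by
    intro A Δ φ g d hd h
    by_cases hnew : ∃ t, S.val A (.wit φ g) t
    · obtain ⟨t, ht⟩ := hnew
      obtain ⟨s, hs, h'⟩ := S.val_wit ht
      refine ⟨_, .val ht, ?_⟩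
      have h2 := StrIn.sound hN h' e he
      rw [StrIn.sat_subst, StrIn.evalSub_cons] at h2
      convert h2
      funext B x
      exact (hd B x).unique (.val (hs B x))
    · rw [not_exists] at hnew
      exact ⟨_, .wit φ g d hnew hd h, Exists.choose_spec h⟩

theorem realizes_henkinMap (S : Stage T Γ₀) (N : StrIn L D) (hN : ∀ q ∈ T, N.Holds q)
    (e : N.Env S.ctx) (he : N.sat S.form e) : S.Realizes (S.henkinMap N hN e he) e :=
  ⟨he, fun _ _ _ h => .val h⟩

/-- The stage at which nothing but `φ` is known. -/
def initial (T : RegTheory L) (φ : Formula L Γ₀) : Stage T Γ₀ where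
  ctx := Γ₀
  form := φ
  val A w t := ∃ x : Var Γ₀ A, w = .base x ∧ t = .var x
  val_unique := by
    rintro A w t t' ⟨x, rfl, rfl⟩ ⟨x', h, rfl⟩
    cases h
    rfl
  val_wit := by
    rintro A Δ φ g t ⟨x, h, -⟩
    cases h

end Stage

end Generic
-- The generic model: density semantics, truth lemma, universal property
section GenericModel

variable {L : Signature.{u}} {T : RegTheory L}

namespace Provable

variable {Γ : List L.Srt} {A : L.Srt} {ξ : Formula L Γ} {t t' t'' : Term L Γ A}

theorem eqs_single (h : Provable T ξ (.eq t t')) :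
    Provable T ξ (Formula.eqs (Fam.cons t (fun _ x => nomatch x) : Sub L [A] Γ)
      (Fam.cons t' (fun _ x => nomatch x))) :=
  .and_intro h (.top_intro _)

theorem eq_symm (h : Provable T ξ (.eq t t')) : Provable T ξ (.eq t' t) :=
  (eqs_symm (eqs_single h)).cut (.and_left _ _)

theorem eq_trans (h : Provable T ξ (.eq t t')) (h' : Provable T ξ (.eq t' t'')) :
    Provable T ξ (.eq t t'') :=
  (eqs_trans (eqs_single h) (eqs_single h')).cut (.and_left _ _)

/-- Substitution of equals in `f(x) = f(y)`, in the doubled context `x, y`, where only the second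
half is replaced. -/
theorem eq_app {f : L.Fn} {s s' : ∀ A, Var (L.dom f) A → Term L Γ A}
    (h : ∀ A x, Provable T ξ (.eq (s A x) (s' A x))) :
    Provable T ξ (.eq (.app f s) (.app f s')) := by
  have k := eqs_use (T := T) (ξ := ξ) (s := Sub.pair s s) (t := Sub.pair s s')
    (.eq (.app f (fun _ x => .var (Var.inl x))) (.app f (fun _ x => .var (Var.inr x))))
  simp only [Formula.subst, Term.subst, Sub.pair, Fam.append_inl, Fam.append_inr] at k
  exact k (eqs_pair (eqs_refl _ _) (eqs_intro h)) (.cut (.top_intro _) (.eq_refl _))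

end Provable

variable {Γ₀ : List L.Srt} (φ₀ : Formula L Γ₀) (D : Type u)

/-- A property of stages that every stage satisfies after a further extension. -/
def Ev (P : Stage T Γ₀ → Prop) : Prop :=
  ∀ S, (Stage.initial T φ₀).Le D S → ∃ S', S.Le D S' ∧ P S'

variable {φ₀ D}

theorem Ev.mono {P Q : Stage T Γ₀ → Prop} (h : Ev φ₀ D P) (k : ∀ S, P S → Q S) : Ev φ₀ D Q := by
  intro S hS
  obtain ⟨S', h1, h2⟩ := h S hS
  exact ⟨S', h1, k _ h2⟩

theorem Ev.bind {P Q : Stage T Γ₀ → Prop} (h : Ev φ₀ D P)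
    (k : ∀ S, P S → ∃ S', S.Le D S' ∧ Q S') : Ev φ₀ D Q := by
  intro S hS
  obtain ⟨S', h1, h2⟩ := h S hS
  obtain ⟨S'', h3, h4⟩ := k _ h2
  exact ⟨S'', h1.trans h3, h4⟩

/-- The two extensions are made one after the other, and stability keeps `P` true during the second.
Thus stages need not be shown to have common extensions. -/
theorem Ev.and {P Q : Stage T Γ₀ → Prop} (hs : Stage.Stable D P) (h : Ev φ₀ D P)
    (k : Ev φ₀ D Q) : Ev φ₀ D (fun S => P S ∧ Q S) := by
  intro S hS
  obtain ⟨S', h1, h2⟩ := h S hS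
  obtain ⟨S'', h3, h4⟩ := k _ (hS.trans h1)
  exact ⟨S'', h1.trans h3, hs h3 h2, h4⟩

theorem Ev.all : ∀ {Δ : List L.Srt} {P : ∀ B, Var Δ B → Stage T Γ₀ → Prop},
    (∀ B x, Stage.Stable D (P B x)) → (∀ B x, Ev φ₀ D (P B x)) →
      Ev φ₀ D (fun S => ∀ B x, P B x S)
  | [], _, _, _ => fun S _ => ⟨S, .refl S, fun _ x => nomatch x⟩
  | A :: Δ, P, hs, h => by
      refine (Ev.and (hs A .zero) (h A .zero)
        (Ev.all (fun B x => hs B (.succ x)) (fun B x => h B (.succ x)))).mono ?_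
      rintro S ⟨h1, h2⟩ B x
      cases x with
      | zero => exact h1
      | succ x => exact h2 B x

variable (φ₀ D)

/-- The name `w` denotes an element of the generic model. -/
def Exi {A : L.Srt} (w : Witness Γ₀ A) : Prop :=
  Ev (T := T) φ₀ D (fun S => ∃ t, S.val A w t)

/-- The names `w` and `w'` denote the same element of the generic model. -/
def Eqv {A : L.Srt} (w w' : Witness Γ₀ A) : Prop :=
  Ev (T := T) φ₀ D (fun S => ∃ t t', S.val A w t ∧ S.val A w' t' ∧ Provable T S.form (.eq t t'))

/-- The formula `φ` is true of the names `g` in the generic model. -/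
def Tr {Δ : List L.Srt} (φ : Formula L Δ) (g : Fam (Witness Γ₀) Δ) : Prop :=
  Ev (T := T) φ₀ D (fun S => S.Forces φ g)

variable {φ₀ D}

theorem stable_exi {A : L.Srt} (w : Witness Γ₀ A) :
    Stage.Stable D (fun S : Stage T Γ₀ => ∃ t, S.val A w t) := by
  rintro S S' ⟨r, -, h, -⟩ ⟨t, ht⟩
  exact ⟨_, h _ _ _ ht⟩

theorem stable_eqv {A : L.Srt} (w w' : Witness Γ₀ A) :
    Stage.Stable D (fun S : Stage T Γ₀ =>
      ∃ t t', S.val A w t ∧ S.val A w' t' ∧ Provable T S.form (.eq t t')) := by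
  rintro S S' ⟨r, h0, h, -⟩ ⟨t, t', ht, ht', k⟩
  exact ⟨_, _, h _ _ _ ht, h _ _ _ ht', h0.cut (k.subst _)⟩

theorem ev_vals {Δ : List L.Srt} {g : Fam (Witness Γ₀) Δ}
    (h : ∀ B x, Exi (T := T) φ₀ D (g B x)) : Ev (T := T) φ₀ D (fun S => ∃ s, S.Vals g s) := by
  refine (Ev.all (fun B x => stable_exi (g B x)) h).mono ?_
  intro S hS
  choose s hs using hS
  exact ⟨s, hs⟩

theorem Tr.cut {Δ : List L.Srt} {φ ψ : Formula L Δ} {g : Fam (Witness Γ₀) Δ}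
    (h : Tr (T := T) φ₀ D φ g) (k : Provable T φ ψ) : Tr (T := T) φ₀ D ψ g := by
  refine h.mono ?_
  rintro S ⟨s, hs, h⟩
  exact ⟨s, hs, h.cut (k.subst _)⟩

/-- Different stages may force the existential formula in different ways, but the name `.wit φ g` is
the same at all of them, so the density statement acquires one uniform witness. -/
theorem Tr.wit {A : L.Srt} {Δ : List L.Srt} {φ : Formula L (A :: Δ)} {g : Fam (Witness Γ₀) Δ}
    (h : Tr (T := T) φ₀ D (.ex A φ) g) : Tr (T := T) φ₀ D φ (Fam.cons (.wit φ g) g) :=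
  h.bind fun _ hS => Stage.exists_forces_wit hS

theorem Tr.exi {Δ : List L.Srt} {φ : Formula L Δ} {g : Fam (Witness Γ₀) Δ}
    (h : Tr (T := T) φ₀ D φ g) (B : L.Srt) (x : Var Δ B) : Exi (T := T) φ₀ D (g B x) := by
  refine h.mono ?_
  rintro S ⟨s, hs, -⟩
  exact ⟨_, hs B x⟩

theorem Eqv.refl {A : L.Srt} {w : Witness Γ₀ A} (h : Exi (T := T) φ₀ D w) :
    Eqv (T := T) φ₀ D w w := by
  refine h.mono ?_
  rintro S ⟨t, ht⟩
  exact ⟨t, t, ht, ht, .cut (.top_intro _) (.eq_refl _)⟩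

theorem Eqv.symm {A : L.Srt} {w w' : Witness Γ₀ A} (h : Eqv (T := T) φ₀ D w w') :
    Eqv (T := T) φ₀ D w' w := by
  refine h.mono ?_
  rintro S ⟨t, t', ht, ht', k⟩
  exact ⟨t', t, ht', ht, k.eq_symm⟩

theorem Eqv.trans {A : L.Srt} {w w' w'' : Witness Γ₀ A} (h : Eqv (T := T) φ₀ D w w')
    (h' : Eqv (T := T) φ₀ D w' w'') : Eqv (T := T) φ₀ D w w'' := by
  refine (Ev.and (stable_eqv _ _) h h').mono ?_
  rintro S ⟨⟨t, t', ht, ht', k⟩, ⟨s, s', hs, hs', k'⟩⟩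
  obtain rfl := S.val_unique ht' hs
  exact ⟨t, s', ht, hs', k.eq_trans k'⟩

theorem Tr.congr {Δ : List L.Srt} {φ : Formula L Δ} {g g' : Fam (Witness Γ₀) Δ}
    (h : Tr (T := T) φ₀ D φ g) (k : ∀ B x, Eqv (T := T) φ₀ D (g B x) (g' B x)) :
    Tr (T := T) φ₀ D φ g' := by
  refine (Ev.and (Stage.stable_forces φ g) h (Ev.all (fun B x => stable_eqv _ _) k)).mono ?_
  rintro S ⟨⟨s, hs, h1⟩, h2⟩
  choose t t' ht ht' h3 using h2
  obtain rfl : s = t := Stage.Vals.unique hs ht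
  exact ⟨t', ht', Provable.eqs_use φ (Provable.eqs_intro h3) h1⟩

theorem Tr.and {Δ : List L.Srt} {φ ψ : Formula L Δ} {g : Fam (Witness Γ₀) Δ}
    (h : Tr (T := T) φ₀ D φ g) (k : Tr (T := T) φ₀ D ψ g) : Tr (T := T) φ₀ D (.and φ ψ) g := by
  refine (Ev.and (Stage.stable_forces φ g) h k).mono ?_
  rintro S ⟨⟨s, hs, h1⟩, ⟨s', hs', h2⟩⟩
  obtain rfl := hs.unique hs'
  exact ⟨s, hs, .and_intro h1 h2⟩

theorem Tr.ex {A : L.Srt} {Δ : List L.Srt} {φ : Formula L (A :: Δ)} {g : Fam (Witness Γ₀) Δ}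
    {w : Witness Γ₀ A} (h : Tr (T := T) φ₀ D φ (Fam.cons w g)) :
    Tr (T := T) φ₀ D (.ex A φ) g := by
  refine h.mono ?_
  rintro S ⟨s, hs, h⟩
  refine ⟨fun B x => s B (.succ x), fun B x => hs B (.succ x), h.cut ?_⟩
  have := (Provable.ex_intro (.refl (T := T) (.ex A φ))).subst s
  rwa [Formula.subst_subst] at this

/-- Forcing includes that the names have terms, so even `⊤` is true only of names that denote. -/
theorem tr_top {Δ : List L.Srt} {g : Fam (Witness Γ₀) Δ}
    (h : ∀ B x, Exi (T := T) φ₀ D (g B x)) : Tr (T := T) φ₀ D .top g := by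
  refine (ev_vals h).mono ?_
  rintro S ⟨s, hs⟩
  exact ⟨s, hs, .top_intro _⟩

theorem tr_initial : Tr (T := T) φ₀ D φ₀ (fun _ x => .base x) := by
  rintro S ⟨r, h1, h2, -⟩
  exact ⟨S, .refl S, r, fun B x => h2 B _ _ ⟨x, rfl, rfl⟩, h1⟩

/-- A formula that is true of the generic tuple is provable. -/
theorem Tr.provable {ψ : Formula L Γ₀} (h : Tr (T := T) φ₀ D ψ (fun _ x => .base x)) :
    Provable T φ₀ ψ := by
  obtain ⟨S, ⟨r, h1, h2, h3, -⟩, s, hs, k⟩ := h _ (.refl _)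
  have e : s = r := Stage.Vals.unique hs (fun B x => h2 B _ _ ⟨x, rfl, rfl⟩)
  rw [e] at k
  -- The stage lies above the initial one, and `h3` is the conservativity of that extension.
  exact h3 ψ k

/-! ### Equivalence classes of names, coded by elements of `D` -/

variable (φ₀ D)

def witnessSetoid (A : L.Srt) : Setoid {w : Witness Γ₀ A // Exi (T := T) φ₀ D w} where
  r w w' := Eqv (T := T) φ₀ D w.1 w'.1
  iseqv := ⟨fun w => .refl w.2, .symm, .trans⟩

variable {D} (T) (j : ∀ A : L.Srt, Witness Γ₀ A ↪ D)

/-- Models must have their elements in `D`, so a class of names is replaced by the code of a chosen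
representative. -/
noncomputable def genericCode (A : L.Srt) (q : Quotient (witnessSetoid (T := T) φ₀ D A)) : D :=
  j A q.out.1

theorem genericCode_injective (A : L.Srt) : Function.Injective (genericCode T φ₀ j A) := by
  intro q q' h
  have := (j A).injective h
  rw [← q.out_eq, ← q'.out_eq, Subtype.ext this]

def genericCarrier (A : L.Srt) : Set D := Set.range (genericCode T φ₀ j A)

noncomputable def genericEquiv (A : L.Srt) :
    Quotient (witnessSetoid (T := T) φ₀ D A) ≃ genericCarrier T φ₀ j A :=
  Equiv.ofInjective _ (genericCode_injective T φ₀ j A)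

variable {φ₀ j T}

/-- A name of an element of the generic model. -/
noncomputable def rep {A : L.Srt} (m : genericCarrier T φ₀ j A) : Witness Γ₀ A :=
  ((genericEquiv T φ₀ j A).symm m).out.1

theorem exi_rep {A : L.Srt} (m : genericCarrier T φ₀ j A) : Exi (T := T) φ₀ D (rep m) :=
  ((genericEquiv T φ₀ j A).symm m).out.2

theorem eq_of_eqv_rep {A : L.Srt} {m m' : genericCarrier T φ₀ j A}
    (h : Eqv (T := T) φ₀ D (rep m) (rep m')) : m = m' := by
  apply (genericEquiv T φ₀ j A).symm.injective
  rw [← Quotient.out_eq ((genericEquiv T φ₀ j A).symm m),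
    ← Quotient.out_eq ((genericEquiv T φ₀ j A).symm m')]
  exact Quotient.sound h

variable (j) in
/-- The element of the generic model that is denoted by a name. -/
noncomputable def denote {A : L.Srt} (w : Witness Γ₀ A) (h : Exi (T := T) φ₀ D w) :
    genericCarrier T φ₀ j A :=
  genericEquiv T φ₀ j A (Quotient.mk (witnessSetoid φ₀ D A) ⟨w, h⟩)

theorem eqv_rep_denote {A : L.Srt} (w : Witness Γ₀ A) (h : Exi (T := T) φ₀ D w) :
    Eqv (T := T) φ₀ D (rep (denote j w h)) w := by
  unfold rep denote
  rw [Equiv.symm_apply_apply]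
  exact Quotient.mk_out (s := witnessSetoid φ₀ D A) (⟨w, h⟩ : {w // Exi (T := T) φ₀ D w})

/-- The formula `f(x) = y`. -/
def fnGraph (f : L.Fn) : Formula L (L.cod f :: L.dom f) :=
  .eq (.app f (fun _ x => .var (.succ x))) (.var .zero)

theorem provable_ex_fnGraph (f : L.Fn) : Provable T .top (.ex _ (fnGraph f)) := by
  have h := (Provable.ex_intro (.refl (T := T) (.ex _ (fnGraph f)))).subst
    (Fam.cons (.app f (fun _ x => .var x)) (Sub.id _) : Sub L _ (L.dom f))
  rw [Formula.subst_subst, Sub.wk_cons, Formula.subst_id] at h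
  exact .cut (.eq_refl _) h

theorem tr_ex_fnGraph (f : L.Fn) {g : Fam (Witness Γ₀) (L.dom f)}
    (h : ∀ B x, Exi (T := T) φ₀ D (g B x)) : Tr (T := T) φ₀ D (.ex _ (fnGraph f)) g :=
  (tr_top h).cut (provable_ex_fnGraph f)

-- Names are not closed under function symbols; the value of `f` is therefore the Henkin witness of
-- `∃ y, f(x) = y`, a formula that is provable for all `x`.
variable (T φ₀ j) in
noncomputable def genericStr : StrIn L D where
  carrier := genericCarrier T φ₀ j
  fn f m := denote j (.wit (fnGraph f) (fun A x => rep (m A x)))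
    ((tr_ex_fnGraph f (fun A x => exi_rep (m A x))).wit.exi _ .zero)
  rel R := {m | Tr (T := T) φ₀ D (.rel R (fun _ x => .var x)) (fun A x => rep (m A x))}

/-- Names of the elements of a tuple. -/
noncomputable def reps {Δ : List L.Srt} (m : (genericStr T φ₀ j).Env Δ) : Fam (Witness Γ₀) Δ :=
  fun A x => rep (m A x)

theorem exi_reps {Δ : List L.Srt} (m : (genericStr T φ₀ j).Env Δ) (B : L.Srt) (x : Var Δ B) :
    Exi (T := T) φ₀ D (reps m B x) := exi_rep _

theorem reps_cons {A : L.Srt} {Δ : List L.Srt} (a : (genericStr T φ₀ j).carrier A)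
    (m : (genericStr T φ₀ j).Env Δ) :
    reps ((genericStr T φ₀ j).consEnv a m) = Fam.cons (rep a) (reps m) := by
  funext B x
  cases x <;> rfl

theorem tr_fnGraph (f : L.Fn) (m : (genericStr T φ₀ j).Env (L.dom f)) :
    Tr (T := T) φ₀ D (fnGraph f) (Fam.cons (rep ((genericStr T φ₀ j).fn f m)) (reps m)) := by
  refine (tr_ex_fnGraph f (exi_reps m)).wit.congr ?_
  intro B x
  cases x with
  | zero => exact (eqv_rep_denote _ _).symm
  | succ x => exact .refl (exi_reps m B x)

theorem stable_term {Δ : List L.Srt} {A : L.Srt} (t : Term L Δ A) (g : Fam (Witness Γ₀) Δ)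
    (w : Witness Γ₀ A) : Stage.Stable D (fun S : Stage T Γ₀ =>
      ∃ s u, S.Vals g s ∧ S.val A w u ∧ Provable T S.form (.eq (t.subst s) u)) := by
  rintro S S' ⟨r, h1, h, -⟩ ⟨s, u, hs, hu, k⟩
  refine ⟨s.comp r, _, fun B x => h _ _ _ (hs B x), h _ _ _ hu, ?_⟩
  rw [← Term.subst_subst]
  exact h1.cut (k.subst r)

/-- The bridge between semantic evaluation and syntactic substitution: at sufficiently late stages
they agree provably. For a compound term, finitely many statements about its arguments are made true
at one stage, and congruence is combined with the defining equation of the witness that interprets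
`f`. -/
theorem ev_eval {Δ : List L.Srt} (m : (genericStr T φ₀ j).Env Δ) :
    ∀ {A : L.Srt} (t : Term L Δ A), Ev (T := T) φ₀ D (fun S => ∃ s u, S.Vals (reps m) s ∧
      S.val A (rep ((genericStr T φ₀ j).eval m t)) u ∧ Provable T S.form (.eq (t.subst s) u))
  | _, .var x => by
      refine (ev_vals (exi_reps m)).mono ?_
      rintro S ⟨s, hs⟩
      exact ⟨s, s _ x, hs, hs _ x, .cut (.top_intro _) (.eq_refl _)⟩
  | _, .app f ts => by
      have h := tr_fnGraph f (fun A x => (genericStr T φ₀ j).eval m (ts A x))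
      have k := Ev.all (fun A x => stable_term (D := D) _ _ _) (fun A x => ev_eval m (ts A x))
      refine (Ev.and (Stage.stable_vals _) (ev_vals (exi_reps m))
        (Ev.and (Stage.stable_forces _ _) h k)).mono ?_
      rintro S ⟨⟨s, hs⟩, ⟨r, hr, h1⟩, h2⟩
      choose s' u hs' hu h3 using h2
      refine ⟨s, r _ .zero, hs, hr _ .zero, ?_⟩
      refine Provable.eq_trans (Provable.eq_app ?_) h1
      intro A x
      have e : u A x = r A (.succ x) := S.val_unique (hu A x) (hr A (.succ x))
      have := h3 A x
      rw [(hs' A x).unique hs, e] at this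
      exact this

theorem exists_eqv_rep {A : L.Srt} {w : Witness Γ₀ A} (h : Exi (T := T) φ₀ D w) :
    ∃ a : (genericStr T φ₀ j).carrier A, Eqv (T := T) φ₀ D (rep a) w :=
  ⟨denote j w h, eqv_rep_denote w h⟩

/-- The truth lemma. Atomic formulas reduce to names by `ev_eval`, conjunction is `Ev.and`, and the
existential case is the purpose of the witnesses: `Tr.wit` names an element that has the required
property. -/
theorem sat_genericStr : ∀ {Δ : List L.Srt} (χ : Formula L Δ) (m : (genericStr T φ₀ j).Env Δ),
    (genericStr T φ₀ j).sat χ m ↔ Tr (T := T) φ₀ D χ (reps m)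
  | _, .top, m => ⟨fun _ => tr_top (exi_reps m), fun _ => trivial⟩
  | _, .eq t t', m => by
      have key := Ev.and (stable_term _ _ _) (ev_eval m t) (ev_eval m t')
      constructor
      · intro h
        replace h : (genericStr T φ₀ j).eval m t = (genericStr T φ₀ j).eval m t' := h
        refine key.mono ?_
        rintro S ⟨⟨s, u, hs, hu, k⟩, ⟨s', u', hs', hu', k'⟩⟩
        obtain rfl := hs.unique hs'
        rw [h] at hu
        obtain rfl := S.val_unique hu hu'
        exact ⟨s, hs, k.eq_trans k'.eq_symm⟩
      · intro h
        refine eq_of_eqv_rep ((Ev.and (Stage.stable_forces _ _) h key).mono ?_)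
        rintro S ⟨⟨r, hr, k0⟩, ⟨s, u, hs, hu, k⟩, ⟨s', u', hs', hu', k'⟩⟩
        obtain rfl := hs.unique hs'
        obtain rfl := hs.unique hr
        exact ⟨u, u', hu, hu', k.eq_symm.eq_trans (Provable.eq_trans k0 k')⟩
  | _, .rel R ts, m => by
      have k := Ev.all (fun A x => stable_term (D := D) _ _ _) (fun A x => ev_eval m (ts A x))
      have key := Ev.and (Stage.stable_vals _) (ev_vals (exi_reps m)) k
      constructor
      · intro h
        refine (Ev.and (Stage.stable_forces _ _) h key).mono ?_
        rintro S ⟨⟨r, hr, k0⟩, ⟨s, hs⟩, h2⟩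
        choose s' u hs' hu h3 using h2
        refine ⟨s, hs, Provable.eqs_use (s := r) (.rel R (fun _ x => .var x)) ?_ k0⟩
        refine Provable.eqs_intro fun A x => ?_
        have e := S.val_unique (hu A x) (hr A x)
        have := h3 A x
        rw [(hs' A x).unique hs, e] at this
        exact this.eq_symm
      · intro h
        refine (Ev.and (Stage.stable_forces _ _) h key).mono ?_
        rintro S ⟨⟨r, hr, k0⟩, ⟨s, hs⟩, h2⟩
        choose s' u hs' hu h3 using h2
        refine ⟨u, hu, Provable.eqs_use (s := fun A x => (ts A x).subst r)
          (.rel R (fun _ x => .var x)) ?_ k0⟩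
        refine Provable.eqs_intro fun A x => ?_
        have := h3 A x
        rwa [(hs' A x).unique hr] at this
  | _, .and φ ψ, m => by
      rw [StrIn.sat, sat_genericStr φ, sat_genericStr ψ]
      exact ⟨fun h => h.1.and h.2, fun h => ⟨h.cut (.and_left _ _), h.cut (.and_right _ _)⟩⟩
  | _, .ex A φ, m => by
      constructor
      · rintro ⟨a, h⟩
        rw [sat_genericStr φ, reps_cons] at h
        exact h.ex
      · intro h
        have h' := h.wit
        obtain ⟨a, ha⟩ := exists_eqv_rep (j := j) (h'.exi _ .zero)
        refine ⟨a, ?_⟩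
        rw [sat_genericStr φ, reps_cons]
        refine h'.congr ?_
        intro B x
        cases x with
        | zero => exact ha.symm
        | succ x => exact .refl (exi_reps m B x)

variable (T φ₀ j) in
noncomputable def genericModel : ModIn T D where
  toStrIn := genericStr T φ₀ j
  holds q hq m h := by
    rw [sat_genericStr] at h ⊢
    exact h.cut (.ax q hq)

/-- The denotation of names in the generic model. -/
def genericHenkinMap : HenkinMap (genericStr T φ₀ j) Γ₀ where
  rel A w m := Eqv (T := T) φ₀ D (rep m) w
  unique h h' := eq_of_eqv_rep (h.trans h'.symm)
  wit := by
    intro A Δ φ g d hd h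
    rw [sat_genericStr] at h
    have h' := (h.congr hd).wit
    obtain ⟨a, ha⟩ := exists_eqv_rep (j := j) (h'.exi _ .zero)
    refine ⟨a, ha, ?_⟩
    rw [sat_genericStr φ, reps_cons]
    refine h'.congr ?_
    intro B x
    cases x with
    | zero => exact ha.symm
    | succ x => exact (hd B x).symm

/-! ### Homomorphisms out of the generic model -/

theorem exists_tuple {Δ : List L.Srt} {g : Fam (Witness Γ₀) Δ}
    (h : ∀ B x, Exi (T := T) φ₀ D (g B x)) :
    ∃ m : (genericStr T φ₀ j).Env Δ, ∀ B x, Eqv (T := T) φ₀ D (reps m B x) (g B x) := by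
  choose m hm using fun B x => exists_eqv_rep (j := j) (h B x)
  exact ⟨m, hm⟩

/-- Every element of the generic model has a value under a Henkin map that realizes some stage. -/
theorem exists_sat_of_tr {N : ModIn T D} {ν : HenkinMap N.toStrIn Γ₀} {S : Stage T Γ₀}
    (hS : (Stage.initial T φ₀).Le D S) {e : N.Env S.ctx} (he : S.Realizes ν e) {Δ : List L.Srt}
    {χ : Formula L Δ} {g : Fam (Witness Γ₀) Δ} (h : Tr (T := T) φ₀ D χ g) :
    ∃ d : N.Env Δ, (∀ B x, ν.rel B (g B x) (d B x)) ∧ N.sat χ d := by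
  obtain ⟨S', h1, s, hs, k⟩ := h S hS
  obtain ⟨e', he'⟩ := h1.realizes he
  refine ⟨N.evalSub s e', he'.vals hs, ?_⟩
  rw [← StrIn.sat_subst]
  exact StrIn.sound N.holds k _ he'.1

/-- A family of functions that preserves the satisfaction of formulas is a homomorphism. -/
def StrIn.Hom.ofSat {M N : StrIn L D} (f : ∀ A, M.carrier A → N.carrier A)
    (h : ∀ {Δ : List L.Srt} (χ : Formula L Δ) (m : M.Env Δ), M.sat χ m →
      N.sat χ (fun A x => f A (m A x))) : StrIn.Hom M N where
  toFun := f
  map_fn k a := (h (fnGraph k) (M.consEnv (M.fn k a) a) rfl).symm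
  map_rel R a ha := h (.rel R (fun _ x => .var x)) a ha

/-- Above `S`, every name that denotes receives a term at some further stage; this stage is again
realized along `ν`, so `ν` has a value at the name. Any true formula is forced at such a stage as
well, hence holds of the values by soundness, and single-valuedness of `ν` makes the values found at
different stages agree. -/
theorem exists_hom_of_realizes {N : ModIn T D} {ν : HenkinMap N.toStrIn Γ₀} {S : Stage T Γ₀}
    (hS : (Stage.initial T φ₀).Le D S) {e : N.Env S.ctx} (he : S.Realizes ν e) :
    ∃ f : genericModel T φ₀ j ⟶ N, ∀ (A : L.Srt) (m : (genericStr T φ₀ j).carrier A),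
      ν.rel A (rep m) (StrIn.Hom.toFun f A m) := by
  have key : ∀ (A : L.Srt) (m : (genericStr T φ₀ j).carrier A), ∃ n, ν.rel A (rep m) n := by
    intro A m
    obtain ⟨d, hd, -⟩ := exists_sat_of_tr hS he (tr_top
      (g := (Fam.cons (rep m) (fun _ x => nomatch x) : Fam (Witness Γ₀) [A])) (by
        intro B x
        cases x with
        | zero => exact exi_rep m
        | succ x => nomatch x))
    exact ⟨_, hd A .zero⟩
  choose f hf using key
  refine ⟨StrIn.Hom.ofSat f ?_, hf⟩
  intro Δ χ m h
  obtain ⟨d, hd, h'⟩ := exists_sat_of_tr hS he ((sat_genericStr χ m).1 h)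
  convert h'
  rename_i A x
  exact ν.unique (hf A (m A x)) (hd A x)

/-- The formula that defines the image of `θ` under a tuple of terms. -/
def Formula.image {Γ Δ : List L.Srt} (θ : Formula L Γ) (s : Sub L Δ Γ) : Formula L Δ :=
  exs Γ (.and (θ.subst (Sub.inl Γ Δ)) (eqs (s.comp (Sub.inl Γ Δ)) (Sub.inr Γ Δ)))

theorem StrIn.sat_image {N : StrIn L D} {Γ Δ : List L.Srt} (θ : Formula L Γ) (s : Sub L Δ Γ)
    (d : N.Env Δ) : N.sat (θ.image s) d ↔ ∃ e : N.Env Γ, N.sat θ e ∧ N.evalSub s e = d := by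
  rw [Formula.image, sat_exs]
  simp only [sat, sat_subst, sat_eqs, evalSub_comp, evalSub_inl, evalSub_inr]

/-- Generic models: the generic tuple satisfies the provable consequences of `φ₀` only, and
every tuple of elements is determined by a formula, up to homomorphisms. -/
theorem exists_generic_of_embedding (φ₀ : Formula L Γ₀) (j : ∀ A : L.Srt, Witness Γ₀ A ↪ D) :
    ∃ (M : ModIn T D) (a : M.Env Γ₀), M.sat φ₀ a ∧
      (∀ ψ : Formula L Γ₀, M.sat ψ a → Provable T φ₀ ψ) ∧
      ∀ {Δ : List L.Srt} (b : M.Env Δ), ∃ σ : Formula L (Δ ++ Γ₀), M.sat σ (Fam.append b a) ∧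
        (∀ (N : ModIn T D) (c : N.Env Γ₀), N.sat φ₀ c → ∃ d, N.sat σ (Fam.append d c)) ∧
        ∀ (N : ModIn T D) (c : N.Env Γ₀) (d : N.Env Δ), N.sat σ (Fam.append d c) →
          ∃ f : M ⟶ N, StrIn.Hom.mapEnv f a = c ∧ StrIn.Hom.mapEnv f b = d := by
  have h0 : (Stage.initial T φ₀).Le D (Stage.initial T φ₀) := .refl _
  obtain ⟨a, ha⟩ := exists_tuple (T := T) (φ₀ := φ₀) (j := j) tr_initial.exi
  have ha' : (genericStr T φ₀ j).sat φ₀ a :=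
    (sat_genericStr _ _).2 (tr_initial.congr fun B x => (ha B x).symm)
  refine ⟨genericModel T φ₀ j, a, ha', ?_, ?_⟩
  · intro ψ h
    exact (((sat_genericStr (j := j) ψ a).1 h).congr ha).provable
  intro Δ b
  -- At `S` all names of `b` have terms `t`. The formula `σ` will be `S.form` projected along `t`
  -- and the terms `u` of the generic variables.
  obtain ⟨S, hS, t, ht⟩ := ev_vals (T := T) (exi_reps (j := j) b) _ h0
  have hbase : ∃ u, S.Vals (fun _ x => Witness.base x) u := by
    obtain ⟨r, -, h2, -⟩ := hS
    exact ⟨r, fun B x => h2 B _ _ ⟨x, rfl, rfl⟩⟩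
  obtain ⟨u, hu⟩ := hbase
  -- A Henkin map that sends the generic variables to `c` realizes the initial stage at `c`, hence
  -- also realizes `S`.
  have key : ∀ (N : ModIn T D) (ν : HenkinMap N.toStrIn Γ₀) (c : N.Env Γ₀), N.sat φ₀ c →
      (∀ B x, ν.rel B (.base x) (c B x)) →
      ∃ e, S.Realizes ν e ∧ N.evalSub u e = c ∧ ∀ B x, ν.rel B (reps b B x) (N.evalSub t e B x) := by
    intro N ν c hc hν
    obtain ⟨e, he⟩ := hS.realizes (N := N) (ν := ν) (e := c) ⟨hc, by
      rintro A w t ⟨x, rfl, rfl⟩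
      exact hν A x⟩
    refine ⟨e, he, ?_, he.vals ht⟩
    funext B x
    exact ν.unique (he.vals hu B x) (hν B x)
  refine ⟨S.form.image (Sub.pair t u), ?_, ?_, ?_⟩
  · rw [StrIn.sat_image]
    -- The generic model realizes `S` through its own denotation of names.
    obtain ⟨e, he, h1, h2⟩ := key (genericModel T φ₀ j) genericHenkinMap a ha' ha
    refine ⟨e, he.1, ?_⟩
    rw [StrIn.evalSub_pair, h1]
    congr 1
    funext B x
    exact (genericHenkinMap (j := j)).unique (h2 B x) (.refl (exi_reps b B x))
  · intro N c hc
    obtain ⟨e, he, h1, h2⟩ := key N ((Stage.initial T φ₀).henkinMap N.toStrIn N.holds c hc) c hc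
      (fun B x => ((Stage.initial T φ₀).realizes_henkinMap N.toStrIn N.holds c hc).2 B _ (.var x)
        ⟨x, rfl, rfl⟩)
    refine ⟨N.evalSub t e, ?_⟩
    rw [StrIn.sat_image]
    exact ⟨e, he.1, by rw [StrIn.evalSub_pair, h1]⟩
  · intro N c d h
    rw [StrIn.sat_image] at h
    obtain ⟨e, he, h⟩ := h
    rw [StrIn.evalSub_pair] at h
    have hc : N.evalSub u e = c := by
      rw [← StrIn.evalSub_inr d c, ← h, StrIn.evalSub_inr]
    have hd : N.evalSub t e = d := by
      rw [← StrIn.evalSub_inl d c, ← h, StrIn.evalSub_inl]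
    -- Now the Henkin map is built over `S` rather than over the initial stage, so that the names of
    -- `b` take the prescribed values `d`.
    have hR := S.realizes_henkinMap N.toStrIn N.holds e he
    obtain ⟨f, hf⟩ := exists_hom_of_realizes (j := j) hS hR
    refine ⟨f, ?_, ?_⟩
    · rw [← hc]
      funext B x
      -- The chosen name of `a B x` is only equivalent to `.base x`. That the two have the same
      -- value in `N` follows from the truth of the formula `x = y` at this pair of names.
      obtain ⟨g, hg, h1⟩ := exists_sat_of_tr hS hR
        (χ := .eq (.var .zero) (.var (.succ .zero)))
        (g := (Fam.cons (rep (a B x)) (Fam.cons (.base x) (fun _ x => nomatch x)) :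
          Fam (Witness Γ₀) [B, B])) (by
            refine (ha B x).mono ?_
            rintro S ⟨t, t', h1, h2, h3⟩
            exact ⟨Fam.cons t (Fam.cons t' (fun _ x => nomatch x)),
              Stage.Vals.cons h1 (Stage.Vals.cons h2 (fun _ x => nomatch x)), h3⟩)
      have e1 := HenkinMap.unique _ (hf B (a B x)) (hg B .zero)
      have e2 := HenkinMap.unique _ (hR.vals hu B x) (hg B (.succ .zero))
      exact e1.trans (Eq.trans h1 e2.symm)
    · rw [← hd]
      funext B x
      exact HenkinMap.unique _ (hf B (b B x)) (hR.vals ht B x)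

end GenericModel
/-! ### Cardinality of the set of names -/

section Cardinality

open Cardinal

theorem mk_sigma_le {κ : Cardinal.{u}} (hκ : ℵ₀ ≤ κ) {ι : Type u} {X : ι → Type u}
    (h : #ι ≤ κ) (h' : ∀ i, #(X i) ≤ κ) : #(Σ i, X i) ≤ κ := by
  rw [mk_sigma]
  refine (Cardinal.sum_le_mk_mul_iSup _).trans ?_
  exact (mul_le_mul' h (ciSup_le' h')).trans (mul_eq_self hκ).le

theorem mk_sum_le {κ : Cardinal.{u}} (hκ : ℵ₀ ≤ κ) {α β : Type u} (h : #α ≤ κ) (h' : #β ≤ κ) :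
    #(α ⊕ β) ≤ κ := by
  rw [mk_sum, lift_id, lift_id]
  exact (add_le_add h h').trans (add_eq_self hκ).le

theorem mk_prod_le {κ : Cardinal.{u}} (hκ : ℵ₀ ≤ κ) {α β : Type u} (h : #α ≤ κ) (h' : #β ≤ κ) :
    #(α × β) ≤ κ := by
  rw [mk_prod, lift_id, lift_id]
  exact (mul_le_mul' h h').trans (mul_eq_self hκ).le

theorem mk_fun_le {κ : Cardinal.{u}} (hκ : ℵ₀ ≤ κ) {ι α : Type u} [Finite ι] (h : #α ≤ κ) :
    #(ι → α) ≤ κ := by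
  rw [← power_def]
  obtain ⟨n, hn⟩ := lt_aleph0.1 (lt_aleph0_of_finite ι)
  rw [hn]
  exact (power_le_power_right h).trans (power_nat_le hκ)

theorem mk_wType_le {κ : Cardinal.{u}} (hκ : ℵ₀ ≤ κ) {α : Type u} {β : α → Type u}
    [∀ a, Finite (β a)] (h : #α ≤ κ) : #(WType β) ≤ κ :=
  WType.cardinalMk_le_max_aleph0_of_finite.trans (max_le h hκ)

/-- All variables of a context. -/
abbrev Vars {S : Type u} (Γ : List S) : Type u := Σ A : S, Var Γ A

instance finite_vars {S : Type u} : ∀ Γ : List S, Finite (Vars Γ)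
  | [] => by
      have : IsEmpty (Vars ([] : List S)) := ⟨fun x => nomatch x.2⟩
      infer_instance
  | A :: Γ => by
      have := finite_vars Γ
      refine Finite.of_surjective (α := Option (Vars Γ))
        (fun x => x.elim ⟨A, .zero⟩ (fun x => ⟨x.1, .succ x.2⟩)) ?_
      rintro ⟨B, x⟩
      cases x with
      | zero => exact ⟨none, rfl⟩
      | succ x => exact ⟨some ⟨B, x⟩, rfl⟩

variable {L : Signature.{u}}

/-- Terms, formulas and names are all coded injectively as well-founded trees with finite branching;
the number of such trees is at most the maximum of `ℵ₀` and the number of node labels. -/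
def termArity (Γ : List L.Srt) : Vars Γ ⊕ L.Fn → Type u
  | .inl _ => PEmpty
  | .inr f => Vars (L.dom f)

instance (Γ : List L.Srt) : ∀ a, Finite (termArity Γ a)
  | .inl _ => inferInstanceAs (Finite PEmpty)
  | .inr f => finite_vars (L.dom f)

def Term.code {Γ : List L.Srt} : ∀ {A : L.Srt}, Term L Γ A → WType (termArity Γ)
  | A, .var x => ⟨.inl ⟨A, x⟩, fun x => nomatch x⟩
  | _, .app f ts => ⟨.inr f, fun x : Vars (L.dom f) => (ts x.1 x.2).code⟩

theorem Term.code_injective {Γ : List L.Srt} : ∀ {A A' : L.Srt} (t : Term L Γ A)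
    (t' : Term L Γ A'), t.code = t'.code → (⟨A, t⟩ : Σ A, Term L Γ A) = ⟨A', t'⟩
  | _, _, .var x, .var x', h => by
      cases h
      rfl
  | _, _, .var x, .app f ts, h => nomatch h
  | _, _, .app f ts, .var x, h => nomatch h
  | _, _, .app f ts, .app f' ts', h => by
      simp only [code] at h
      obtain ⟨h0, h⟩ := WType.mk.inj h
      cases Sum.inr.inj h0
      have h' := eq_of_heq h
      have : ts = ts' := by
        funext A x
        have := Term.code_injective (ts A x) (ts' A x) (congrFun h' ⟨A, x⟩)
        exact eq_of_heq (Sigma.mk.inj this).2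
      rw [this]

/-- Atomic formulas and truth. -/
abbrev Atom (L : Signature.{u}) (Γ : List L.Srt) : Type u :=
  PUnit.{u + 1} ⊕ (Σ A : L.Srt, Term L Γ A × Term L Γ A) ⊕
    (Σ R : L.Rel, Vars (L.arity R) → Σ A : L.Srt, Term L Γ A)

/-- Atomic formulas with their contexts are leaves; `true` marks a conjunction and `false` a
quantifier. The quantified sort needs no label, because it is the head of the context of the body.
-/
def formulaArity (L : Signature.{u}) :
    (Σ Γ : List L.Srt, Atom L Γ) ⊕ ULift.{u} Bool → Type u
  | .inl _ => PEmpty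
  | .inr ⟨true⟩ => ULift Bool
  | .inr ⟨false⟩ => PUnit

instance (L : Signature.{u}) : ∀ a, Finite (formulaArity L a)
  | .inl _ => inferInstanceAs (Finite PEmpty)
  | .inr ⟨true⟩ => inferInstanceAs (Finite (ULift Bool))
  | .inr ⟨false⟩ => inferInstanceAs (Finite PUnit)

def Formula.code : ∀ {Γ : List L.Srt}, Formula L Γ → WType (formulaArity L)
  | Γ, .top => ⟨.inl ⟨Γ, .inl ⟨⟩⟩, fun x => nomatch x⟩
  | Γ, .eq (A := A) t t' => ⟨.inl ⟨Γ, .inr (.inl ⟨A, t, t'⟩)⟩, fun x => nomatch x⟩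
  | Γ, .rel R ts => ⟨.inl ⟨Γ, .inr (.inr ⟨R, fun x => ⟨x.1, ts x.1 x.2⟩⟩)⟩, fun x => nomatch x⟩
  | _, .and φ ψ => ⟨.inr ⟨true⟩, fun b : ULift Bool => bif b.down then φ.code else ψ.code⟩
  | _, .ex _ φ => ⟨.inr ⟨false⟩, fun _ => φ.code⟩

theorem Formula.code_injective : ∀ {Γ Γ' : List L.Srt} (φ : Formula L Γ) (φ' : Formula L Γ'),
    φ.code = φ'.code → (⟨Γ, φ⟩ : Σ Γ, Formula L Γ) = ⟨Γ', φ'⟩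
  | _, _, .and φ ψ, φ', h => by
      cases φ' with
      | and φ' ψ' =>
        simp only [code] at h
        have h := eq_of_heq (WType.mk.inj h).2
        have h1 := Formula.code_injective φ φ' (congrFun h (⟨true⟩ : ULift Bool))
        have h2 := Formula.code_injective ψ ψ' (congrFun h (⟨false⟩ : ULift Bool))
        cases h1
        cases h2
        rfl
      | _ => exact nomatch h
  | _, _, .ex A φ, φ', h => by
      cases φ' with
      | ex A' φ' =>
        simp only [code] at h
        have h := eq_of_heq (WType.mk.inj h).2
        have h1 := Formula.code_injective φ φ' (congrFun h PUnit.unit)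
        cases h1
        rfl
      | _ => exact nomatch h
  | _, _, .top, φ', h => by
      cases φ' with
      | top =>
        cases h
        rfl
      | _ => exact nomatch h
  | _, _, .eq t t', φ', h => by
      cases φ' with
      | eq t t' =>
        cases h
        rfl
      | _ => exact nomatch h
  | Γ, _, .rel R ts, φ', h => by
      cases φ' with
      | rel R' ts' =>
        simp only [code, WType.mk.injEq, Sum.inl.injEq, Sigma.mk.injEq] at h
        obtain ⟨⟨rfl, h⟩, -⟩ := h
        have h := eq_of_heq h
        simp only [Sum.inr.injEq, Sigma.mk.injEq] at h
        obtain ⟨rfl, h⟩ := h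
        have h := eq_of_heq h
        have : ts = ts' := by
          funext A x
          exact eq_of_heq (Sigma.mk.inj (congrFun h ⟨A, x⟩)).2
        rw [this]
      | _ => exact nomatch h

def witnessArity (Γ₀ : List L.Srt) :
    Vars Γ₀ ⊕ (Σ p : L.Srt × List L.Srt, Formula L (p.1 :: p.2)) → Type u
  | .inl _ => PEmpty
  | .inr p => Vars p.1.2

instance (Γ₀ : List L.Srt) : ∀ a, Finite (witnessArity Γ₀ a)
  | .inl _ => inferInstanceAs (Finite PEmpty)
  | .inr p => finite_vars p.1.2

def Witness.code {Γ₀ : List L.Srt} : ∀ {A : L.Srt}, Witness Γ₀ A → WType (witnessArity Γ₀)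
  | A, .base x => ⟨.inl ⟨A, x⟩, fun x => nomatch x⟩
  | A, .wit (Δ := Δ) φ g => ⟨.inr ⟨(A, Δ), φ⟩, fun x : Vars Δ => (g x.1 x.2).code⟩

theorem Witness.code_injective {Γ₀ : List L.Srt} : ∀ {A A' : L.Srt} (w : Witness Γ₀ A)
    (w' : Witness Γ₀ A'), w.code = w'.code → (⟨A, w⟩ : Σ A, Witness Γ₀ A) = ⟨A', w'⟩
  | _, _, .base x, .base x', h => by
      cases h
      rfl
  | _, _, .base x, .wit φ g, h => nomatch h
  | _, _, .wit φ g, .base x, h => nomatch h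
  | _, _, .wit φ g, .wit φ' g', h => by
      simp only [code] at h
      obtain ⟨h0, h⟩ := WType.mk.inj h
      cases Sum.inr.inj h0
      have h' := eq_of_heq h
      have : g = g' := by
        funext A x
        have := Witness.code_injective (g A x) (g' A x) (congrFun h' ⟨A, x⟩)
        exact eq_of_heq (Sigma.mk.inj this).2
      rw [this]

variable {κ : Cardinal.{u}}

theorem mk_vars_le (hκ : ℵ₀ ≤ κ) {S : Type u} (Γ : List S) : #(Vars Γ) ≤ κ :=
  (lt_aleph0_of_finite _).le.trans hκ

theorem mk_list_le' (hκ : ℵ₀ ≤ κ) {S : Type u} (h : #S ≤ κ) : #(List S) ≤ κ :=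
  (mk_list_le_max S).trans (max_le hκ h)

theorem mk_terms_le (hκ : ℵ₀ ≤ κ) (hF : #L.Fn ≤ κ) (Γ : List L.Srt) :
    #(Σ A, Term L Γ A) ≤ κ :=
  (mk_le_of_injective (f := fun t : Σ A, Term L Γ A => t.2.code)
    (fun _ _ h => Term.code_injective _ _ h)).trans
    (mk_wType_le hκ (mk_sum_le hκ (mk_vars_le hκ Γ) hF))

theorem mk_atom_le (hκ : ℵ₀ ≤ κ) (hS : #L.Srt ≤ κ) (hF : #L.Fn ≤ κ) (hR : #L.Rel ≤ κ)
    (Γ : List L.Srt) : #(Atom L Γ) ≤ κ := by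
  have ht := mk_terms_le hκ hF Γ
  have ht' : ∀ A, #(Term L Γ A) ≤ κ := fun A =>
    (mk_le_of_injective (f := fun t : Term L Γ A => (⟨A, t⟩ : Σ A, Term L Γ A))
      sigma_mk_injective).trans ht
  refine mk_sum_le hκ ?_ (mk_sum_le hκ ?_ ?_)
  · exact (lt_aleph0_of_finite _).le.trans hκ
  · exact mk_sigma_le hκ hS fun A => mk_prod_le hκ (ht' A) (ht' A)
  · exact mk_sigma_le hκ hR fun R => mk_fun_le hκ ht

theorem mk_formulas_le (hκ : ℵ₀ ≤ κ) (hS : #L.Srt ≤ κ) (hF : #L.Fn ≤ κ) (hR : #L.Rel ≤ κ) :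
    #(Σ Γ, Formula L Γ) ≤ κ :=
  (mk_le_of_injective (f := fun t : Σ Γ, Formula L Γ => t.2.code)
    (fun _ _ h => Formula.code_injective _ _ h)).trans
    (mk_wType_le hκ (mk_sum_le hκ (mk_sigma_le hκ (mk_list_le' hκ hS) (mk_atom_le hκ hS hF hR))
      ((lt_aleph0_of_finite _).le.trans hκ)))

theorem mk_witnesses_le (hκ : ℵ₀ ≤ κ) (hS : #L.Srt ≤ κ) (hF : #L.Fn ≤ κ) (hR : #L.Rel ≤ κ)
    (Γ₀ : List L.Srt) : #(Σ A, Witness Γ₀ A) ≤ κ := by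
  refine (mk_le_of_injective (f := fun w : Σ A, Witness Γ₀ A => w.2.code)
    (fun _ _ h => Witness.code_injective _ _ h)).trans
    (mk_wType_le hκ (mk_sum_le hκ (mk_vars_le hκ Γ₀) (mk_sigma_le hκ
      (mk_prod_le hκ hS (mk_list_le' hκ hS)) fun p => ?_)))
  exact (mk_le_of_injective (f := fun t : Formula L (p.1 :: p.2) =>
    (⟨_, t⟩ : Σ Γ, Formula L Γ)) sigma_mk_injective).trans (mk_formulas_le hκ hS hF hR)

/-- Here the size of `D` enters: infinity absorbs the countable growth of contexts, terms and
formulas, and `L.card` bounds the number of symbols. -/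
theorem nonempty_witness_embedding {D : Type u} [Infinite D] (hD : L.card ≤ #D)
    (Γ₀ : List L.Srt) : Nonempty (∀ A : L.Srt, Witness Γ₀ A ↪ D) := by
  have hS : #L.Srt ≤ #D := (mk_le_of_injective (f := fun x : L.Srt =>
    (.inl x : L.Srt ⊕ L.Fn ⊕ L.Rel)) Sum.inl_injective).trans hD
  have hF : #L.Fn ≤ #D := (mk_le_of_injective (f := fun x : L.Fn =>
    (.inr (.inl x) : L.Srt ⊕ L.Fn ⊕ L.Rel)) (Sum.inr_injective.comp Sum.inl_injective)).trans hD
  have hR : #L.Rel ≤ #D := (mk_le_of_injective (f := fun x : L.Rel =>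
    (.inr (.inr x) : L.Srt ⊕ L.Fn ⊕ L.Rel)) (Sum.inr_injective.comp Sum.inr_injective)).trans hD
  obtain ⟨f⟩ := mk_witnesses_le (aleph0_le_mk D) hS hF hR Γ₀
  exact ⟨fun A => ⟨fun w => f ⟨A, w⟩, fun _ _ h => sigma_mk_injective (f.injective h)⟩⟩

end Cardinality
/-! ### Completeness and definability of natural families of functions -/

section Definability

variable {L : Signature.{u}} {T : RegTheory L} {D : Type u}

theorem Fam.exists_append {S : Type u} {X : S → Type v} {Δ Γ : List S} (e : Fam X (Δ ++ Γ)) :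
    ∃ (d : Fam X Δ) (g : Fam X Γ), e = Fam.append d g :=
  ⟨fun A x => e A x.inl, fun A x => e A x.inr, Fam.append_ext _ _
    (fun _ x => (Fam.append_inl (fun A x => e A x.inl) _ x).symm)
    (fun _ x => (Fam.append_inr (fun A x => e A x.inl) (fun A x => e A x.inr) x).symm)⟩

theorem Fam.append_inj {S : Type u} {X : S → Type v} {Δ Γ : List S} {d d' : Fam X Δ}
    {g g' : Fam X Γ} (h : Fam.append d g = Fam.append d' g') : d = d' ∧ g = g' := by
  constructor
  · funext A x
    rw [← Fam.append_inl d g x, h, Fam.append_inl]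
  · funext A x
    rw [← Fam.append_inr d g x, h, Fam.append_inr]

variable [Infinite D] (hD : L.card ≤ Cardinal.mk D)
include hD

theorem exists_generic {Γ₀ : List L.Srt} (φ₀ : Formula L Γ₀) :
    ∃ (M : ModIn T D) (a : M.Env Γ₀), M.sat φ₀ a ∧
      (∀ ψ : Formula L Γ₀, M.sat ψ a → Provable T φ₀ ψ) ∧
      ∀ {Δ : List L.Srt} (b : M.Env Δ), ∃ σ : Formula L (Δ ++ Γ₀), M.sat σ (Fam.append b a) ∧
        (∀ (N : ModIn T D) (c : N.Env Γ₀), N.sat φ₀ c → ∃ d, N.sat σ (Fam.append d c)) ∧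
        ∀ (N : ModIn T D) (c : N.Env Γ₀) (d : N.Env Δ), N.sat σ (Fam.append d c) →
          ∃ f : M ⟶ N, StrIn.Hom.mapEnv f a = c ∧ StrIn.Hom.mapEnv f b = d := by
  obtain ⟨j⟩ := nonempty_witness_embedding hD Γ₀
  exact exists_generic_of_embedding φ₀ j

/-- Completeness with respect to the models with elements from `D`. -/
theorem completeness {Γ : List L.Srt} {φ ψ : Formula L Γ}
    (h : ∀ (N : ModIn T D) (e : N.Env Γ), N.sat φ e → N.sat ψ e) : Provable T φ ψ := by
  obtain ⟨M, a, ha, h', -⟩ := exists_generic (T := T) hD φ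
  exact h' ψ (h M a ha)

/-- By completeness, functionality may be verified in models instead of being derived. -/
theorem IsFunctional.of_sat {Γ Δ : List L.Srt} {φ : Formula L Γ} {ψ : Formula L Δ}
    {σ : Formula L (Δ ++ Γ)}
    (h : ∀ (N : ModIn T D) (c : N.Env Γ) (d : N.Env Δ), N.sat σ (Fam.append d c) →
      N.sat φ c ∧ N.sat ψ d)
    (total : ∀ (N : ModIn T D) (c : N.Env Γ), N.sat φ c → ∃ d, N.sat σ (Fam.append d c))
    (unique : ∀ (N : ModIn T D) (c : N.Env Γ) (d d' : N.Env Δ), N.sat σ (Fam.append d c) →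
      N.sat σ (Fam.append d' c) → d = d') : IsFunctional T φ ψ σ where
  dom := by
    refine completeness hD fun N e he => ?_
    obtain ⟨d, c, rfl⟩ := Fam.exists_append e
    rw [StrIn.sat_subst, StrIn.evalSub_inr]
    exact (h N c d he).1
  cod := by
    refine completeness hD fun N e he => ?_
    obtain ⟨d, c, rfl⟩ := Fam.exists_append e
    rw [StrIn.sat_subst, StrIn.evalSub_inl]
    exact (h N c d he).2
  total := by
    refine completeness hD fun N c hc => ?_
    rw [StrIn.sat_exs]
    exact total N c hc
  unique := by
    refine completeness hD fun N e he => ?_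
    obtain ⟨d, e, rfl⟩ := Fam.exists_append e
    obtain ⟨d', c, rfl⟩ := Fam.exists_append e
    simp only [StrIn.sat, StrIn.sat_subst, StrIn.evalSub_pair, StrIn.evalSub_comp,
      StrIn.evalSub_inl, StrIn.evalSub_inr] at he
    rw [StrIn.sat_eqs, StrIn.evalSub_comp, StrIn.evalSub_inl, StrIn.evalSub_inr,
      StrIn.evalSub_inl]
    exact unique N c d d' he.1 he.2

theorem hom_ext_of_defMap {X Y : SynCat T} {f g : X ⟶ Y}
    (h : ∀ (M : ModIn T D) (a : M.Def X), M.defMap f a = M.defMap g a) : f = g := by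
  have key : ∀ (M : ModIn T D) (a : M.Def X) (b : M.Def Y), M.graph f a b → M.graph g a b := by
    intro M a b hb
    have := M.graph_defMap g a
    rwa [← h, M.defMap_eq hb] at this
  obtain ⟨σ⟩ := f
  obtain ⟨τ⟩ := g
  refine SynCat.FunRel.sound (completeness hD fun N e he => ?_)
  have h1 := StrIn.sound N.holds σ.2.dom e he
  have h2 := StrIn.sound N.holds σ.2.cod e he
  obtain ⟨d, c, rfl⟩ := Fam.exists_append e
  rw [StrIn.sat_subst, StrIn.evalSub_inr] at h1
  rw [StrIn.sat_subst, StrIn.evalSub_inl] at h2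
  exact key N ⟨c, h1⟩ ⟨d, h2⟩ he

/-- Natural families of functions between definable sets are definable. -/
theorem exists_defMap_eq {X Y : SynCat T} (h : ∀ M : ModIn T D, M.Def X → M.Def Y)
    (nat : ∀ {M N : ModIn T D} (k : M ⟶ N) (a : M.Def X), h N (a.push k) = (h M a).push k) :
    ∃ f : X ⟶ Y, ∀ (M : ModIn T D) (a : M.Def X), M.defMap f a = h M a := by
  obtain ⟨M, a, ha, -, h'⟩ := exists_generic (T := T) hD X.form
  obtain ⟨σ, -, h2, h3⟩ := h' (h M ⟨a, ha⟩).1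
  -- A solution `(d, c)` of `σ` is the image of `(h a, a)` under a homomorphism, and naturality
  -- along it gives `d = h c`. So `σ` is contained in the graph of `h`, and totality makes it the
  -- whole graph.
  have key : ∀ (N : ModIn T D) (c : N.Env X.ctx) (d : N.Env Y.ctx),
      N.sat σ (Fam.append d c) → ∃ hc : N.sat X.form c, (h N ⟨c, hc⟩).1 = d := by
    intro N c d hcd
    obtain ⟨k, rfl, rfl⟩ := h3 N c d hcd
    exact ⟨StrIn.Hom.map_sat k X.form a ha, congrArg Subtype.val (nat k ⟨a, ha⟩)⟩
  have hσ : IsFunctional T X.form Y.form σ := by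
    refine IsFunctional.of_sat hD ?_ h2 ?_
    · intro N c d hcd
      obtain ⟨hc, rfl⟩ := key N c d hcd
      exact ⟨hc, (h N ⟨c, hc⟩).2⟩
    · intro N c d d' hd hd'
      obtain ⟨hc, rfl⟩ := key N c d hd
      obtain ⟨_, h4⟩ := key N c d' hd'
      exact h4
  refine ⟨Quotient.mk (SynCat.funSetoid X Y) ⟨σ, hσ⟩, fun N c => N.defMap_eq ?_⟩
  obtain ⟨d, hd⟩ := h2 N c.1 c.2
  obtain ⟨hc, rfl⟩ := key N c.1 d hd
  exact hd

end Definability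

/-! ### Subobjects, the terminal object and pullbacks in the syntactic category -/

section Constructions

variable {L : Signature.{u}} {T : RegTheory L}

theorem exists_graph_formula {X Y : SynCat T} (f : X ⟶ Y) :
    ∃ σ : Formula L (Y.ctx ++ X.ctx), ∀ {D : Type u} (M : ModIn T D) (a : M.Def X) (b : M.Def Y),
      M.defMap f a = b ↔ M.sat σ (Fam.append b.1 a.1) := by
  have key : ∃ σ : Formula L (Y.ctx ++ X.ctx), ∀ {D : Type u} (M : ModIn T D) (a : M.Def X)
      (b : M.Def Y), M.graph f a b ↔ M.sat σ (Fam.append b.1 a.1) := by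
    obtain ⟨σ⟩ := f
    exact ⟨σ.1, fun M a b => Iff.rfl⟩
  obtain ⟨σ, hσ⟩ := key
  refine ⟨σ, fun M a b => ⟨?_, fun h => M.defMap_eq ((hσ M a b).2 h)⟩⟩
  rintro rfl
  exact (hσ M a _).1 (M.graph_defMap f a)

/-- A formula that defines the image of a morphism. -/
theorem exists_image_formula {X Y : SynCat T} (f : X ⟶ Y) :
    ∃ ψ : Formula L Y.ctx, ∀ {D : Type u} (M : ModIn T D) (b : M.Env Y.ctx),
      M.sat ψ b ↔ ∃ a : M.Def X, (M.defMap f a).1 = b := by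
  obtain ⟨σ, hσ⟩ := exists_graph_formula f
  -- The conjuncts `X.form` and `Y.form` place both tuples in the definable sets, outside of which
  -- `hσ` says nothing.
  refine ⟨.exs X.ctx (.and (X.form.subst (Sub.inl _ _)) (.and (Y.form.subst (Sub.inr _ _))
    (σ.subst (Sub.pair (Sub.inr _ _) (Sub.inl _ _))))), fun M b => ?_⟩
  rw [StrIn.sat_exs]
  simp only [StrIn.sat, StrIn.sat_subst, StrIn.evalSub_pair, StrIn.evalSub_inl,
    StrIn.evalSub_inr]
  constructor
  · rintro ⟨a, h1, h2, h3⟩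
    exact ⟨⟨a, h1⟩, congrArg Subtype.val ((hσ M ⟨a, h1⟩ ⟨b, h2⟩).2 h3)⟩
  · rintro ⟨a, rfl⟩
    exact ⟨a.1, a.2, (M.defMap f a).2, (hσ M a _).1 rfl⟩

/-- A formula that defines the fibre product of two morphisms. -/
theorem exists_pullback_formula {X Y Z : SynCat T} (f : X ⟶ Z) (g : Y ⟶ Z) :
    ∃ χ : Formula L (X.ctx ++ Y.ctx), ∀ {D : Type u} (M : ModIn T D) (a : M.Env X.ctx)
      (b : M.Env Y.ctx), M.sat χ (Fam.append a b) ↔ ∃ (ha : M.sat X.form a) (hb : M.sat Y.form b),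
        M.defMap f ⟨a, ha⟩ = M.defMap g ⟨b, hb⟩ := by
  obtain ⟨σ, hσ⟩ := exists_graph_formula f
  obtain ⟨τ, hτ⟩ := exists_graph_formula g
  refine ⟨.and (X.form.subst (Sub.inl _ _)) (.and (Y.form.subst (Sub.inr _ _))
    (.exs Z.ctx (.and (Z.form.subst (Sub.inl _ _)) (.and
      (σ.subst (Sub.pair (Sub.inl _ _) ((Sub.inl _ _).comp (Sub.inr _ _))))
      (τ.subst (Sub.pair (Sub.inl _ _) ((Sub.inr _ _).comp (Sub.inr _ _)))))))), fun M a b => ?_⟩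
  simp only [StrIn.sat, StrIn.sat_exs, StrIn.sat_subst, StrIn.evalSub_pair, StrIn.evalSub_inl,
    StrIn.evalSub_inr, StrIn.evalSub_comp]
  constructor
  · rintro ⟨h1, h2, c, h3, h4, h5⟩
    exact ⟨h1, h2, ((hσ M ⟨a, h1⟩ ⟨c, h3⟩).2 h4).trans ((hτ M ⟨b, h2⟩ ⟨c, h3⟩).2 h5).symm⟩
  · rintro ⟨h1, h2, h⟩
    exact ⟨h1, h2, _, (M.defMap f ⟨a, h1⟩).2, (hσ M _ _).1 rfl, (hτ M _ _).1 h.symm⟩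

end Constructions
/-! ### The logical topologies -/

section Topology

variable {L : Signature.{u}} {T : RegTheory L} {D : Type u}

/-- The elements of `D` that underlie a tuple. -/
def StrIn.under {M : StrIn L D} {Γ : List L.Srt} (e : M.Env Γ) : Fam (fun _ => D) Γ :=
  fun A x => (e A x : D)

theorem StrIn.under_injective {M : StrIn L D} {Γ : List L.Srt} :
    Function.Injective (StrIn.under : M.Env Γ → Fam (fun _ => D) Γ) := by
  intro e e' h
  funext A x
  exact Subtype.ext (congrFun (congrFun h A) x)

theorem StrIn.under_append {M : StrIn L D} {Δ Γ : List L.Srt} (d : M.Env Δ) (e : M.Env Γ) :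
    StrIn.under (Fam.append d e : M.Env (Δ ++ Γ)) =
      Fam.append (StrIn.under d) (StrIn.under e) := by
  apply Fam.append_ext
  · intro A x
    rw [Fam.append_inl]
    exact congrArg Subtype.val (Fam.append_inl d e x)
  · intro A x
    rw [Fam.append_inr]
    exact congrArg Subtype.val (Fam.append_inr d e x)

namespace ModIn

/-- The tuple `a` of elements of `D` lies in `M` and the value of `t` at `a` is `b`. -/
def EvalAt (M : ModIn T D) {Γ : List L.Srt} {A : L.Srt} (t : Term L Γ A)
    (a : Fam (fun _ => D) Γ) (b : D) : Prop :=
  ∃ e : M.Env Γ, StrIn.under e = a ∧ (M.eval e t : D) = b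

/-- The tuple `a` of elements of `D` lies in `M` and satisfies `φ`. -/
def SatAt (M : ModIn T D) {Γ : List L.Srt} (φ : Formula L Γ) (a : Fam (fun _ => D) Γ) : Prop :=
  ∃ e : M.Env Γ, StrIn.under e = a ∧ M.sat φ e

theorem isOpen_carrier (A : L.Srt) (a : D) : IsOpen {M : ModIn T D | a ∈ M.carrier A} :=
  TopologicalSpace.isOpen_generateFrom_of_mem (Or.inl (Or.inl ⟨A, a, rfl⟩))

theorem isOpen_fn (f : L.Fn) (a : Fam (fun _ => D) (L.dom f)) (b : D) :
    IsOpen {M : ModIn T D | ∃ e : M.Env (L.dom f), StrIn.under e = a ∧ (M.fn f e : D) = b} := by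
  have h0 : IsOpen {M : ModIn T D | ∃ h : ∀ A x, a A x ∈ M.carrier A,
      (M.fn f (fun A x => ⟨a A x, h A x⟩) : D) = b} :=
    TopologicalSpace.isOpen_generateFrom_of_mem (Or.inr ⟨f, a, b, rfl⟩)
  convert h0
  constructor
  · rintro ⟨e, rfl, h⟩
    exact ⟨fun A x => (e A x).2, h⟩
  · rintro ⟨h, h'⟩
    exact ⟨_, rfl, h'⟩

theorem isOpen_rel (R : L.Rel) (a : Fam (fun _ => D) (L.arity R)) :
    IsOpen {M : ModIn T D | ∃ e : M.Env (L.arity R), StrIn.under e = a ∧ e ∈ M.rel R} := by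
  have h0 : IsOpen {M : ModIn T D | ∃ h : ∀ A x, a A x ∈ M.carrier A,
      (fun A x => ⟨a A x, h A x⟩) ∈ M.rel R} :=
    TopologicalSpace.isOpen_generateFrom_of_mem (Or.inl (Or.inr ⟨R, a, rfl⟩))
  convert h0
  constructor
  · rintro ⟨e, rfl, h⟩
    exact ⟨fun A x => (e A x).2, h⟩
  · rintro ⟨h, h'⟩
    exact ⟨_, rfl, h'⟩

theorem isOpen_forall_var {Z : Type*} [TopologicalSpace Z] {S : Type u} {Γ : List S}
    {P : ∀ A, Var Γ A → Z → Prop} (h : ∀ A x, IsOpen {z | P A x z}) :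
    IsOpen {z | ∀ A x, P A x z} := by
  have e : {z | ∀ A x, P A x z} = ⋂ x : Vars Γ, {z | P x.1 x.2 z} := by
    ext z
    simp only [Set.mem_ofPred_eq, Set.mem_iInter, Sigma.forall]
  rw [e]
  exact isOpen_iInter_of_finite fun x => h x.1 x.2

theorem isOpen_exists {Z ι : Type*} [TopologicalSpace Z] {P : ι → Z → Prop}
    (h : ∀ i, IsOpen {z | P i z}) : IsOpen {z | ∃ i, P i z} := by
  rw [Set.ofPred_exists]
  exact isOpen_iUnion h

theorem isOpen_env {Γ : List L.Srt} (a : Fam (fun _ => D) Γ) :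
    IsOpen {M : ModIn T D | ∃ e : M.Env Γ, StrIn.under e = a} := by
  convert isOpen_forall_var fun A x => isOpen_carrier (T := T) A (a A x)
  constructor
  · rintro ⟨e, rfl⟩ A x
    exact (e A x).2
  · exact fun h => ⟨fun A x => ⟨_, h A x⟩, rfl⟩

/-- The value of a compound term is reached through some tuple `c` of values of the arguments: a
union over `c` of finite intersections of open sets. -/
theorem isOpen_evalAt {Γ : List L.Srt} (a : Fam (fun _ => D) Γ) : ∀ {A : L.Srt} (t : Term L Γ A)
    (b : D), IsOpen {M : ModIn T D | M.EvalAt t a b}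
  | A, .var x, b => by
      by_cases h : a A x = b
      · convert isOpen_env (T := T) a
        exact ⟨fun ⟨e, he, _⟩ => ⟨e, he⟩, fun ⟨e, he⟩ => ⟨e, he, by rw [← h, ← he]; rfl⟩⟩
      · convert isOpen_empty
        rw [Set.eq_empty_iff_forall_notMem]
        rintro M ⟨e, rfl, he⟩
        exact h he
  | _, .app f ts, b => by
      -- That `a` lies in `M` has to be required separately: if `f` is a constant, there are no
      -- arguments to imply it.
      convert (isOpen_env (T := T) a).inter (isOpen_exists fun c : Fam (fun _ => D) (L.dom f) =>
        (isOpen_forall_var fun A x => isOpen_evalAt a (ts A x) (c A x)).inter (isOpen_fn f c b))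
        using 1
      ext M
      constructor
      · rintro ⟨e, he, h⟩
        exact ⟨⟨e, he⟩, StrIn.under (fun A x => M.eval e (ts A x)), fun A x => ⟨e, he, rfl⟩,
          _, rfl, h⟩
      · rintro ⟨⟨e, he⟩, c, h1, e', rfl, h2⟩
        refine ⟨e, he, ?_⟩
        have : (fun A x => M.eval e (ts A x)) = e' := by
          funext A x
          obtain ⟨e1, h3, h4⟩ := h1 A x
          obtain rfl := StrIn.under_injective (he.trans h3.symm)
          exact Subtype.ext h4
        rw [← h2, ← this]
        rfl

/-- The set of models in which a tuple of elements of `D` satisfies a regular formula is open. -/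
theorem isOpen_satAt : ∀ {Γ : List L.Srt} (φ : Formula L Γ) (a : Fam (fun _ => D) Γ),
    IsOpen {M : ModIn T D | M.SatAt φ a}
  | _, .top, a => by
      convert isOpen_env (T := T) a
      exact ⟨fun ⟨e, he, _⟩ => ⟨e, he⟩, fun ⟨e, he⟩ => ⟨e, he, trivial⟩⟩
  | _, .eq t t', a => by
      convert isOpen_exists fun b : D =>
        (isOpen_evalAt (T := T) a t b).inter (isOpen_evalAt a t' b) using 1
      ext M
      constructor
      · rintro ⟨e, he, h⟩
        exact ⟨_, ⟨e, he, congrArg Subtype.val h⟩, e, he, rfl⟩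
      · rintro ⟨b, ⟨e, he, h⟩, e', he', h'⟩
        obtain rfl := StrIn.under_injective (he.trans he'.symm)
        exact ⟨e, he, Subtype.ext (h.trans h'.symm)⟩
  | _, .rel R ts, a => by
      convert (isOpen_env (T := T) a).inter (isOpen_exists fun c : Fam (fun _ => D) (L.arity R) =>
        (isOpen_forall_var fun A x => isOpen_evalAt a (ts A x) (c A x)).inter (isOpen_rel R c))
        using 1
      ext M
      constructor
      · rintro ⟨e, he, h⟩
        exact ⟨⟨e, he⟩, StrIn.under (fun A x => M.eval e (ts A x)), fun A x => ⟨e, he, rfl⟩,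
          _, rfl, h⟩
      · rintro ⟨⟨e, he⟩, c, h1, e', rfl, h2⟩
        refine ⟨e, he, ?_⟩
        have : (fun A x => M.eval e (ts A x)) = e' := by
          funext A x
          obtain ⟨e1, h3, h4⟩ := h1 A x
          obtain rfl := StrIn.under_injective (he.trans h3.symm)
          exact Subtype.ext h4
        rw [← this] at h2
        exact h2
  | _, .and φ ψ, a => by
      convert (isOpen_satAt φ a).inter (isOpen_satAt ψ a) using 1
      ext M
      constructor
      · rintro ⟨e, he, h⟩
        exact ⟨⟨e, he, h.1⟩, e, he, h.2⟩
      · rintro ⟨⟨e, he, h⟩, e', he', h'⟩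
        obtain rfl := StrIn.under_injective (he.trans he'.symm)
        exact ⟨e, he, h, h'⟩
  | Γ, .ex A φ, a => by
      convert (isOpen_env (T := T) a).inter (isOpen_exists fun d : D =>
        isOpen_satAt φ (Fam.cons d a : Fam (fun _ => D) (A :: Γ))) using 1
      ext M
      constructor
      · rintro ⟨e, rfl, d, h⟩
        refine ⟨⟨e, rfl⟩, d, _, ?_, h⟩
        funext B x
        cases x <;> rfl
      · rintro ⟨⟨e, rfl⟩, d, e', he', h⟩
        refine ⟨e, rfl, e' _ .zero, ?_⟩
        convert h
        funext B x
        cases x with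
        | zero => rfl
        | succ x => exact Subtype.ext (congrFun (congrFun he' B) (.succ x)).symm

end ModIn

namespace DefTotal

variable {X Y : SynCat T}

theorem continuous_proj : Continuous (proj : DefTotal D X → ModIn T D) :=
  continuous_iff_le_induced.2 inf_le_left

theorem isOpen_tuple (a : Fam (fun _ => D) X.ctx) : IsOpen {p : DefTotal D X | p.tuple = a} :=
  TopologicalSpace.le_def.1 inf_le_right _
    (TopologicalSpace.isOpen_generateFrom_of_mem ⟨a, rfl⟩)

theorem continuous_of_proj_of_tuple {Z : Type*} [TopologicalSpace Z] {f : Z → DefTotal D X}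
    (h : Continuous (fun z => (f z).proj)) (h' : ∀ a, IsOpen {z | (f z).tuple = a}) :
    Continuous f := by
  refine continuous_inf_rng.2 ⟨continuous_induced_rng.2 h, continuous_generateFrom_iff.2 ?_⟩
  rintro _ ⟨a, rfl⟩
  exact h' a

theorem ext_of_tuple {p q : DefTotal D X} (h : p.proj = q.proj) (h' : p.tuple = q.tuple) :
    p = q := by
  obtain ⟨M, a⟩ := p
  obtain ⟨N, b⟩ := q
  obtain rfl : M = N := h
  exact congrArg (Sigma.mk M) (Subtype.ext (StrIn.under_injective h'))

/-- The section of the projection that is given by a tuple of elements of `D`. -/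
noncomputable def sect (a : Fam (fun _ => D) X.ctx) (M : {M : ModIn T D // M.SatAt X.form a}) :
    DefTotal D X :=
  ⟨M.1, M.2.choose, M.2.choose_spec.2⟩

theorem tuple_sect (a : Fam (fun _ => D) X.ctx) (M : {M : ModIn T D // M.SatAt X.form a}) :
    (sect a M).tuple = a :=
  M.2.choose_spec.1

theorem continuous_sect (a : Fam (fun _ => D) X.ctx) :
    Continuous (sect a : {M : ModIn T D // M.SatAt X.form a} → DefTotal D X) := by
  refine continuous_of_proj_of_tuple continuous_subtype_val fun b => ?_
  simp only [tuple_sect]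
  exact isOpen_const

/-- Every point lies on one of the continuous sections `sect a`, whose domains are open by
`isOpen_satAt`. The image of `V` is the union of the preimages of `V` under these sections. -/
theorem isOpenMap_proj : IsOpenMap (proj : DefTotal D X → ModIn T D) := by
  intro V hV
  have e : proj '' V = ⋃ a, Subtype.val '' (sect (X := X) a ⁻¹' V) := by
    ext M
    rw [Set.mem_iUnion]
    constructor
    · rintro ⟨p, hp, rfl⟩
      have h : p.proj.SatAt X.form p.tuple := ⟨p.2.1, rfl, p.2.2⟩
      refine ⟨p.tuple, ⟨p.proj, h⟩, ?_, rfl⟩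
      have : sect p.tuple ⟨p.proj, h⟩ = p := ext_of_tuple rfl (tuple_sect _ _)
      rwa [Set.mem_preimage, this]
    · rintro ⟨a, M, h, rfl⟩
      exact ⟨_, h, rfl⟩
  rw [e]
  exact isOpen_iUnion fun a => (ModIn.isOpen_satAt X.form a).isOpenMap_subtype_val _
    (hV.preimage (continuous_sect a))

/-- On the open set of points with a fixed tuple, the continuous open projection is injective. -/
theorem isLocalHomeomorph_proj :
    IsLocalHomeomorph (proj : DefTotal D X → ModIn T D) := by
  rw [isLocalHomeomorph_iff_isOpenEmbedding_restrict]
  intro p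
  have hU := isOpen_tuple p.tuple
  refine ⟨{q | q.tuple = p.tuple}, hU.mem_nhds rfl, .of_continuous_injective_isOpenMap
    (continuous_proj.comp continuous_subtype_val) ?_ (isOpenMap_proj.comp hU.isOpenMap_subtype_val)⟩
  rintro ⟨q, hq⟩ ⟨q', hq'⟩ h
  exact Subtype.ext (ext_of_tuple h (hq.trans hq'.symm))

/-- The value has tuple `b` exactly if the argument has some tuple `a` with `σ(b, a)` true in the
model; this is a union over `a` of open conditions on the tuple and on the model. -/
theorem continuous_map (f : X ⟶ Y) : Continuous (map (D := D) f) := by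
  refine continuous_of_proj_of_tuple continuous_proj fun b => ?_
  obtain ⟨σ, hσ⟩ := exists_graph_formula f
  convert ModIn.isOpen_exists fun a : Fam (fun _ => D) X.ctx => (isOpen_tuple (X := X) a).inter
    ((ModIn.isOpen_satAt (T := T) (.and (Y.form.subst (Sub.inl Y.ctx X.ctx)) σ)
      (Fam.append b a)).preimage continuous_proj) using 1
  ext ⟨M, a⟩
  constructor
  · rintro rfl
    have h : M.SatAt (.and (Y.form.subst (Sub.inl Y.ctx X.ctx)) σ)
        (Fam.append (StrIn.under (M.defMap f a).1) (StrIn.under a.1)) := by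
      refine ⟨Fam.append (M.defMap f a).1 a.1, StrIn.under_append _ _, ?_, (hσ M a _).1 rfl⟩
      rw [StrIn.sat_subst, StrIn.evalSub_inl]
      exact (M.defMap f a).2
    exact ⟨_, rfl, h⟩
  · rintro ⟨a', ha', h⟩
    obtain ⟨e, he, h1, h2⟩ : M.SatAt _ _ := h
    obtain ⟨d, c, rfl⟩ := Fam.exists_append e
    rw [StrIn.sat_subst, StrIn.evalSub_inl] at h1
    rw [StrIn.under_append] at he
    obtain ⟨rfl, hc⟩ := Fam.append_inj he
    have e1 : c = a.1 := StrIn.under_injective (hc.trans ha'.symm)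
    rw [e1] at h2
    have := (hσ M a ⟨d, h1⟩).2 h2
    exact congrArg (fun b : M.Def Y => StrIn.under b.1) this

theorem continuous_cod : Continuous (Mor.cod : Mor (ModIn T D) → ModIn T D) :=
  continuous_iff_le_induced.2 (inf_le_left.trans inf_le_right)

theorem isOpen_mor (A : L.Srt) (a b : D) : IsOpen {f : Mor (ModIn T D) |
    ∃ h : a ∈ f.dom.carrier A, (StrIn.Hom.toFun f.hom A ⟨a, h⟩ : D) = b} :=
  TopologicalSpace.le_def.1 inf_le_right _
    (TopologicalSpace.isOpen_generateFrom_of_mem ⟨A, a, b, rfl⟩)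

/-- The image tuple is `b` exactly if, for some `a`, the point has tuple `a` and the homomorphism
sends `a` to `b`; the latter is a finite intersection of subbasic open sets, as contexts are finite.
-/
theorem continuous_act : Continuous (act (D := D) (X := X)) := by
  refine continuous_of_proj_of_tuple
    (continuous_cod.comp (continuous_fst.comp continuous_subtype_val)) fun b => ?_
  convert ModIn.isOpen_exists fun a : Fam (fun _ => D) X.ctx =>
    ((isOpen_tuple (X := X) a).preimage (continuous_snd.comp continuous_subtype_val)).inter
    ((ModIn.isOpen_forall_var fun A x => isOpen_mor (T := T) A (a A x) (b A x)).preimage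
      (continuous_fst.comp continuous_subtype_val)) using 1
  ext ⟨⟨⟨M, N, f⟩, ⟨M', a⟩⟩, h⟩
  obtain rfl : M = M' := h
  constructor
  · rintro rfl
    exact ⟨_, rfl, fun A x => ⟨(a.1 A x).2, rfl⟩⟩
  · rintro ⟨_, rfl, h⟩
    funext A x
    obtain ⟨h1, h2⟩ := h A x
    exact h2

end DefTotal

end Topology
/-! ### The functor to equivariant sheaves is full, faithful and regular -/

section SheafFunctor

variable {L : Signature.{u}} {T : RegTheory L} {D : Type u}

namespace EqSheaf

variable {C : Type u} [Category.{v} C] [TopologicalSpace C] [TopologicalSpace (Mor C)]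

theorem hom_ext {R S : EqSheaf C} {f g : R ⟶ S}
    (h : ∀ x, EqSheaf.Hom.toFun f x = EqSheaf.Hom.toFun g x) : f = g :=
  EqSheaf.Hom.ext (funext h)

theorem hom_congr {R S : EqSheaf C} {f g : R ⟶ S} (h : f = g) (x : R.space) :
    EqSheaf.Hom.toFun f x = EqSheaf.Hom.toFun g x := by
  rw [h]

end EqSheaf

namespace DefTotal

variable {X Y Z : SynCat T}

theorem map_act (f : X ⟶ Y) (k : Mor (ModIn T D)) (p : DefTotal D X) (h : k.dom = p.proj) :
    map f (act ⟨(k, p), h⟩) = act ⟨(k, map f p), h⟩ :=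
  congrArg (Sigma.mk k.cod) (ModIn.defMap_push _ f p.2)

theorem isOpenMap_map (f : X ⟶ Y) : IsOpenMap (map (D := D) f) :=
  (IsLocalHomeomorph.of_comp (f := map (D := D) f) (g := proj) isLocalHomeomorph_proj
    isLocalHomeomorph_proj (continuous_map f)).isOpenMap

/-- `act` transports along the equality of domain and base model. With `q` as a variable, the
substitution of `q` by `⟨M, a⟩` makes this transport disappear. -/
theorem act_mk {M N : ModIn T D} (f : M ⟶ N) (a : M.Def X) :
    ∀ (q : DefTotal D X) (h : M = q.proj), q = ⟨M, a⟩ →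
      act ⟨(⟨M, N, f⟩, q), h⟩ = ⟨N, a.push f⟩ := by
  rintro _ _ rfl
  rfl

end DefTotal

variable (T D) in
/-- The functor that sends a formula in context to its equivariant sheaf. -/
noncomputable abbrev sheafFunctor : SynCat T ⥤ EqSheaf (ModIn T D) :=
  definableFunctor (fun _ => DefTotal.isLocalHomeomorph_proj) (fun _ => DefTotal.continuous_act)
    (fun _ _ => DefTotal.continuous_map)

/-- The fibres of the sheaf of a formula in context are its definable sets. -/
noncomputable def forgetIso :
    sheafFunctor T D ⋙ EqSheaf.forget _ ≅ evaluation T D :=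
  NatIso.ofComponents (fun X => NatIso.ofComponents
    (fun M => Equiv.toIso
      { toFun := fun p : {p : DefTotal D X // p.proj = M} => p.2 ▸ p.1.2
        invFun := fun a => ⟨⟨M, a⟩, rfl⟩
        left_inv := by
          rintro ⟨p, rfl⟩
          rfl
        right_inv := fun _ => rfl })
    (by
      intro M N f
      ext ⟨p, rfl⟩
      rfl))
    (by
      intro X Y f
      ext M ⟨p, rfl⟩
      rfl)

section Embedding

variable [Infinite D] (hD : L.card ≤ Cardinal.mk D)
include hD

theorem faithful_sheafFunctor : (sheafFunctor T D).Faithful where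
  map_injective {X Y f g} h := by
    refine hom_ext_of_defMap hD fun M a => ?_
    have := EqSheaf.hom_congr h (⟨M, a⟩ : DefTotal D X)
    exact eq_of_heq (Sigma.mk.inj this).2

/-- A morphism over the base that commutes with the action is a natural family of functions between
definable sets, and such families are definable. -/
theorem full_sheafFunctor : (sheafFunctor T D).Full where
  map_surjective {X Y} k := by
    have key : ∀ (M : ModIn T D) (a : M.Def X), ∃ b : M.Def Y,
        EqSheaf.Hom.toFun k (⟨M, a⟩ : DefTotal D X) = (⟨M, b⟩ : DefTotal D Y) := by
      intro M a
      have h : (EqSheaf.Hom.toFun k (⟨M, a⟩ : DefTotal D X) : DefTotal D Y).proj = M :=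
        EqSheaf.Hom.proj_toFun k _
      revert h
      generalize (EqSheaf.Hom.toFun k (⟨M, a⟩ : DefTotal D X) : DefTotal D Y) = q
      rintro rfl
      exact ⟨q.2, rfl⟩
    choose h hh using key
    obtain ⟨f, hf⟩ := exists_defMap_eq hD h (by
      intro M N l a
      have h1 := EqSheaf.Hom.toFun_act k ⟨M, N, l⟩ (⟨M, a⟩ : DefTotal D X) rfl
      have h2 : (⟨N, h N (a.push l)⟩ : DefTotal D Y) = ⟨N, (h M a).push l⟩ :=
        (hh N (a.push l)).symm.trans (h1.trans (DefTotal.act_mk l (h M a) _ _ (hh M a)))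
      exact eq_of_heq (Sigma.mk.inj h2).2)
    refine ⟨f, EqSheaf.hom_ext ?_⟩
    rintro ⟨M, a⟩
    exact (congrArg (Sigma.mk M) (hf M a)).trans (hh M a).symm

end Embedding

/-! #### Finite limits -/

variable (T) in
/-- The formula `⊤` in the empty context. -/
def SynCat.one : SynCat T := ⟨[], .top⟩

variable (T D) in
/-- The sheaf of `⊤` in the empty context is terminal. -/
noncomputable def isTerminalSheafOne : IsTerminal ((sheafFunctor T D).obj (SynCat.one T)) :=
  IsTerminal.ofUniqueHom
    (fun S =>
      { toFun := fun s => (⟨S.proj s, fun _ x => (nomatch x), trivial⟩ : DefTotal D (SynCat.one T))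
        continuous_toFun := DefTotal.continuous_of_proj_of_tuple
          S.isLocalHomeomorph_proj.continuous (fun a => by
            convert isOpen_univ
            rw [Set.eq_univ_iff_forall]
            intro s
            funext A x
            nomatch x)
        proj_toFun := fun _ => rfl
        toFun_act := fun f s h => DefTotal.ext_of_tuple (S.proj_act ⟨(f, s), h⟩) (by
          funext A x
          nomatch x) })
    (fun S k => EqSheaf.hom_ext fun s => DefTotal.ext_of_tuple (EqSheaf.Hom.proj_toFun k s) (by
      funext A x
      nomatch x))

section Limits

variable [Infinite D] (hD : L.card ≤ Cardinal.mk D)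
include hD

/-- Fibre products of definable sets are definable. -/
theorem exists_fibreProduct {X Y Z : SynCat T} (f : X ⟶ Z) (g : Y ⟶ Z) :
    ∃ (χ : Formula L (X.ctx ++ Y.ctx)) (p : (⟨_, χ⟩ : SynCat T) ⟶ X) (q : (⟨_, χ⟩ : SynCat T) ⟶ Y),
      (∀ r : DefTotal D (⟨_, χ⟩ : SynCat T),
        r.tuple = Fam.append (DefTotal.map p r).tuple (DefTotal.map q r).tuple) ∧
      (∀ r : DefTotal D (⟨_, χ⟩ : SynCat T),
        DefTotal.map f (DefTotal.map p r) = DefTotal.map g (DefTotal.map q r)) ∧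
      ∀ (x : DefTotal D X) (y : DefTotal D Y), DefTotal.map f x = DefTotal.map g y →
        ∃ r, DefTotal.map p r = x ∧ DefTotal.map q r = y := by
  obtain ⟨χ, hχ⟩ := exists_pullback_formula f g
  have hsplit : ∀ (M : ModIn T D) (c : M.Def (⟨_, χ⟩ : SynCat T)),
      ∃ (a : M.Def X) (b : M.Def Y), c.1 = Fam.append a.1 b.1 ∧ M.defMap f a = M.defMap g b := by
    rintro M ⟨c, hc⟩
    obtain ⟨a, b, rfl⟩ := Fam.exists_append (X := fun A => M.carrier A) c
    obtain ⟨ha, hb, h⟩ := (hχ M a b).1 hc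
    exact ⟨⟨a, ha⟩, ⟨b, hb⟩, rfl, h⟩
  choose fst snd h1 h2 using hsplit
  have hnat : ∀ {M N : ModIn T D} (k : M ⟶ N) (c : M.Def (⟨_, χ⟩ : SynCat T)),
      fst N (c.push k) = (fst M c).push k ∧ snd N (c.push k) = (snd M c).push k := by
    intro M N k c
    have e := h1 N (c.push k)
    have e' : (c.push k).1 = Fam.append ((fst M c).push k).1 ((snd M c).push k).1 :=
      (congrArg (StrIn.Hom.mapEnv k) (h1 M c)).trans (StrIn.Hom.mapEnv_append k _ _)
    obtain ⟨e1, e2⟩ := Fam.append_inj (e.symm.trans e')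
    exact ⟨Subtype.ext e1, Subtype.ext e2⟩
  -- The projections are obtained from naturality alone, without writing down functional formulas
  -- for them.
  obtain ⟨p, hp⟩ := exists_defMap_eq hD fst (fun k c => (hnat k c).1)
  obtain ⟨q, hq⟩ := exists_defMap_eq hD snd (fun k c => (hnat k c).2)
  refine ⟨χ, p, q, ?_, ?_, ?_⟩
  · rintro ⟨M, c⟩
    change StrIn.under c.1 = Fam.append (StrIn.under (M.defMap p c).1)
      (StrIn.under (M.defMap q c).1)
    rw [hp, hq, ← StrIn.under_append, ← h1]
  · rintro ⟨M, c⟩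
    refine congrArg (Sigma.mk M) ?_
    change M.defMap f (M.defMap p c) = M.defMap g (M.defMap q c)
    rw [hp, hq, h2]
  · rintro ⟨M, a⟩ ⟨N, b⟩ h
    obtain rfl : M = N := congrArg DefTotal.proj h
    have hab : M.defMap f a = M.defMap g b := eq_of_heq (Sigma.mk.inj h).2
    let c : M.Def (⟨_, χ⟩ : SynCat T) := ⟨Fam.append a.1 b.1, (hχ M a.1 b.1).2 ⟨a.2, b.2, hab⟩⟩
    obtain ⟨e1, e2⟩ := Fam.append_inj (h1 M c)
    refine ⟨⟨M, c⟩, congrArg (Sigma.mk M) ?_, congrArg (Sigma.mk M) ?_⟩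
    · rw [hp]
      exact Subtype.ext e1.symm
    · rw [hq]
      exact Subtype.ext e2.symm

/-- Only the square of sheaves is verified; a fully faithful functor reflects pullbacks. The induced
map exists pointwise, and it is continuous and equivariant because a point of the fibre product is
determined by its two projections, with the concatenation of their tuples as its tuple. -/
theorem exists_isPullback {X Y Z : SynCat T} (f : X ⟶ Z) (g : Y ⟶ Z) :
    ∃ (P : SynCat T) (p : P ⟶ X) (q : P ⟶ Y), IsPullback p q f g ∧
      IsPullback ((sheafFunctor T D).map p) ((sheafFunctor T D).map q)
        ((sheafFunctor T D).map f) ((sheafFunctor T D).map g) ∧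
      ∀ (x : DefTotal D X) (y : DefTotal D Y), DefTotal.map f x = DefTotal.map g y →
        ∃ r, DefTotal.map p r = x ∧ DefTotal.map q r = y := by
  obtain ⟨χ, p, q, h1, h2, h3⟩ := exists_fibreProduct (T := T) hD f g
  have := full_sheafFunctor (T := T) hD
  have := faithful_sheafFunctor (T := T) hD
  have hinj : ∀ r r' : DefTotal D (⟨_, χ⟩ : SynCat T), DefTotal.map p r = DefTotal.map p r' →
      DefTotal.map q r = DefTotal.map q r' → r = r' := by
    intro r r' e1 e2
    have e0 := congrArg DefTotal.proj e1
    refine DefTotal.ext_of_tuple e0 ?_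
    rw [h1, h1, e1, e2]
  have hw : (sheafFunctor T D).map p ≫ (sheafFunctor T D).map f =
      (sheafFunctor T D).map q ≫ (sheafFunctor T D).map g := EqSheaf.hom_ext h2
  have hF : IsPullback ((sheafFunctor T D).map p) ((sheafFunctor T D).map q)
      ((sheafFunctor T D).map f) ((sheafFunctor T D).map g) := by
    have key : ∀ s : PullbackCone ((sheafFunctor T D).map f) ((sheafFunctor T D).map g),
        ∃ l : s.pt ⟶ (sheafFunctor T D).obj ⟨_, χ⟩,
          l ≫ (sheafFunctor T D).map p = s.fst ∧ l ≫ (sheafFunctor T D).map q = s.snd := by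
      intro s
      have hr := fun z : s.pt.space => h3 (EqSheaf.Hom.toFun s.fst z) (EqSheaf.Hom.toFun s.snd z)
        (EqSheaf.hom_congr s.condition z)
      choose r hp hq using hr
      have hproj : ∀ z, (r z).proj = s.pt.proj z := fun z =>
        (congrArg DefTotal.proj (hp z)).trans (EqSheaf.Hom.proj_toFun s.fst z)
      refine ⟨⟨r, ?_, hproj, ?_⟩, EqSheaf.hom_ext hp, EqSheaf.hom_ext hq⟩
      · refine DefTotal.continuous_of_proj_of_tuple ?_ fun a => ?_
        · simp only [hproj]
          exact s.pt.isLocalHomeomorph_proj.continuous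
        · obtain ⟨a, b, rfl⟩ := Fam.exists_append a
          convert ((DefTotal.isOpen_tuple (X := X) a).preimage
            (EqSheaf.Hom.continuous_toFun s.fst)).inter ((DefTotal.isOpen_tuple (X := Y) b).preimage
            (EqSheaf.Hom.continuous_toFun s.snd)) using 1
          ext z
          constructor
          · intro h
            have h' := (h1 (r z)).symm.trans h
            rw [hp, hq] at h'
            exact Fam.append_inj h'
          · rintro ⟨ha, hb⟩
            refine (h1 (r z)).trans ?_
            rw [hp, hq]
            exact congrArg₂ Fam.append ha hb
      · intro k z h
        apply hinj
        · rw [hp]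
          refine (EqSheaf.Hom.toFun_act s.fst k z h).trans ?_
          refine Eq.trans ?_ (DefTotal.map_act p k (r z) (h.trans (hproj z).symm)).symm
          congr 3
          exact (hp z).symm
        · rw [hq]
          refine (EqSheaf.Hom.toFun_act s.snd k z h).trans ?_
          refine Eq.trans ?_ (DefTotal.map_act q k (r z) (h.trans (hproj z).symm)).symm
          congr 3
          exact (hq z).symm
    choose l hl hl' using key
    refine ⟨⟨hw⟩, ⟨PullbackCone.IsLimit.mk hw l hl hl' ?_⟩⟩
    intro s m hm hm'
    refine EqSheaf.hom_ext fun z => hinj _ _ ?_ ?_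
    · exact EqSheaf.hom_congr (hm.trans (hl s).symm) z
    · exact EqSheaf.hom_congr (hm'.trans (hl' s).symm) z
  exact ⟨_, p, q, .of_map_of_faithful (sheafFunctor T D) hF, hF, h3⟩

/-- A terminal object and pullbacks suffice, and for each of these it is enough that one limit cone
has a limit cone as its image. -/
theorem preservesFiniteLimits_sheafFunctor : PreservesFiniteLimits (sheafFunctor T D) := by
  have := full_sheafFunctor (T := T) hD
  have := faithful_sheafFunctor (T := T) hD
  have h1 : IsTerminal (SynCat.one T) :=
    IsTerminal.isTerminalOfObj (sheafFunctor T D) _ (isTerminalSheafOne T D)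
  have : HasTerminal (SynCat T) := h1.hasTerminal
  have : HasPullbacks (SynCat T) := by
    refine @hasPullbacks_of_hasLimit_cospan _ _ ?_
    intro X Y Z f g
    obtain ⟨P, p, q, h, -⟩ := exists_isPullback (T := T) hD f g
    exact h.hasPullback
  have : PreservesLimit (Functor.empty.{0} (SynCat T)) (sheafFunctor T D) :=
    preservesLimit_of_preserves_limit_cone h1
      ((isLimitMapConeEmptyConeEquiv _ _).symm (isTerminalSheafOne T D))
  have := preservesLimitsOfShape_pempty_of_preservesTerminal (sheafFunctor T D)
  have : PreservesLimitsOfShape WalkingCospan (sheafFunctor T D) :=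
    preservesLimitsOfShape_walkingCospan_of_forall_isPullback (by
      intro X Y Z f g _
      obtain ⟨P, p, q, h, h', -⟩ := exists_isPullback (T := T) hD f g
      exact ⟨P, p, q, h, h'⟩)
  exact preservesFiniteLimits_of_preservesTerminal_and_pullbacks _

/-! #### Regular epimorphisms -/

/-- An open continuous surjection is a quotient map, so on sheaves it is the coequalizer of its
kernel pair. The kernel pair comes from the syntactic category, and the fully faithful functor
reflects the coequalizer. -/
theorem isRegularEpi_of_surjective {X Y : SynCat T} (f : X ⟶ Y)
    (hf : Function.Surjective (DefTotal.map (D := D) f)) :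
    IsRegularEpi f ∧ IsRegularEpi ((sheafFunctor T D).map f) := by
  obtain ⟨P, p, q, h, hF, h3⟩ := exists_isPullback (T := T) hD f f
  have := full_sheafFunctor (T := T) hD
  have := faithful_sheafFunctor (T := T) hD
  have hquot : Topology.IsQuotientMap (DefTotal.map (D := D) f) :=
    (DefTotal.isOpenMap_map f).isQuotientMap (DefTotal.continuous_map f) hf
  have key : ∀ s : Cofork ((sheafFunctor T D).map p) ((sheafFunctor T D).map q),
      ∃ l : (sheafFunctor T D).obj Y ⟶ s.pt, (sheafFunctor T D).map f ≫ l = s.π := by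
    intro s
    have hs : ∀ x x' : DefTotal D X, DefTotal.map f x = DefTotal.map f x' →
        EqSheaf.Hom.toFun s.π x = EqSheaf.Hom.toFun s.π x' := by
      intro x x' e
      obtain ⟨r, rfl, rfl⟩ := h3 x x' e
      exact EqSheaf.hom_congr s.condition r
    have hl : ∃ l : DefTotal D Y → s.pt.space,
        ∀ x, l (DefTotal.map f x) = EqSheaf.Hom.toFun s.π x := by
      choose i hi using hf
      exact ⟨fun y => EqSheaf.Hom.toFun s.π (i y), fun x => hs _ _ (hi _)⟩
    obtain ⟨l, hl⟩ := hl
    have hproj : ∀ y, s.pt.proj (l y) = DefTotal.proj y := by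
      intro y
      obtain ⟨x, rfl⟩ := hf y
      rw [hl]
      exact EqSheaf.Hom.proj_toFun s.π x
    refine ⟨⟨l, ?_, hproj, ?_⟩, EqSheaf.hom_ext hl⟩
    · refine hquot.continuous_iff.2 ?_
      have e : l ∘ DefTotal.map f = EqSheaf.Hom.toFun s.π := funext hl
      rw [e]
      exact EqSheaf.Hom.continuous_toFun s.π
    · intro k y e
      obtain ⟨x, rfl⟩ := hf y
      refine (congrArg l (DefTotal.map_act f k x e).symm).trans ((hl _).trans ?_)
      refine (EqSheaf.Hom.toFun_act s.π k x e).trans ?_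
      congr 3
      exact (hl x).symm
  choose l hl using key
  have hcolim : IsColimit (Cofork.ofπ ((sheafFunctor T D).map f) hF.w) := by
    refine Cofork.IsColimit.mk _ l hl ?_
    intro s m hm
    refine EqSheaf.hom_ext fun y => ?_
    obtain ⟨x, rfl⟩ := hf y
    exact EqSheaf.hom_congr (hm.trans (hl s).symm) x
  exact ⟨⟨⟨P, p, q, h.w, isColimitOfIsColimitCoforkMap (sheafFunctor T D) h.w hcolim⟩⟩,
    ⟨⟨_, _, _, hF.w, hcolim⟩⟩⟩

/-- Factor `f = e ≫ m` through its definable image. Since `m` is injective on definable sets, `e`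
coequalizes the pair whose coequalizer is `f`; the induced `d` satisfies `d ≫ m = 𝟙 Y`, so every
point of `Y` lies in the image. -/
theorem surjective_of_isRegularEpi {X Y : SynCat T} (f : X ⟶ Y) (hf : IsRegularEpi f) :
    Function.Surjective (DefTotal.map (D := D) f) := by
  obtain ⟨⟨W, left, right, w, hc⟩⟩ := hf
  obtain ⟨ψ, hψ⟩ := exists_image_formula f
  obtain ⟨e, he⟩ := exists_defMap_eq hD (X := X) (Y := ⟨Y.ctx, ψ⟩)
    (fun M a => ⟨(M.defMap f a).1, (hψ M _).2 ⟨a, rfl⟩⟩)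
    (fun k a => by
      have h := congrArg Subtype.val (ModIn.defMap_push k f a)
      exact Subtype.ext h)
  have hψ' : ∀ (M : ModIn T D) (b : M.Def (⟨Y.ctx, ψ⟩ : SynCat T)), M.sat Y.form b.1 := by
    intro M b
    obtain ⟨a, ha⟩ := (hψ M b.1).1 b.2
    rw [← ha]
    exact (M.defMap f a).2
  obtain ⟨m, hm⟩ := exists_defMap_eq hD (X := ⟨Y.ctx, ψ⟩) (Y := Y)
    (fun M b => ⟨b.1, hψ' M b⟩) (fun k b => rfl)
  have hfac : e ≫ m = f := by
    refine hom_ext_of_defMap hD fun M a => ?_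
    rw [ModIn.defMap_comp, hm, he]
    rfl
  have hcoeq : left ≫ e = right ≫ e := by
    refine hom_ext_of_defMap hD fun M a => ?_
    rw [ModIn.defMap_comp, ModIn.defMap_comp, he, he]
    have h : M.defMap f (M.defMap left a) = M.defMap f (M.defMap right a) := by
      rw [← ModIn.defMap_comp, ← ModIn.defMap_comp, w]
    have h' := congrArg Subtype.val h
    exact Subtype.ext h'
  obtain ⟨d, hd⟩ : ∃ d, f ≫ d = e := ⟨_, Cofork.IsColimit.π_desc' hc e hcoeq⟩
  have hdm : d ≫ m = 𝟙 Y := by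
    refine Cofork.IsColimit.hom_ext hc ?_
    change f ≫ d ≫ m = f ≫ 𝟙 Y
    rw [← Category.assoc, hd, hfac, Category.comp_id]
  rintro ⟨M, b⟩
  have h1 : M.defMap m (M.defMap d b) = b := by
    rw [← ModIn.defMap_comp, hdm, ModIn.defMap_id]
  rw [hm] at h1
  obtain ⟨a, ha⟩ := (hψ M _).1 (M.defMap d b).2
  refine ⟨⟨M, a⟩, congrArg (Sigma.mk M) (Subtype.ext ?_)⟩
  rw [ha]
  exact congrArg Subtype.val h1

theorem isRegularFunctor_sheafFunctor : IsRegularFunctor (sheafFunctor T D) where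
  preservesFiniteLimits := preservesFiniteLimits_sheafFunctor hD
  map_regularEpi f hf := (isRegularEpi_of_surjective hD f (surjective_of_isRegularEpi hD f hf)).2

end Limits

end SheafFunctor
/-! ### The functor to equivariant sheaves reflects covers -/

namespace EqSheaf

section Double

variable {C : Type u} [Category.{v} C] [TopologicalSpace C] [TopologicalSpace (Mor C)]
  (R : EqSheaf C) (U : Set R.space)

/-- Two copies of the space of `R`, glued along `U`. -/
def doubleSetoid : Setoid (R.space × Bool) where
  r p q := p.1 = q.1 ∧ (p.1 ∉ U → p.2 = q.2)
  iseqv :=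
    { refl := fun _ => ⟨rfl, fun _ => rfl⟩
      symm := by
        rintro ⟨x, b⟩ ⟨y, c⟩ ⟨rfl, h⟩
        exact ⟨rfl, fun hx => (h hx).symm⟩
      trans := by
        rintro ⟨x, b⟩ ⟨y, c⟩ ⟨z, d⟩ ⟨rfl, h⟩ ⟨rfl, h'⟩
        exact ⟨rfl, fun hx => (h hx).trans (h' hx)⟩ }

abbrev DoubleSpace : Type u := Quotient (R.doubleSetoid U)

variable {R U}

/-- The two copies of the space of `R`. -/
def copy (b : Bool) (x : R.space) : R.DoubleSpace U := Quotient.mk (R.doubleSetoid U) (x, b)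

theorem copy_eq_copy_iff {b c : Bool} {x y : R.space} :
    (copy b x : R.DoubleSpace U) = copy c y ↔ x = y ∧ (x ∉ U → b = c) :=
  Quotient.eq (r := R.doubleSetoid U)

theorem exists_copy (z : R.DoubleSpace U) : ∃ b x, z = copy b x := by
  obtain ⟨⟨x, b⟩, rfl⟩ := Quotient.exists_rep z
  exact ⟨b, x, rfl⟩

theorem copy_injective (b : Bool) : Function.Injective (copy b : R.space → R.DoubleSpace U) :=
  fun _ _ h => (copy_eq_copy_iff.1 h).1

theorem continuous_copy (b : Bool) : Continuous (copy b : R.space → R.DoubleSpace U) :=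
  continuous_quotient_mk'.comp (by fun_prop : Continuous fun x : R.space => (x, b))

/-- Before gluing, the image of `V` consists of `V` in copy `b` and of `V ∩ U` in both copies; the
latter part is open because `U` is. -/
theorem isOpenEmbedding_copy (hU : IsOpen U) (b : Bool) :
    Topology.IsOpenEmbedding (copy b : R.space → R.DoubleSpace U) := by
  refine .of_continuous_injective_isOpenMap (continuous_copy b) (copy_injective b) ?_
  intro V hV
  refine isOpen_coinduced.2 (?_ : IsOpen (Quotient.mk (R.doubleSetoid U) ⁻¹' (copy b '' V)))
  have e : Quotient.mk (R.doubleSetoid U) ⁻¹' (copy b '' V) =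
      V ×ˢ {b} ∪ (V ∩ U) ×ˢ Set.univ := by
    ext ⟨x, c⟩
    constructor
    · rintro ⟨y, hy, h⟩
      obtain ⟨rfl, h'⟩ := copy_eq_copy_iff.1 h
      by_cases hyU : y ∈ U
      · exact .inr ⟨⟨hy, hyU⟩, trivial⟩
      · exact .inl ⟨hy, (h' hyU).symm⟩
    · rintro (⟨hx, hc⟩ | ⟨⟨hx, hxU⟩, -⟩)
      · exact ⟨x, hx, copy_eq_copy_iff.2 ⟨rfl, fun _ => hc.symm⟩⟩
      · exact ⟨x, hx, copy_eq_copy_iff.2 ⟨rfl, fun h => absurd hxU h⟩⟩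
  rw [e]
  exact (hV.prod (isOpen_discrete _)).union ((hV.inter hU).prod isOpen_univ)

variable (R U) in
def doubleProj : R.DoubleSpace U → C :=
  Quotient.lift (fun p => R.proj p.1) (fun _ _ h => congrArg R.proj h.1)

theorem doubleProj_out (z : R.DoubleSpace U) : R.proj z.out.1 = R.doubleProj U z := by
  conv_rhs => rw [← z.out_eq]
  rfl

-- The action is computed on a chosen representative. Independence of the choice requires that `U`
-- be stable under the action: points that are identified must remain identified.
variable (R U) in
noncomputable def doubleAct (p : {p : Mor C × R.DoubleSpace U // p.1.dom = R.doubleProj U p.2}) :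
    R.DoubleSpace U :=
  copy p.1.2.out.2 (R.act ⟨(p.1.1, p.1.2.out.1), p.2.trans (doubleProj_out p.1.2).symm⟩)

variable (hU : IsOpen U) (hact : ∀ p : {p : Mor C × R.space // p.1.dom = R.proj p.2},
  p.1.2 ∈ U → R.act p ∈ U)

include hact in
theorem doubleAct_copy (k : Mor C) (b : Bool) (x : R.space) (h : k.dom = R.proj x) :
    R.doubleAct U ⟨(k, copy b x), h⟩ = copy b (R.act ⟨(k, x), h⟩) := by
  have e := copy_eq_copy_iff.1 (show copy (Quotient.out (copy b x : R.DoubleSpace U)).2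
    (Quotient.out (copy b x : R.DoubleSpace U)).1 = copy b x from Quotient.out_eq _)
  refine copy_eq_copy_iff.2 ⟨?_, fun hx => e.2 fun hxU => hx (hact _ hxU)⟩
  congr 3
  exact e.1

include hU in
theorem isLocalHomeomorph_doubleProj : IsLocalHomeomorph (R.doubleProj U) := by
  rw [isLocalHomeomorph_iff_isLocalHomeomorphOn_univ]
  intro z _
  obtain ⟨b, x, rfl⟩ := exists_copy z
  exact IsLocalHomeomorphOn.of_comp_right (g := R.doubleProj U)
    (f := (copy b : R.space → R.DoubleSpace U)) (s := Set.univ) R.isLocalHomeomorph_proj.isLocalHomeomorphOn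
    (isOpenEmbedding_copy hU b).isLocalHomeomorph.isLocalHomeomorphOn _ ⟨x, trivial, rfl⟩

-- Each point lies in one of the two copies, which are open, and there the action is that of `R`.
include hU hact in
theorem continuous_doubleAct : Continuous (R.doubleAct U) := by
  rw [continuous_iff_continuousAt]
  rintro ⟨⟨k, z⟩, h⟩
  obtain ⟨b, x, rfl⟩ := exists_copy z
  let s : Set (Mor C × R.DoubleSpace U) := {p | p.1.dom = R.doubleProj U p.2}
  have he : Topology.IsOpenEmbedding (s.restrictPreimage (Prod.map id (copy b))) :=
    (Topology.IsOpenEmbedding.id.prodMap (isOpenEmbedding_copy hU b)).restrictPreimage s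
  refine (he.continuousAt_iff (x := ⟨(k, x), h⟩)).1 (Continuous.continuousAt ?_)
  have e : R.doubleAct U ∘ s.restrictPreimage (Prod.map id (copy b)) =
      fun p => copy b (R.act ⟨p.1, p.2⟩) := by
    funext p
    exact doubleAct_copy hact p.1.1 b p.1.2 p.2
  rw [e]
  exact (continuous_copy b).comp R.continuous_act

/-- The equivariant sheaf that consists of two copies of `R`, glued along `U`. -/
noncomputable def double : EqSheaf C where
  space := R.DoubleSpace U
  proj := R.doubleProj U
  act := R.doubleAct U
  isLocalHomeomorph_proj := isLocalHomeomorph_doubleProj hU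
  continuous_act := continuous_doubleAct hU hact
  proj_act := by
    rintro ⟨⟨k, z⟩, h⟩
    exact R.proj_act _
  act_id z := by
    obtain ⟨b, x, rfl⟩ := exists_copy z
    exact (doubleAct_copy hact _ b x rfl).trans (congrArg (copy b) (R.act_id x))
  act_comp f g z h := by
    obtain ⟨b, x, rfl⟩ := exists_copy z
    refine (doubleAct_copy hact _ b x h).trans ?_
    rw [R.act_comp f g x h]
    refine (doubleAct_copy hact _ b _ _).symm.trans ?_
    congr 3
    exact (doubleAct_copy hact _ b x h).symm

/-- The two inclusions of `R`. -/
def inclusion (b : Bool) : R ⟶ double hU hact where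
  toFun := copy b
  continuous_toFun := continuous_copy b
  proj_toFun _ := rfl
  toFun_act k x h := (doubleAct_copy hact k b x h).symm

end Double

/-- The images of a jointly covering family cover every point. -/
theorem mem_of_jointlyCovering {C : Type u} [Category.{u} C] [TopologicalSpace C]
    [TopologicalSpace (Mor C)] {R : EqSheaf C} {P : Presieve R} (hP : JointlyCovering P)
    {U : Set R.space} (hU : IsOpen U)
    (hact : ∀ p : {p : Mor C × R.space // p.1.dom = R.proj p.2}, p.1.2 ∈ U → R.act p ∈ U)
    (h : ∀ ⦃S : EqSheaf C⦄ (f : S ⟶ R), P f → ∀ s, EqSheaf.Hom.toFun f s ∈ U) (x : R.space) :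
    x ∈ U := by
  by_contra hx
  -- The two inclusions agree exactly on `U`, which contains all images of the family. The family
  -- being jointly epimorphic, they are equal, which is impossible at a point outside `U`.
  have e := hP (inclusion hU hact true) (inclusion hU hact false) (by
    intro S f hf
    refine hom_ext fun s => ?_
    exact copy_eq_copy_iff.2 ⟨rfl, fun hs => absurd (h f hf s) hs⟩)
  exact absurd ((copy_eq_copy_iff.1 (hom_congr e x)).2 hx) (by decide)

end EqSheaf

section Covers

variable {L : Signature.{u}} {T : RegTheory L} {D : Type u}

/-- The union of the images is open and invariant, hence everything. Looking at the generic point of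
`X` selects a single member of the family, and what holds at the generic point holds at every point
of `X`. -/
theorem reflectsCovers_sheafFunctor [Infinite D] (hD : L.card ≤ Cardinal.mk D) :
    ReflectsCovers (sheafFunctor T D) := by
  intro X P hP
  obtain ⟨M, a, ha, h, -⟩ := exists_generic (T := T) hD X.form
  let U : Set (DefTotal D X) := ⋃ (Y : SynCat T) (f : Y ⟶ X) (_ : P f), Set.range (DefTotal.map f)
  have hmem : ∀ x, x ∈ U ↔ ∃ (Y : SynCat T) (f : Y ⟶ X), P f ∧ ∃ y, DefTotal.map f y = x := by
    intro x
    simp only [U, Set.mem_iUnion, Set.mem_range, exists_prop]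
  have hU : IsOpen U := isOpen_iUnion fun Y => isOpen_iUnion fun f => isOpen_iUnion fun _ =>
    (DefTotal.isOpenMap_map f).isOpen_range
  have key : (⟨M, ⟨a, ha⟩⟩ : DefTotal D X) ∈ U := by
    refine EqSheaf.mem_of_jointlyCovering (R := (sheafFunctor T D).obj X) hP hU ?_ ?_ _
    · rintro ⟨⟨k, x⟩, hk⟩ hx
      obtain ⟨Y, f, hf, y, rfl⟩ := (hmem x).1 hx
      exact (hmem _).2 ⟨Y, f, hf, _, DefTotal.map_act f k y hk⟩
    · rintro _ _ ⟨hf⟩ y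
      exact (hmem _).2 ⟨_, _, hf, y, rfl⟩
  obtain ⟨Y, f, hf, ⟨N, b⟩, hy⟩ := (hmem _).1 key
  obtain rfl : N = M := congrArg DefTotal.proj hy
  have hb : N.defMap f b = ⟨a, ha⟩ := eq_of_heq (Sigma.mk.inj hy).2
  obtain ⟨ψ, hψ⟩ := exists_image_formula f
  -- Genericity of `a` turns membership in the image of `f` into a provable sequent.
  have hprov : Provable T X.form ψ := h ψ ((hψ N a).2 ⟨b, congrArg Subtype.val hb⟩)
  refine ⟨Y, f, hf, (isRegularEpi_of_surjective hD f ?_).1⟩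
  rintro ⟨N', c⟩
  obtain ⟨c', hc'⟩ := (hψ N' c.1).1 (StrIn.sound N'.holds hprov c.1 c.2)
  exact ⟨⟨N', c'⟩, congrArg (Sigma.mk N') (Subtype.ext hc')⟩

end Covers

end RegLogic

theorem mainTheorem4 (L : RegLogic.Signature.{u}) (T : RegLogic.RegTheory L) (D : Type u)
    [Infinite D] (hD : L.card ≤ Cardinal.mk D) :
    ∃ (hproj : ∀ X : RegLogic.SynCat T, IsLocalHomeomorph
          (RegLogic.DefTotal.proj : RegLogic.DefTotal D X → RegLogic.ModIn T D))
      (hact : ∀ X : RegLogic.SynCat T,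
          Continuous (RegLogic.DefTotal.act (D := D) (X := X)))
      (hmap : ∀ (X Y : RegLogic.SynCat T) (f : X ⟶ Y),
          Continuous (RegLogic.DefTotal.map (D := D) f)),
      (∃ e : RegLogic.definableFunctor hproj hact hmap ⋙ RegLogic.EqSheaf.forget _ ≅
            RegLogic.evaluation T D,
          ∀ (X : RegLogic.SynCat T) (M : RegLogic.ModIn T D) (a : M.Def X),
            (e.hom.app X).app M
              (⟨⟨M, a⟩, rfl⟩ : {p : RegLogic.DefTotal D X // p.proj = M}) = a) ∧
      RegLogic.IsRegularFunctor (RegLogic.definableFunctor hproj hact hmap) ∧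
      (RegLogic.definableFunctor hproj hact hmap).Full ∧
      (RegLogic.definableFunctor hproj hact hmap).Faithful ∧
      RegLogic.ReflectsCovers (RegLogic.definableFunctor hproj hact hmap) :=
  ⟨fun _ => RegLogic.DefTotal.isLocalHomeomorph_proj, fun _ => RegLogic.DefTotal.continuous_act,
    fun _ _ => RegLogic.DefTotal.continuous_map,
    ⟨RegLogic.forgetIso, fun _ _ _ => rfl⟩,
    RegLogic.isRegularFunctor_sheafFunctor hD, RegLogic.full_sheafFunctor hD,
    RegLogic.faithful_sheafFunctor hD, RegLogic.reflectsCovers_sheafFunctor hD⟩
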